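/- Let $\log$ denote the logarithm to base $2$. For a function $f$, a function is $\tilde O(f)$ if it is $O\bigl(f\cdot(\log f)^{c}\bigr)$ for some constant $c$. Running times are measured on a random access machine with the logarithmic cost criterion: registers hold natural numbers of arbitrary size; the instructions are addition, truncated subtraction, multiplication, integer division and bitwise "and", with direct and indirect addressing, conditional branching and loops; each instruction costs the sum of the binary lengths of all the numbers and addresses it involves (up to an additive constant). There is a single deterministic algorithm with the following property. Let $n\equiv 1 \pmod 4$ be a positive integer, let $k=\nu_2(n-1)$ be the exponent of the exact power of $2$ dividing $n-1$, let $s=\lceil 2\log\log n\rceil$, and let $a$ and $u$ be integers with $1\le u\le k$ and $$a^{\frac{n-1}{2^u}}\equiv -1 \pmod n .$$ Then, given $n$, the residue of $a$ modulo $n$, and $u$, the algorithm decides whether $n$ is prime in time at most $$2^{2(u-1)}\cdot 2^{\max(s+2(u-1)-k,\,0)}\cdot g(n),\qquad\text{where } g(n)=\tilde O\bigl((\log n)^4\bigr)$$ is a function of $n$ alone; in particular the implied constants do not depend on $n$, $k$, $a$ or $u$. -/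

import Mathlib

/-! A random access machine with structured control flow and the logarithmic cost criterion.

Memory is an infinite array of registers, each holding a natural number of arbitrary size.
Programs are finite and fixed: they are built from assignments by sequencing, branching and
looping. Every access to an address or to a number is charged with its binary length, so that
nothing on `b` bits is ever done in fewer than `b` steps. -/

namespace RAM

/-- The memory: register `i` contains `σ i`. -/
abbrev Mem := ℕ → ℕ

/-- The logarithmic cost of a number: its binary length, `⌊log₂ x⌋ + 1`, and `1` for `x = 0`. -/
def len (x : ℕ) : ℕ := Nat.log 2 x + 1

/-- Operands: a literal, the content of a register, or (indirect addressing) the content of the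
register whose address is stored in register `i`. -/
inductive Operand where
  | lit (c : ℕ)
  | reg (i : ℕ)
  | ind (i : ℕ)

/-- The value of an operand. -/
def Operand.val (σ : Mem) : Operand → ℕ
  | .lit c => c
  | .reg i => σ i
  | .ind i => σ (σ i)

/-- The logarithmic cost of fetching an operand: the lengths of all addresses and contents
involved. -/
def Operand.cost (σ : Mem) : Operand → ℕ
  | .lit c => len c
  | .reg i => len i + len (σ i)
  | .ind i => len i + len (σ i) + len (σ (σ i))

/-- Destinations of an assignment, direct or indirect. -/
inductive Dest where
  | reg (i : ℕ)
  | ind (i : ℕ)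

/-- The address of the register that is written. -/
def Dest.addr (σ : Mem) : Dest → ℕ
  | .reg i => i
  | .ind i => σ i

/-- The logarithmic cost of addressing a destination. -/
def Dest.cost (σ : Mem) : Dest → ℕ
  | .reg i => len i
  | .ind i => len i + len (σ i)

/-- The operations of the machine: the four arithmetic operations (subtraction truncated at `0`,
integer division with `x / 0 = 0`) and bitwise conjunction. -/
inductive Op where
  | add
  | sub
  | mul
  | div
  | land

/-- The result of an operation. -/
def Op.eval : Op → ℕ → ℕ → ℕ
  | .add, x, y => x + y
  | .sub, x, y => x - y
  | .mul, x, y => x * y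
  | .div, x, y => x / y
  | .land, x, y => x &&& y

/-- Programs. `assign d o x y` is `d := x o y`; `ite x P Q` runs `P` if `x ≠ 0` and `Q` otherwise;
`loop x P` is `while x ≠ 0 do P`. -/
inductive Prog where
  | skip
  | assign (d : Dest) (o : Op) (x y : Operand)
  | seq (P Q : Prog)
  | ite (x : Operand) (P Q : Prog)
  | loop (x : Operand) (P : Prog)

/-- The cost of the assignment `d := x o y`: fetching both operands, addressing the destination
and writing the result. -/
def assignCost (σ : Mem) (d : Dest) (o : Op) (x y : Operand) : ℕ :=
  x.cost σ + y.cost σ + d.cost σ + len (o.eval (x.val σ) (y.val σ))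

/-- `P.Runs σ t τ`: started on the memory `σ`, the program `P` halts with the memory `τ`, at total
logarithmic cost `t`. -/
inductive Prog.Runs : Prog → Mem → ℕ → Mem → Prop where
  | skip (σ : Mem) : Prog.Runs .skip σ 1 σ
  | assign (σ : Mem) (d : Dest) (o : Op) (x y : Operand) :
      Prog.Runs (.assign d o x y) σ (assignCost σ d o x y)
        (Function.update σ (d.addr σ) (o.eval (x.val σ) (y.val σ)))
  | seq {P Q : Prog} {σ σ₁ σ₂ : Mem} {t₁ t₂ : ℕ} :
      Prog.Runs P σ t₁ σ₁ → Prog.Runs Q σ₁ t₂ σ₂ → Prog.Runs (.seq P Q) σ (t₁ + t₂) σ₂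
  | ite_true {x : Operand} {P Q : Prog} {σ τ : Mem} {t : ℕ} :
      x.val σ ≠ 0 → Prog.Runs P σ t τ → Prog.Runs (.ite x P Q) σ (x.cost σ + 1 + t) τ
  | ite_false {x : Operand} {P Q : Prog} {σ τ : Mem} {t : ℕ} :
      x.val σ = 0 → Prog.Runs Q σ t τ → Prog.Runs (.ite x P Q) σ (x.cost σ + 1 + t) τ
  | loop_true {x : Operand} {P : Prog} {σ σ₁ σ₂ : Mem} {t₁ t₂ : ℕ} :
      x.val σ ≠ 0 → Prog.Runs P σ t₁ σ₁ → Prog.Runs (.loop x P) σ₁ t₂ σ₂ →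
        Prog.Runs (.loop x P) σ (x.cost σ + 1 + t₁ + t₂) σ₂
  | loop_false {x : Operand} {P : Prog} {σ : Mem} :
      x.val σ = 0 → Prog.Runs (.loop x P) σ (x.cost σ + 1) σ

/-- The machine is deterministic: the final memory and the running time are determined by the
program and the initial memory. -/
theorem Prog.Runs.unique {P : Prog} {σ τ τ' : Mem} {t t' : ℕ}
    (h : P.Runs σ t τ) (h' : P.Runs σ t' τ') : t = t' ∧ τ = τ' := by
  induction h generalizing t' τ' with
  | skip => cases h'; exact ⟨rfl, rfl⟩
  | assign => cases h'; exact ⟨rfl, rfl⟩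
  | seq _ _ ih₁ ih₂ =>
    cases h' with
    | seq a b =>
      obtain ⟨rfl, rfl⟩ := ih₁ a
      obtain ⟨rfl, rfl⟩ := ih₂ b
      exact ⟨rfl, rfl⟩
  | ite_true hx _ ih =>
    cases h' with
    | ite_true _ a => obtain ⟨rfl, rfl⟩ := ih a; exact ⟨rfl, rfl⟩
    | ite_false hx' _ => exact absurd hx' hx
  | ite_false hx _ ih =>
    cases h' with
    | ite_true hx' _ => exact absurd hx hx'
    | ite_false _ a => obtain ⟨rfl, rfl⟩ := ih a; exact ⟨rfl, rfl⟩
  | loop_true hx _ _ ih₁ ih₂ =>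
    cases h' with
    | loop_true _ a b =>
      obtain ⟨rfl, rfl⟩ := ih₁ a
      obtain ⟨rfl, rfl⟩ := ih₂ b
      exact ⟨rfl, rfl⟩
    | loop_false hx' => exact absurd hx' hx
  | loop_false hx =>
    cases h' with
    | loop_true hx' _ _ => exact absurd hx hx'
    | loop_false _ => exact ⟨rfl, rfl⟩

/-- The initial memory for an input of three numbers: they are in the registers `0`, `1`, `2`, and
all other registers contain `0`. -/
def init (x y z : ℕ) : Mem
  | 0 => x
  | 1 => y
  | 2 => z
  | _ => 0

end RAM

/-- `g = Õ(f)`, that is, `g = O(f · poly(log f))`. -/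
def IsSoftO (g f : ℕ → ℝ) : Prop :=
  ∃ c : ℕ, g =O[Filter.atTop] fun n => f n * (Real.logb 2 (f n)) ^ c

/-! Write `n - 1 = 2 ^ k * (2 * q + 1)` and `v = u - 1`, and let `h = hh n`, so that `2 ^ h` has the
order of `log n` and `n ^ 4 < 2 ^ 2 ^ h`. The test is of Agrawal–Kayal–Saxena type in the Kummer
ring `(ℤ/n)[X]/(X ^ N - a)`, where `N = 2 ^ s` and `s = 2h + 2v`. It checks `(1 + c X) ^ n = 1 + c X
^ n` for only `C = 2 ^ (s - r)` constants `c`, where `r = min k s`.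

Correctness (`KummerTest.prime_of_tests`). Let `p` be the least prime factor of `n`, `A` the image
of `a` in `𝔽_p`, and `θ` an `N`-th root of `A` in an algebraic closure. Some power `ζ` of `A` has
order `2 ^ (r - v)` and is fixed by the exponents `n` and `p`. Replacing `x` by `ζ ^ t * x` turns
the tests for the `c` into tests for a set `S` of `2 ^ (s - v)` constants `c * ζ ^ t`. The points `θ
^ n ^ i` with `i < |S|` are distinct, because `n` has order `2 ^ (s - v)` modulo `2 ^ (k + s - v)`.
Hence the products of `1 + b θ` over the proper subsets of `S` are `2 ^ |S| - 1` distinct elements.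
Among the exponents `n ^ i * p ^ l` with `i, l ≤ R = √N`, two, `m` and `m'`, agree on `θ` and so on
all these products (`exists_pow_mul_pow_eq`). Since `n ^ (2R) < 2 ^ |S| - 1`, the polynomial `X ^ m
- X ^ m'` has too many roots unless `m = m'`. So `n` is a power of `p`, and the perfect power test
leaves `n = p`.

The constants. The `c * ζ ^ t` are distinct if the `c` have distinct nonzero `W`-th powers modulo
`p`, `W = 2 ^ (r - v)`. Trial division up to `M = W * C = 2 ^ (2h + v)` either settles the matter or
gives `p > M`. Then `1, …, M` have at least `M / W = C` different `W`-th powers modulo `p`, so the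
search for the `c` succeeds for composite `n` as well. One gcd with the product of all differences
certifies distinctness modulo `p`.

Running time. A polynomial is packed into one number by Kronecker substitution. Multiplication,
reduction modulo `X ^ N - a` and reduction of all coefficients modulo `n` then take boundedly many
instructions on `O(N log n)` bits, at linear cost each. With `O(log n)` ring operations per test,
`C` tests and `N = O((log n) ^ 2 * 2 ^ (2v))`, the total is `O(C * 2 ^ (2v) * (log n) ^ 4)`. Finally
`C = 2 ^ max (s - k) 0`, and this `s` exceeds `⌈2 log log n⌉ + 2v` by at most `8`. -/

namespace RAM

/-! ### Total correctness with running time -/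

/-- All registers hold numbers of at most `B` bits. -/
def Bdd (B : ℕ) (σ : Mem) : Prop := ∀ i, σ i < 2 ^ B

/-- Literals and directly named addresses fit into eight bits. -/
def Operand.small : Operand → Bool
  | .lit c => c < 256
  | .reg i => i < 256
  | .ind i => i < 256

/-- Directly named addresses fit into eight bits. -/
def Dest.small : Dest → Bool
  | .reg i => i < 256
  | .ind i => i < 256

/-- The program is loop-free and mentions only literals and addresses of at most eight bits. -/
def Prog.straight : Prog → Bool
  | .skip => true
  | .assign d _ x y => d.small && x.small && y.small
  | .seq P Q => P.straight && Q.straight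
  | .ite x P Q => x.small && P.straight && Q.straight
  | .loop _ _ => false

/-- The number of instructions of a loop-free program. -/
def Prog.size : Prog → ℕ
  | .skip => 1
  | .assign _ _ _ _ => 1
  | .seq P Q => P.size + Q.size
  | .ite _ P Q => 1 + P.size + Q.size
  | .loop _ _ => 0

/-- Weakest precondition of a loop-free program on memories with `B`-bit registers. -/
def wp (B : ℕ) : Prog → Mem → (Mem → Prop) → Prop
  | .skip, σ, Q => Q σ
  | .assign d .add x y, σ, Q => x.val σ + y.val σ < 2 ^ B ∧
      Q (Function.update σ (d.addr σ) (x.val σ + y.val σ))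
  | .assign d .mul x y, σ, Q => x.val σ * y.val σ < 2 ^ B ∧
      Q (Function.update σ (d.addr σ) (x.val σ * y.val σ))
  | .assign d .sub x y, σ, Q => Q (Function.update σ (d.addr σ) (x.val σ - y.val σ))
  | .assign d .div x y, σ, Q => Q (Function.update σ (d.addr σ) (x.val σ / y.val σ))
  | .assign d .land x y, σ, Q => Q (Function.update σ (d.addr σ) (x.val σ &&& y.val σ))
  | .seq P R, σ, Q => wp B P σ fun τ => wp B R τ Q
  | .ite x P R, σ, Q => (x.val σ ≠ 0 → wp B P σ Q) ∧ (x.val σ = 0 → wp B R σ Q)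
  | .loop _ _, _, _ => False

/-- Total correctness with a bound for the running time, on memories with `B`-bit registers. -/
def Tri (B k : ℕ) (P : Prog) (σ : Mem) (Q : Mem → Prop) : Prop :=
  Bdd B σ → ∃ t τ, P.Runs σ t τ ∧ t ≤ k * (9 * B) ∧ Bdd B τ ∧ Q τ

/-- A list of programs, run one after the other. -/
def blk : List Prog → Prog
  | [] => .skip
  | [P] => P
  | P :: Ps => .seq P (blk Ps)

theorem len_le {B x : ℕ} (hB : 8 ≤ B) (hx : x < 2 ^ B) : len x ≤ B := by
  unfold len
  rcases Nat.eq_zero_or_pos x with rfl | h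
  · simp; omega
  · have := Nat.log_lt_of_lt_pow h.ne' hx
    omega

theorem lt_two_pow_of_small {B x : ℕ} (hB : 8 ≤ B) (hx : x < 256) : x < 2 ^ B :=
  lt_of_lt_of_le hx (le_trans (by norm_num : 256 ≤ 2 ^ 8) (Nat.pow_le_pow_right (by norm_num) hB))

theorem Operand.cost_le {B : ℕ} (hB : 8 ≤ B) {σ : Mem} (hσ : Bdd B σ) {x : Operand}
    (hx : x.small = true) : x.cost σ ≤ 3 * B := by
  cases x with
  | lit c =>
    have := len_le hB (lt_two_pow_of_small hB (by simpa [Operand.small] using hx) : c < 2 ^ B)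
    simp only [Operand.cost]; omega
  | reg i =>
    have := len_le hB (lt_two_pow_of_small hB (by simpa [Operand.small] using hx) : i < 2 ^ B)
    have := len_le hB (hσ i)
    simp only [Operand.cost]; omega
  | ind i =>
    have := len_le hB (lt_two_pow_of_small hB (by simpa [Operand.small] using hx) : i < 2 ^ B)
    have := len_le hB (hσ i)
    have := len_le hB (hσ (σ i))
    simp only [Operand.cost]; omega

theorem Operand.val_lt {B : ℕ} (hB : 8 ≤ B) {σ : Mem} (hσ : Bdd B σ) {x : Operand}
    (hx : x.small = true) : x.val σ < 2 ^ B := by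
  cases x with
  | lit c => exact lt_two_pow_of_small hB (by simpa [Operand.small, Operand.val] using hx)
  | reg i => exact hσ i
  | ind i => exact hσ _

theorem Dest.cost_le {B : ℕ} (hB : 8 ≤ B) {σ : Mem} (hσ : Bdd B σ) {d : Dest}
    (hd : d.small = true) : d.cost σ ≤ 2 * B := by
  cases d with
  | reg i =>
    have := len_le hB (lt_two_pow_of_small hB (by simpa [Dest.small] using hd) : i < 2 ^ B)
    simp only [Dest.cost]; omega
  | ind i =>
    have := len_le hB (lt_two_pow_of_small hB (by simpa [Dest.small] using hd) : i < 2 ^ B)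
    have := len_le hB (hσ i)
    simp only [Dest.cost]; omega

theorem Bdd.update {B : ℕ} {σ : Mem} (hσ : Bdd B σ) {i x : ℕ} (hx : x < 2 ^ B) :
    Bdd B (Function.update σ i x) := by
  intro j
  by_cases h : j = i
  · subst h; simpa using hx
  · simpa [Function.update_of_ne h] using hσ j

/-- Two operands cost at most `3 * B` each, the destination `2 * B` and the result `B`; this is the
unit `9 * B` in which `Tri` counts. -/
theorem Tri.assign {B : ℕ} (hB : 8 ≤ B) {σ : Mem} {d : Dest} {o : Op} {x y : Operand}
    {Q : Mem → Prop} (hs : (Prog.assign d o x y).straight = true)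
    (hv : Bdd B σ → o.eval (x.val σ) (y.val σ) < 2 ^ B)
    (hQ : Q (Function.update σ (d.addr σ) (o.eval (x.val σ) (y.val σ)))) :
    Tri B 1 (.assign d o x y) σ Q := by
  intro hσ
  simp only [Prog.straight, Bool.and_eq_true] at hs
  refine ⟨_, _, Prog.Runs.assign σ d o x y, ?_, hσ.update (hv hσ), hQ⟩
  have h1 := Operand.cost_le hB hσ hs.1.2
  have h2 := Operand.cost_le hB hσ hs.2
  have h3 := Dest.cost_le hB hσ hs.1.1
  have h4 := len_le hB (hv hσ)
  simp only [assignCost]; omega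

/-- Subtraction, division and conjunction never exceed their left operand, so `wp` needs overflow
conditions only for addition and multiplication. Each instruction and each test costs at most one
unit. -/
theorem Tri.of_wp {B : ℕ} (hB : 8 ≤ B) {P : Prog} {σ : Mem} {Q : Mem → Prop}
    (hs : P.straight = true) (h : Bdd B σ → wp B P σ Q) : Tri B P.size P σ Q := by
  induction P generalizing σ Q with
  | skip =>
    intro hσ
    exact ⟨1, σ, .skip σ, by simp only [Prog.size]; omega, hσ, h hσ⟩
  | assign d o x y =>
    intro hσ
    have hw := h hσ
    have hs' := hs
    simp only [Prog.straight, Bool.and_eq_true] at hs'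
    have hx := Operand.val_lt hB hσ hs'.1.2
    cases o with
    | add => exact Tri.assign hB hs (fun _ => hw.1) hw.2 hσ
    | mul => exact Tri.assign hB hs (fun _ => hw.1) hw.2 hσ
    | sub => exact Tri.assign hB hs (fun _ => lt_of_le_of_lt (Nat.sub_le _ _) hx) hw hσ
    | div => exact Tri.assign hB hs (fun _ => lt_of_le_of_lt (Nat.div_le_self _ _) hx) hw hσ
    | land => exact Tri.assign hB hs (fun _ => lt_of_le_of_lt Nat.and_le_left hx) hw hσ
  | seq P R ihP ihR =>
    intro hσ
    simp only [Prog.straight, Bool.and_eq_true] at hs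
    obtain ⟨t, τ, h1, h2, h3, h4⟩ := ihP hs.1 (fun _ => h hσ) hσ
    obtain ⟨t', τ', h1', h2', h3', h4'⟩ := ihR hs.2 (fun _ => h4) h3
    refine ⟨_, τ', .seq h1 h1', ?_, h3', h4'⟩
    simp only [Prog.size, add_mul]; omega
  | ite x P R ihP ihR =>
    intro hσ
    simp only [Prog.straight, Bool.and_eq_true] at hs
    have hc := Operand.cost_le hB hσ hs.1.1
    by_cases hx : x.val σ = 0
    · obtain ⟨t', τ', h1', h2', h3', h4'⟩ := ihR hs.2 (fun _ => (h hσ).2 hx) hσ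
      refine ⟨_, τ', .ite_false hx h1', ?_, h3', h4'⟩
      simp only [Prog.size, add_mul]; omega
    · obtain ⟨t', τ', h1', h2', h3', h4'⟩ := ihP hs.1.2 (fun _ => (h hσ).1 hx) hσ
      refine ⟨_, τ', .ite_true hx h1', ?_, h3', h4'⟩
      simp only [Prog.size, add_mul]; omega
  | loop x P ih => simp [Prog.straight] at hs

theorem Tri.mono {B k k' : ℕ} {P : Prog} {σ : Mem} {Q Q' : Mem → Prop}
    (h : Tri B k P σ Q) (hk : k ≤ k') (hQ : ∀ τ, Bdd B τ → Q τ → Q' τ) : Tri B k' P σ Q' := by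
  intro hσ
  obtain ⟨t, τ, h1, h2, h3, h4⟩ := h hσ
  exact ⟨t, τ, h1, h2.trans (Nat.mul_le_mul_right _ hk), h3, hQ τ h3 h4⟩

theorem Tri.seq {B k₁ k₂ : ℕ} {P R : Prog} {σ : Mem} {Q : Mem → Prop}
    (h : Tri B k₁ P σ fun τ => Tri B k₂ R τ Q) : Tri B (k₁ + k₂) (.seq P R) σ Q := by
  intro hσ
  obtain ⟨t, τ, h1, h2, h3, h4⟩ := h hσ
  obtain ⟨t', τ', h1', h2', h3', h4'⟩ := h4 h3
  refine ⟨_, τ', .seq h1 h1', ?_, h3', h4'⟩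
  rw [add_mul]; omega

theorem Tri.cons {B k₁ k₂ : ℕ} {P P' : Prog} {Ps : List Prog} {σ : Mem} {Q Q' : Mem → Prop}
    (h : Tri B k₁ P σ Q') (h' : ∀ τ, Q' τ → Tri B k₂ (blk (P' :: Ps)) τ Q) :
    Tri B (k₁ + k₂) (blk (P :: P' :: Ps)) σ Q :=
  Tri.seq (h.mono le_rfl fun τ _ => h' τ)

theorem Tri.ite {B k : ℕ} (hB : 8 ≤ B) {x : Operand} {P R : Prog} {σ : Mem} {Q : Mem → Prop}
    (hx : x.small = true) (h1 : x.val σ ≠ 0 → Tri B k P σ Q) (h2 : x.val σ = 0 → Tri B k R σ Q) :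
    Tri B (k + 1) (.ite x P R) σ Q := by
  intro hσ
  have hc := Operand.cost_le hB hσ hx
  by_cases hx : x.val σ = 0
  · obtain ⟨t', τ', h1', h2', h3', h4'⟩ := h2 hx hσ
    refine ⟨_, τ', .ite_false hx h1', ?_, h3', h4'⟩
    rw [add_mul]; omega
  · obtain ⟨t', τ', h1', h2', h3', h4'⟩ := h1 hx hσ
    refine ⟨_, τ', .ite_true hx h1', ?_, h3', h4'⟩
    rw [add_mul]; omega

/-- The rule for loops: `I m` is an invariant indexed by a bound for the number of remaining
rounds. -/
theorem Tri.loop {B k : ℕ} (hB : 8 ≤ B) {x : Operand} {P : Prog} (hx : x.small = true)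
    (I : ℕ → Mem → Prop) (h0 : ∀ τ, I 0 τ → x.val τ = 0)
    (h : ∀ i τ, I (i + 1) τ → x.val τ ≠ 0 → Tri B k P τ (I i)) {m : ℕ} {σ : Mem} (hI : I m σ) :
    Tri B (m * (k + 1) + 1) (.loop x P) σ fun τ => (∃ i, I i τ) ∧ x.val τ = 0 := by
  induction m generalizing σ with
  | zero =>
    intro hσ
    have hc := Operand.cost_le hB hσ hx
    refine ⟨_, σ, .loop_false (h0 σ hI), ?_, hσ, ⟨0, hI⟩, h0 σ hI⟩
    omega
  | succ m ih =>
    intro hσ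
    have hc := Operand.cost_le hB hσ hx
    by_cases hz : x.val σ = 0
    · refine ⟨_, σ, .loop_false hz, ?_, hσ, ⟨m + 1, hI⟩, hz⟩
      rw [add_mul]; omega
    · obtain ⟨t, τ, h1, h2, h3, h4⟩ := h m σ hI hz hσ
      obtain ⟨t', τ', h1', h2', h3', h4'⟩ := ih h4 h3
      refine ⟨_, τ', .loop_true hz h1 h1', ?_, h3', h4'⟩
      have e : ((m + 1) * (k + 1) + 1) * (9 * B)
          = (m * (k + 1) + 1) * (9 * B) + k * (9 * B) + 9 * B := by ring
      omega

theorem blk_singleton (P : Prog) : blk [P] = P := rfl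

theorem blk_cons (P P' : Prog) (Ps : List Prog) :
    blk (P :: P' :: Ps) = .seq P (blk (P' :: Ps)) := rfl

/-! ### Binary length and the parameters of the test -/

/-- `d := x + y`. -/
abbrev addP (d : ℕ) (x y : Operand) : Prog := .assign (.reg d) .add x y

/-- `d := x - y`. -/
abbrev subP (d : ℕ) (x y : Operand) : Prog := .assign (.reg d) .sub x y

/-- `d := x * y`. -/
abbrev mulP (d : ℕ) (x y : Operand) : Prog := .assign (.reg d) .mul x y

/-- `d := x / y`. -/
abbrev divP (d : ℕ) (x y : Operand) : Prog := .assign (.reg d) .div x y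

/-- `d := x && y`. -/
abbrev andP (d : ℕ) (x y : Operand) : Prog := .assign (.reg d) .land x y

open Operand

set_option linter.unusedSimpArgs false

/-- `c := size x` and `d := 2 ^ size x`, where `x` is in register `12`, which is destroyed. -/
def sizeP (c d : ℕ) : Prog := blk [
  blk [addP c (lit 0) (lit 0), addP d (lit 1) (lit 0)],
  .loop (reg 12) (blk [divP 12 (reg 12) (lit 2), addP c (reg c) (lit 1), mulP d (reg d) (lit 2)])]

theorem size_div_two {x : ℕ} (hx : x ≠ 0) : x.size = (x / 2).size + 1 := by
  conv_lhs => rw [← Nat.bit_bodd_div2 x]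
  rw [Nat.size_bit (by rwa [Nat.bit_bodd_div2]), Nat.div2_val]

theorem sizeP_spec {B : ℕ} (hB : 8 ≤ B) {c d : ℕ} (hc : c < 256) (hd : d < 256) (hcd : c ≠ d)
    (hc' : c ≠ 12) (hd' : d ≠ 12) {σ : Mem} (h : 2 ^ (σ 12).size < 2 ^ B) :
    Tri B (4 * (σ 12).size + 3) (sizeP c d) σ fun τ =>
      τ c = (σ 12).size ∧ τ d = 2 ^ (σ 12).size ∧ ∀ j, j ∉ [c, d, 12] → τ j = σ j := by
  have h1 : (1 : ℕ) < 2 ^ B := lt_two_pow_of_small hB (by norm_num)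
  refine (Tri.cons (k₁ := 2) (k₂ := (σ 12).size * (3 + 1) + 1)
    (Q' := fun τ => τ c = 0 ∧ τ d = 1 ∧ ∀ j, j ∉ [c, d] → τ j = σ j) ?_ ?_).mono (by omega)
    (fun τ _ => id)
  · refine Tri.of_wp hB (by simp [blk, Prog.straight, Dest.small, small, hc, hd]) fun hσ => ?_
    simp [blk_cons, blk_singleton, wp, val, Dest.addr, Function.update_apply, hcd]
    exact ⟨by omega, fun j h1 h2 => by simp [h1, h2]⟩
  · rintro τ ⟨hτc, hτd, hτ⟩
    rw [blk_singleton]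
    refine (Tri.loop hB rfl (fun i ρ => (ρ 12).size = i ∧ ρ c + i = (σ 12).size ∧
      ρ d = 2 ^ ρ c ∧ ∀ j, j ∉ [c, d, 12] → ρ j = σ j) ?_ ?_ ?_).mono le_rfl ?_
    · rintro ρ ⟨h, -⟩
      exact Nat.size_eq_zero.1 h
    · rintro i ρ ⟨hi, hci, hdi, hj⟩ h0
      refine Tri.of_wp hB (by simp [blk, Prog.straight, Dest.small, small, hc, hd]) fun hσ => ?_
      simp only [val] at h0
      rw [size_div_two h0] at hi
      have h2 : 2 ^ (ρ c + 1) < 2 ^ B :=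
        lt_of_le_of_lt (Nat.pow_le_pow_right (by norm_num) (by omega)) h
      have h3 : ρ c + 1 < 2 ^ (ρ c + 1) := Nat.lt_two_pow_self
      simp [blk_cons, blk_singleton, wp, val, Dest.addr, Function.update_apply, hcd, hcd.symm,
        hc', hd', hc'.symm, hd'.symm]
      refine ⟨by omega, by rwa [hdi, ← pow_succ], by omega, by omega, by rw [hdi, pow_succ], ?_⟩
      intro j h1 h2 h3
      simp [h1, h2, h3, hj j (by simp [h1, h2, h3])]
    · exact ⟨by rw [hτ 12 (by simp [hc'.symm, hd'.symm])], by omega, by rw [hτc, hτd, pow_zero],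
        fun j hj => hτ j (by simp at hj ⊢; tauto)⟩
    · rintro ρ - ⟨⟨i, hi, hci, hdi, hj⟩, h0⟩
      simp only [val] at h0
      rw [h0, Nat.size_zero] at hi
      subst hi
      exact ⟨hci, by rw [hdi, ← hci, add_zero], hj⟩

/-- `⌈log₂⌉` of the square root of the length scale: `4 * size n < 2 ^ hh n ≤ 8 * size n`. -/
def hh (n : ℕ) : ℕ := (4 * n.size).size

/-- The parameters of the test, with `n - 1 = 2 ^ k * odd` and `v = u - 1`. -/
structure Params (n a k v : ℕ) (σ : Mem) : Prop where
  eq_n : σ 0 = n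
  eq_a : σ 1 = a
  eq_L : σ 3 = n.size
  eq_V : σ 5 = 2 ^ v
  eq_M : σ 7 = 2 ^ (2 * hh n + v)
  eq_N : σ 8 = 2 ^ (2 * hh n + 2 * v)
  eq_C : σ 9 = 2 ^ (2 * hh n + 2 * v - min k (2 * hh n + 2 * v))
  eq_W : σ 10 = 2 ^ (min k (2 * hh n + 2 * v) - v)
  eq_P : σ 13 = 2 ^ n.size

/-- Frame rule: the checks overwrite scratch registers only, so the parameters survive them. -/
theorem Params.congr {n a k v : ℕ} {σ τ : Mem} (h : Params n a k v σ)
    (hτ : ∀ j ∈ [0, 1, 3, 5, 7, 8, 9, 10, 13], τ j = σ j) : Params n a k v τ where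
  eq_n := (hτ 0 (by simp)).trans h.eq_n
  eq_a := (hτ 1 (by simp)).trans h.eq_a
  eq_L := (hτ 3 (by simp)).trans h.eq_L
  eq_V := (hτ 5 (by simp)).trans h.eq_V
  eq_M := (hτ 7 (by simp)).trans h.eq_M
  eq_N := (hτ 8 (by simp)).trans h.eq_N
  eq_C := (hτ 9 (by simp)).trans h.eq_C
  eq_W := (hτ 10 (by simp)).trans h.eq_W
  eq_P := (hτ 13 (by simp)).trans h.eq_P

/-- Bitwise conjunction acts separately on the digits in base `2 ^ w`. -/
theorem land_add_mul {w x y x' y' : ℕ} (hx : x < 2 ^ w) (hy : y < 2 ^ w) :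
    (x + 2 ^ w * x') &&& (y + 2 ^ w * y') = (x &&& y) + 2 ^ w * (x' &&& y') := by
  have hxy : x &&& y < 2 ^ w := lt_of_le_of_lt Nat.and_le_left hx
  apply Nat.eq_of_testBit_eq
  intro i
  rw [add_comm x, add_comm y, add_comm (x &&& y), Nat.testBit_and,
    Nat.testBit_two_pow_mul_add _ hx, Nat.testBit_two_pow_mul_add _ hy,
    Nat.testBit_two_pow_mul_add _ hxy]
  split_ifs <;> simp

/-- Passing from `x` to `x - 1` flips exactly the bits up to the lowest set one, so the conjunction
clears that bit and nothing else. For `x = n - 1` this extracts `2 ^ k` without a loop. -/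
theorem sub_land_pred {x k q : ℕ} (hx : x = 2 ^ k * (2 * q + 1)) :
    x - (x &&& (x - 1)) = 2 ^ k := by
  have hk : 0 < 2 ^ k := by positivity
  have e1 : x = 0 + 2 ^ k * (2 * q + 1) := by omega
  have e2 : x - 1 = (2 ^ k - 1) + 2 ^ k * (2 * q) := by
    rw [hx, mul_add, mul_one]; omega
  have e3 : (2 * q + 1) &&& (2 * q) = 2 * q := by
    have := land_add_mul (w := 1) (x := 1) (y := 0) (x' := q) (y' := q) (by norm_num) (by norm_num)
    simpa [add_comm] using this
  have e4 : x &&& (x - 1) = 2 ^ k * (2 * q) := by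
    rw [e2]
    nth_rw 1 [e1]
    rw [land_add_mul hk (by omega), e3]
    simp
  rw [e4, hx, mul_add, mul_one]
  omega

/-- Computation of the parameters. -/
def setupP : Prog := blk [
  addP 12 (reg 0) (lit 0),
  sizeP 3 13,
  blk [subP 12 (reg 0) (lit 1), subP 14 (reg 12) (lit 1), andP 14 (reg 12) (reg 14),
    subP 4 (reg 12) (reg 14), addP 5 (lit 1) (lit 0), subP 12 (reg 2) (lit 1)],
  .loop (reg 12) (blk [mulP 5 (reg 5) (lit 2), subP 12 (reg 12) (lit 1)]),
  mulP 12 (reg 3) (lit 4),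
  sizeP 15 6,
  blk [mulP 14 (reg 6) (reg 5), mulP 7 (reg 6) (reg 14), mulP 8 (reg 14) (reg 14),
    subP 12 (reg 8) (reg 4), subP 12 (reg 8) (reg 12), divP 9 (reg 8) (reg 12),
    divP 10 (reg 12) (reg 5), addP 11 (lit 1) (lit 0)]]

theorem setupP_spec {B n a k v q : ℕ} (hB : 8 + 4 * n.size + 2 * hh n + 2 * v ≤ B)
    (hn : n - 1 = 2 ^ k * (2 * q + 1)) (hv : v < k) :
    Tri B (4 * n.size + 3 * v + 4 * hh n + 24) setupP (init n a (v + 1)) fun τ =>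
      Params n a k v τ ∧ τ 11 = 1 := by
  have hB' : 8 ≤ B := by omega
  have hp : ∀ {p}, p < B → 2 ^ p < 2 ^ B := fun h => Nat.pow_lt_pow_right (by norm_num) h
  refine (Tri.cons (k₁ := 1) (k₂ := 4 * n.size + 3 + (6 + ((v * (2 + 1) + 1) + (1 +
    ((4 * hh n + 3) + 8)))))
    (Q' := fun τ => τ 12 = n ∧ τ 0 = n ∧ τ 1 = a ∧ τ 2 = v + 1) ?_ ?_).mono (by omega)
    (fun τ _ => id)
  · refine Tri.of_wp hB' rfl fun hσ => ?_
    have := hσ 0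
    simp [wp, val, Dest.addr, init] at this ⊢
    exact this
  rintro σ₁ ⟨h12, h0, h1, h2⟩
  refine Tri.cons ((sizeP_spec (c := 3) (d := 13) hB' (by norm_num) (by norm_num) (by norm_num)
    (by norm_num) (by norm_num) (hp (by rw [h12]; omega))).mono (by rw [h12]) fun _ _ => id) ?_
  rintro σ₂ ⟨h3, h13, hσ₂⟩
  rw [h12] at h3 h13
  rw [← hσ₂ 0 (by simp)] at h0
  rw [← hσ₂ 1 (by simp)] at h1
  rw [← hσ₂ 2 (by simp)] at h2
  clear hσ₂ h12
  refine Tri.cons (Q' := fun τ => τ 0 = n ∧ τ 1 = a ∧ τ 3 = n.size ∧ τ 13 = 2 ^ n.size ∧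
    τ 4 = 2 ^ k ∧ τ 5 = 1 ∧ τ 12 = v) (Tri.of_wp hB' rfl fun hσ => ?_) ?_
  · have := lt_two_pow_of_small hB' (show 1 < 256 by norm_num)
    simp [blk_cons, blk_singleton, wp, val, Dest.addr, Function.update_apply, h0, h1, h2, h3, h13]
    exact ⟨by omega, sub_land_pred hn⟩
  rintro σ₃ ⟨h0, h1, h3, h13, h4, h5, h12⟩
  refine Tri.cons ((Tri.loop hB' rfl (fun i τ => τ 0 = n ∧ τ 1 = a ∧ τ 3 = n.size ∧
    τ 13 = 2 ^ n.size ∧ τ 4 = 2 ^ k ∧ τ 12 = i ∧ ∃ j, j + i = v ∧ τ 5 = 2 ^ j) ?_ ?_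
      ⟨h0, h1, h3, h13, h4, h12, 0, by omega, h5⟩).mono le_rfl fun _ _ => id) ?_
  · rintro τ ⟨-, -, -, -, -, h, -⟩; exact h
  · rintro i τ ⟨h0, h1, h3, h13, h4, h12, j, hj, h5⟩ -
    refine Tri.of_wp hB' rfl fun hσ => ?_
    simp [blk_cons, blk_singleton, wp, val, Dest.addr, Function.update_apply, h0, h1, h3, h13, h4,
      h5, h12]
    exact ⟨by rw [← pow_succ]; exact hp (by omega), j + 1, by omega, by rw [pow_succ]⟩
  rintro σ₄ ⟨⟨i, h0, h1, h3, h13, h4, hi, j, hj, h5⟩, h12⟩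
  obtain rfl : j = v := by simp only [val] at h12; omega
  refine Tri.cons (Q' := fun τ => τ 0 = n ∧ τ 1 = a ∧ τ 3 = n.size ∧ τ 13 = 2 ^ n.size ∧
    τ 4 = 2 ^ k ∧ τ 5 = 2 ^ j ∧ τ 12 = 4 * n.size) (Tri.of_wp hB' rfl fun hσ => ?_) ?_
  · simp [wp, val, Dest.addr, Function.update_apply, h0, h1, h3, h13, h4, h5]
    refine ⟨?_, mul_comm _ _⟩
    have : n.size < 2 ^ n.size := Nat.lt_two_pow_self
    have : 2 ^ (n.size + 2) < 2 ^ B := hp (by omega)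
    rw [pow_add] at this
    omega
  rintro σ₅ ⟨h0, h1, h3, h13, h4, h5, h12⟩
  have e : (4 * n.size).size = hh n := rfl
  refine Tri.cons ((sizeP_spec (c := 15) (d := 6) hB' (by norm_num) (by norm_num) (by norm_num)
    (by norm_num) (by norm_num) (hp (by rw [h12, e]; omega))).mono (by rw [h12, e]) fun _ _ => id) ?_
  rintro σ₆ ⟨h15, h6, hσ₆⟩
  rw [h12, e] at h15 h6
  rw [← hσ₆ _ (by simp)] at h0 h1 h3 h13 h4 h5
  clear hσ₆ h12 e
  -- Truncated subtraction computes minima as `x - (x - y) = min x y`; for powers of two this is the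
  -- minimum of the exponents.
  have hm : 2 ^ (2 * hh n + 2 * j) - (2 ^ (2 * hh n + 2 * j) - 2 ^ k)
      = 2 ^ min k (2 * hh n + 2 * j) := by
    rcases le_total k (2 * hh n + 2 * j) with h | h
    · rw [min_eq_left h]
      have := Nat.pow_le_pow_right (show 0 < 2 by norm_num) h
      omega
    · rw [min_eq_right h, Nat.sub_eq_zero_of_le (Nat.pow_le_pow_right (by norm_num) h),
        Nat.sub_zero]
  have e1 : 2 ^ hh n * (2 ^ hh n * 2 ^ j) = 2 ^ (2 * hh n + j) := by
    rw [← pow_add, ← pow_add]; congr 1; ring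
  have e2 : 2 ^ hh n * 2 ^ j * (2 ^ hh n * 2 ^ j) = 2 ^ (2 * hh n + 2 * j) := by
    rw [← pow_add, ← pow_add]; congr 1; ring
  rw [blk_singleton]
  refine Tri.of_wp hB' rfl fun hσ => ?_
  have := lt_two_pow_of_small hB' (show 1 < 256 by norm_num)
  simp [blk_cons, blk_singleton, wp, val, Dest.addr, Function.update_apply, h4, h5, h6, e1, e2, hm]
  rw [← pow_add]
  refine ⟨hp (by omega), hp (by omega), hp (by omega), by omega, ?_⟩
  constructor <;> simp [h0, h1, h3, h13, h5]
  · rw [Nat.pow_div (min_le_right _ _) (by norm_num)]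
  · rw [Nat.pow_div (le_min (by omega) (by omega)) (by norm_num)]

/-! ### Trial division -/

/-- Register `11` is the verdict so far: it is `1` if `n` is prime, and if it is `1` then the
checks `A` have been passed. -/
def Flag (n : ℕ) (A : Prop) (σ : Mem) : Prop :=
  σ 11 ≤ 1 ∧ (n.Prime → σ 11 = 1) ∧ (σ 11 = 1 → A)

theorem Flag.congr {n : ℕ} {A A' : Prop} {σ τ : Mem} (h : Flag n A σ) (hτ : τ 11 = σ 11)
    (hA : A → A') : Flag n A' τ := by
  rw [Flag, hτ]; exact ⟨h.1, h.2.1, fun h' => hA (h.2.2 h')⟩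

theorem Flag.zero {n : ℕ} {A : Prop} {τ : Mem} (hτ : τ 11 = 0) (hn : ¬ n.Prime) : Flag n A τ := by
  rw [Flag, hτ]; exact ⟨by omega, fun h => absurd h hn, by omega⟩

/-- The machine has no remainder instruction; remainders are formed in this way. -/
theorem sub_div_mul (x y : ℕ) : x - x / y * y = x % y := by
  have := Nat.div_add_mod' x y
  omega

theorem div_mul_lt {B x y : ℕ} (hx : x < 2 ^ B) : x / y * y < 2 ^ B :=
  lt_of_le_of_lt (Nat.div_mul_le_self _ _) hx

/-- Trial division by all numbers from `2` to `min (n - 1) M`. -/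
def trialP : Prog := blk [
  blk [subP 12 (reg 0) (lit 1), subP 14 (reg 12) (reg 7), subP 12 (reg 12) (reg 14),
    subP 14 (reg 12) (lit 1)],
  .loop (reg 14) (blk [addP 12 (reg 14) (lit 1), divP 15 (reg 0) (reg 12), mulP 15 (reg 15) (reg 12),
    subP 15 (reg 0) (reg 15), .ite (reg 15) .skip (addP 11 (lit 0) (lit 0)),
    subP 14 (reg 14) (lit 1)])]

theorem trialP_spec {B n a k v : ℕ} {A : Prop} (hB : 8 ≤ B) (hn : 1 < n) {σ : Mem}
    (hσ : Params n a k v σ) (hf : Flag n A σ) :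
    Tri B (9 * 2 ^ (2 * hh n + v) + 5) trialP σ fun τ => Params n a k v τ ∧
      Flag n (A ∧ ∀ c, 2 ≤ c → c < n → c ≤ 2 ^ (2 * hh n + v) → ¬ c ∣ n) τ := by
  -- This is the minimum of `n - 1` and the bound for the divisors. Stopping at `n - 1` keeps `n`
  -- from being tried as its own divisor.
  obtain ⟨m, hm⟩ : ∃ m, m = n - 1 - (n - 1 - 2 ^ (2 * hh n + v)) := ⟨_, rfl⟩
  have hm1 : ∀ c, c < n → c ≤ 2 ^ (2 * hh n + v) → c ≤ m := by omega
  refine (Tri.cons (k₁ := 4) (k₂ := (m - 1) * (8 + 1) + 1)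
    (Q' := fun τ => Params n a k v τ ∧ τ 14 = m - 1 ∧ Flag n A τ) ?_ ?_).mono (by omega)
    fun _ _ => id
  · refine Tri.of_wp hB rfl fun hb => ?_
    simp [blk_cons, blk_singleton, wp, val, Dest.addr, Function.update_apply, hσ.eq_n, hσ.eq_M]
    exact ⟨hσ.congr (by simp [Function.update_apply]), by rw [hm], hf.congr rfl id⟩
  · rintro τ ⟨hP, h14, hF⟩
    rw [blk_singleton]
    refine (Tri.loop hB rfl (fun i τ => τ 14 = i ∧ i + 1 < n ∧ Params n a k v τ ∧
      Flag n (A ∧ ∀ c, i + 2 ≤ c → c < n → c ≤ 2 ^ (2 * hh n + v) → ¬ c ∣ n) τ) ?_ ?_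
        ⟨h14, by omega, hP, ?_⟩).mono le_rfl ?_
    · rintro τ ⟨h, -⟩; exact h
    · rintro i τ ⟨hi, hin, hP, hF⟩ -
      refine Tri.of_wp hB rfl fun hb => ?_
      have h0 := hb 0
      simp [blk_cons, blk_singleton, wp, val, Dest.addr, Function.update_apply, hP.eq_n, hi,
        sub_div_mul] at h0 ⊢
      refine ⟨by omega, div_mul_lt h0, fun h => ⟨by omega,
        hP.congr (by simp [Function.update_apply]), hF.congr rfl fun h' => ⟨h'.1,
          fun c h1 h2 h3 => ?_⟩⟩, fun h => ⟨by omega,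
        hP.congr (by simp [Function.update_apply]), Flag.zero rfl ?_⟩⟩
      · rcases (show i + 2 = c ∨ i + 1 + 2 ≤ c by omega) with rfl | hc
        · rwa [Nat.dvd_iff_mod_eq_zero]
        · exact h'.2 c hc h2 h3
      · intro hp
        rcases (Nat.dvd_prime hp).1 (Nat.dvd_of_mod_eq_zero h) with h | h <;> omega
    · exact hF.congr rfl fun h => ⟨h, fun c h1 h2 h3 => by have := hm1 c h2 h3; omega⟩
    · rintro ρ - ⟨⟨i, hi, -, hP, hF⟩, h0⟩
      obtain rfl : i = 0 := hi.symm.trans h0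
      exact ⟨hP, hF⟩

/-! ### Perfect powers -/

/-- Saturated exponentiation: `r₁₈ := min (r₁₈ * r₁₇ ^ r₁₉) r₂₁`. -/
def satP : Prog :=
  .loop (reg 19) (blk [mulP 18 (reg 18) (reg 17), subP 20 (reg 18) (reg 21),
    subP 18 (reg 18) (reg 20), subP 19 (reg 19) (lit 1)])

/-- Once the cap is reached, multiplication by a positive number stays at or above it, so the
product may be capped after every factor. All intermediate values are then at most `r₂₁ * r₁₇`. -/
theorem satP_spec {B : ℕ} (hB : 8 ≤ B) {σ : Mem} (h17 : 0 < σ 17) (h18 : σ 18 ≤ σ 21)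
    (h : σ 21 * σ 17 < 2 ^ B) :
    Tri B (5 * σ 19 + 1) satP σ fun τ => τ 18 = min (σ 18 * σ 17 ^ σ 19) (σ 21) ∧
      ∀ j, j ∉ [18, 19, 20] → τ j = σ j := by
  refine (Tri.loop hB (k := 4) rfl (fun i τ => τ 19 = i ∧ (∀ j, j ∉ [18, 19, 20] → τ j = σ j) ∧
    ∃ e, e + i = σ 19 ∧ τ 18 = min (σ 18 * σ 17 ^ e) (σ 21)) ?_ ?_
      ⟨rfl, fun _ _ => rfl, 0, by omega, by simp [h18]⟩).mono (le_of_eq (by ring)) ?_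
  · rintro τ ⟨h, -⟩; exact h
  · rintro i τ ⟨hi, hj, e, he, hτ⟩ -
    refine Tri.of_wp hB rfl fun hb => ?_
    have e17 := hj 17 (by simp)
    have e21 := hj 21 (by simp)
    have hlt : τ 18 * σ 17 < 2 ^ B :=
      lt_of_le_of_lt (Nat.mul_le_mul_right _ (hτ ▸ min_le_right _ _)) h
    simp [blk_cons, blk_singleton, wp, val, Dest.addr, Function.update_apply, e17, e21, hi]
    refine ⟨hlt, fun j h1 h2 h3 => ?_, e + 1, by omega, ?_⟩
    · simp [h1, h2, h3, hj j (by simp [h1, h2, h3])]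
    · have hm : ∀ x y : ℕ, x - (x - y) = min x y := by omega
      rw [hm, hτ, pow_succ, ← mul_assoc]
      rcases le_total (σ 18 * σ 17 ^ e) (σ 21) with h' | h'
      · rw [min_eq_left h']
      · rw [min_eq_right h', min_eq_right (h'.trans (Nat.le_mul_of_pos_right _ h17)),
          min_eq_right (Nat.le_mul_of_pos_right _ h17)]
  · rintro τ - ⟨⟨i, hi, hj, e, he, hτ⟩, h0⟩
    obtain rfl : i = 0 := hi.symm.trans h0
    obtain rfl : e = σ 19 := he
    exact ⟨hτ, hj⟩

/-- Bitwise search for a root of `n` of order `r₁₄ + 1`. -/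
def rootP : Prog :=
  .loop (reg 16) (blk [
    blk [addP 17 (reg 15) (reg 16), addP 18 (lit 1) (lit 0), addP 19 (reg 14) (lit 1)],
    satP,
    blk [subP 20 (reg 21) (reg 18),
      .ite (reg 20) (blk [addP 15 (reg 17) (lit 0), subP 20 (reg 0) (reg 18),
        .ite (reg 20) .skip (addP 11 (lit 0) (lit 0))]) .skip,
      divP 16 (reg 16) (lit 2)]])

theorem rootP_spec {B n a k v d : ℕ} {A : Prop} (hB : 8 + 4 * n.size ≤ B) (hn : 1 < n)
    (hd : 0 < d) (hdn : d < n.size) {σ : Mem} (hσ : Params n a k v σ) (hf : Flag n A σ)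
    (h14 : σ 14 = d) (h15 : σ 15 = 0) (h16 : σ 16 = 2 ^ n.size) (h21 : σ 21 = n + 1) :
    Tri B (20 * (n.size + 1) * (n.size + 1)) rootP σ fun τ => Params n a k v τ ∧
      Flag n (A ∧ ∀ y, y ^ (d + 1) ≠ n) τ ∧ τ 14 = d ∧ τ 21 = n + 1 := by
  have hB' : 8 ≤ B := by omega
  have hp : ∀ {p}, p < B → 2 ^ p < 2 ^ B := fun h => Nat.pow_lt_pow_right (by norm_num) h
  have hL : n < 2 ^ n.size := Nat.lt_size_self n
  have hl : n.size < 2 ^ n.size := Nat.lt_two_pow_self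
  have hpL : 2 ^ (n.size + 1) < 2 ^ B := hp (by omega)
  have hpL2 : 2 ^ n.size * 2 ^ (n.size + 1) < 2 ^ B := by rw [← pow_add]; exact hp (by omega)
  -- Bisection: every root lies strictly between `τ 15` and `τ 15 + 2 ^ i`. The step `2 ^ i / 2`
  -- vanishes exactly at `i = 0`, where this interval is empty. Capping powers at `n + 1` is enough
  -- to compare them with `n`.
  refine (Tri.loop hB' (k := 3 + (5 * (d + 1) + 1 + 9)) rfl (fun i τ => Params n a k v τ ∧
    τ 14 = d ∧ τ 21 = n + 1 ∧ τ 16 = 2 ^ i / 2 ∧ τ 15 + 2 ^ i ≤ 2 ^ (n.size + 1) ∧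
    Flag n (A ∧ ∀ y, y ^ (d + 1) = n → τ 15 < y ∧ y < τ 15 + 2 ^ i) τ) (m := n.size + 1)
      ?_ ?_ ?_).mono ?_ ?_
  · rintro τ ⟨-, -, -, h, -⟩; exact h
  · rintro i τ ⟨hP, h14, h21, h16, h15, hF⟩ -
    have e16 : 2 ^ (i + 1) / 2 = 2 ^ i := by rw [pow_succ]; simp
    rw [e16] at h16
    have hi : 2 ^ i < 2 ^ (i + 1) := Nat.pow_lt_pow_right (by norm_num) (by omega)
    have hi' : 2 ^ (i + 1) = 2 * 2 ^ i := by ring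
    refine Tri.cons (Q' := fun ρ => Params n a k v ρ ∧ ρ 14 = d ∧ ρ 21 = n + 1 ∧ ρ 16 = 2 ^ i ∧
      ρ 15 = τ 15 ∧ ρ 17 = τ 15 + 2 ^ i ∧ ρ 18 = 1 ∧ ρ 19 = d + 1 ∧ ρ 11 = τ 11)
      (Tri.of_wp hB' rfl fun hb => ?_) ?_
    · simp [blk_cons, blk_singleton, wp, val, Dest.addr, Function.update_apply, h14, h16, h21]
      exact ⟨by omega, by omega, by omega, hP.congr (by simp [Function.update_apply])⟩
    rintro ρ ⟨hP, h14, h21, h16, e15, h17, h18, h19, h11⟩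
    have hz : 0 < 2 ^ i := by positivity
    refine Tri.cons ((satP_spec hB' (by omega) (by omega) ?_).mono (by rw [h19])
      fun _ _ => id) ?_
    · rw [h21, h17]
      exact lt_of_le_of_lt (Nat.mul_le_mul (by omega) (by omega)) hpL2
    rintro μ ⟨h18', hμ⟩
    rw [h18, h19, h17, h21, one_mul] at h18'
    rw [← hμ _ (by simp)] at h14 h21 h16 h17 h11 e15
    replace hP : Params n a k v μ := hP.congr fun j hj => hμ j (by simp at hj ⊢; omega)
    replace hF := hF.congr h11 id
    clear hμ h18 h19
    rw [blk_singleton]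
    refine Tri.of_wp hB' rfl fun hb => ?_
    have h0 := hP.eq_n
    have hmono : ∀ {x y : ℕ}, x ^ (d + 1) < y ^ (d + 1) → x < y := fun h =>
      lt_of_pow_lt_pow_left₀ _ (Nat.zero_le _) h
    simp [blk_cons, blk_singleton, wp, val, Dest.addr, Function.update_apply, h14, h16, h21, h17,
      h0, h18']
    refine ⟨fun h => ⟨by omega, fun h' => ⟨hP.congr (by simp [Function.update_apply]), by omega,
      hF.congr rfl fun h3 => ⟨h3.1, fun y hy => ?_⟩⟩,
      fun h' => ⟨hP.congr (by simp [Function.update_apply]), by omega, Flag.zero rfl ?_⟩⟩,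
      fun h => ⟨hP.congr (by simp [Function.update_apply]), by omega,
        hF.congr rfl fun h3 => ⟨h3.1, fun y hy => ?_⟩⟩⟩
    · have := h3.2 y hy
      refine ⟨hmono (by omega), by omega⟩
    · have e : (τ 15 + 2 ^ i) ^ (d + 1) = n := by omega
      rw [← e]
      exact Nat.Prime.not_prime_pow (by omega)
    · have := h3.2 y hy
      have := hmono (x := y) (y := τ 15 + 2 ^ i) (by omega)
      omega
  · refine ⟨hσ, h14, h21, by rw [h16, pow_succ]; simp, by omega, hf.congr rfl fun h =>
      ⟨h, fun y hy => ?_⟩⟩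
    have h1 : 0 < y := by
      rcases Nat.eq_zero_or_pos y with rfl | h
      · rw [zero_pow (by omega)] at hy; omega
      · exact h
    have h2 : y ≤ n := hy ▸ Nat.le_self_pow (by omega) y
    rw [pow_succ]; omega
  · nlinarith
  · rintro τ - ⟨⟨i, hP, h14, h21, h16, h15, hF⟩, h0⟩
    have hi : i = 0 := by
      by_contra hi
      obtain ⟨j, rfl⟩ := Nat.exists_eq_succ_of_ne_zero hi
      have : 2 ^ (j + 1) / 2 = 2 ^ j := by rw [pow_succ]; simp
      have h2 : 0 < 2 ^ j := by positivity
      simp only [val] at h0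
      omega
    subst hi
    refine ⟨hP, hF.congr rfl fun h => ⟨h.1, fun y hy => ?_⟩, h14, h21⟩
    have := h.2 y hy
    omega

/-- The test whether `n` is a perfect power. -/
def powerP : Prog := blk [
  blk [addP 21 (reg 0) (lit 1), subP 14 (reg 3) (lit 1)],
  .loop (reg 14) (blk [blk [addP 15 (lit 0) (lit 0), addP 16 (reg 13) (lit 0)], rootP,
    subP 14 (reg 14) (lit 1)])]

theorem powerP_spec {B n a k v : ℕ} {A : Prop} (hB : 8 + 4 * n.size ≤ B) (hn : 1 < n)
    {σ : Mem} (hσ : Params n a k v σ) (hf : Flag n A σ) :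
    Tri B (20 * (n.size + 1) ^ 3) powerP σ fun τ => Params n a k v τ ∧
      Flag n (A ∧ ∀ b y, 2 ≤ b → y ^ b ≠ n) τ := by
  have hB' : 8 ≤ B := by omega
  have hp : ∀ {p}, p < B → 2 ^ p < 2 ^ B := fun h => Nat.pow_lt_pow_right (by norm_num) h
  have hL : n < 2 ^ n.size := Nat.lt_size_self n
  have hpL : 2 ^ n.size < 2 ^ B := hp (by omega)
  have hL0 : 0 < n.size := Nat.size_pos.2 (by omega)
  refine (Tri.cons (k₁ := 2) (k₂ := (n.size - 1) * ((2 + (20 * (n.size + 1) * (n.size + 1) + 1))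
    + 1) + 1) (Q' := fun τ => Params n a k v τ ∧ τ 14 = n.size - 1 ∧ τ 21 = n + 1 ∧ Flag n A τ)
    ?_ ?_).mono ?_ fun _ _ => id
  · refine Tri.of_wp hB' rfl fun hb => ?_
    simp [blk_cons, blk_singleton, wp, val, Dest.addr, Function.update_apply, hσ.eq_n, hσ.eq_L]
    exact ⟨by omega, hσ.congr (by simp [Function.update_apply]), hf.congr rfl id⟩
  · rintro τ ⟨hP, h14, h21, hF⟩
    rw [blk_singleton]
    refine (Tri.loop hB' rfl (fun i τ => τ 14 = i ∧ i < n.size ∧ τ 21 = n + 1 ∧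
      Params n a k v τ ∧ Flag n (A ∧ ∀ b y, i + 1 < b → b ≤ n.size → y ^ b ≠ n) τ) ?_ ?_
        ⟨h14, by omega, h21, hP, hF.congr rfl fun h => ⟨h, by omega⟩⟩).mono le_rfl ?_
    · rintro τ ⟨h, -⟩; exact h
    · rintro i τ ⟨h14, hi, h21, hP, hF⟩ -
      refine Tri.cons (Q' := fun ρ => Params n a k v ρ ∧ ρ 14 = i + 1 ∧ ρ 21 = n + 1 ∧ ρ 15 = 0 ∧
        ρ 16 = 2 ^ n.size ∧ ρ 11 = τ 11) (Tri.of_wp hB' rfl fun hb => ?_) ?_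
      · simp [blk_cons, blk_singleton, wp, val, Dest.addr, Function.update_apply, h14, h21,
          hP.eq_P]
        exact ⟨hpL, hP.congr (by simp [Function.update_apply])⟩
      rintro ρ ⟨hP, h14, h21, h15, h16, h11⟩
      refine Tri.cons (rootP_spec hB hn (by omega) hi hP (hF.congr h11 id) h14 h15 h16 h21) ?_
      rintro μ ⟨hP, hF, h14, h21⟩
      refine Tri.of_wp hB' rfl fun hb => ?_
      simp [blk_cons, blk_singleton, wp, val, Dest.addr, Function.update_apply, h14, h21]
      refine ⟨by omega, hP.congr (by simp [Function.update_apply]), hF.congr rfl fun h =>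
        ⟨h.1.1, fun b y h1 h2 => ?_⟩⟩
      rcases (show b = i + 1 + 1 ∨ i + 1 + 1 < b by omega) with rfl | hb
      · exact h.2 y
      · exact h.1.2 b y hb h2
    · rintro ρ - ⟨⟨i, hi, -, -, hP, hF⟩, h0⟩
      obtain rfl : i = 0 := hi.symm.trans h0
      refine ⟨hP, hF.congr rfl fun h => ⟨h.1, fun b y hb hy => ?_⟩⟩
      -- Exponents above `n.size` need no check, since `2 ^ b ≤ y ^ b = n < 2 ^ n.size`.
      refine h.2 b y (by omega) ?_ hy
      have hy2 : 2 ≤ y := by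
        by_contra hlt
        rcases (show y = 0 ∨ y = 1 by omega) with rfl | rfl
        · rw [zero_pow (by omega)] at hy; omega
        · rw [one_pow] at hy; omega
      have h2 : 2 ^ b ≤ n := hy ▸ Nat.pow_le_pow_left hy2 b
      exact ((Nat.pow_lt_pow_iff_right (by norm_num)).1 (h2.trans_lt hL)).le
  · obtain ⟨l, hl⟩ : ∃ l, n.size = l + 1 := ⟨n.size - 1, by omega⟩
    rw [hl, Nat.add_sub_cancel]
    nlinarith [sq_nonneg l, pow_nonneg (Nat.zero_le l) 3]

/-! ### Representatives with distinct `W`-th powers -/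

/-- `r₁₇ := r₁₄ ^ r₁₀ % n` for a power of two in register `10`. -/
def sqrP : Prog := blk [
  blk [addP 17 (reg 14) (lit 0), divP 18 (reg 10) (lit 2)],
  .loop (reg 18) (blk [mulP 17 (reg 17) (reg 17), divP 24 (reg 17) (reg 0),
    mulP 24 (reg 24) (reg 0), subP 17 (reg 17) (reg 24), divP 18 (reg 18) (lit 2)])]

theorem two_pow_succ_div_two (i : ℕ) : 2 ^ (i + 1) / 2 = 2 ^ i := by rw [pow_succ]; simp

theorem eq_zero_of_two_pow_div_two {i : ℕ} (h : 2 ^ i / 2 = 0) : i = 0 := by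
  by_contra hi
  obtain ⟨j, rfl⟩ := Nat.exists_eq_succ_of_ne_zero hi
  have h2 : 0 < 2 ^ j := by positivity
  rw [Nat.succ_eq_add_one, two_pow_succ_div_two] at h
  omega

/-- Register `18` starts at `2 ^ w / 2`, hence vanishes after exactly `w` halvings, one for each
squaring. -/
theorem sqrP_spec {B n w c : ℕ} (hB : 8 ≤ B) (hn : n * n < 2 ^ B) (hc : c < n) {σ : Mem}
    (h0 : σ 0 = n) (h10 : σ 10 = 2 ^ w) (h14 : σ 14 = c) :
    Tri B (6 * w + 3) sqrP σ fun τ => τ 17 = c ^ 2 ^ w % n ∧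
      ∀ j, j ∉ [17, 18, 24] → τ j = σ j := by
  refine (Tri.cons (k₁ := 2) (k₂ := w * (5 + 1) + 1) (Q' := fun τ => τ 17 = c ∧
    τ 18 = 2 ^ w / 2 ∧ ∀ j, j ∉ [17, 18, 24] → τ j = σ j)
    (Tri.of_wp hB rfl fun hb => ?_) ?_).mono (by omega) fun _ _ => id
  · have := hb 14
    simp [blk_cons, blk_singleton, wp, val, Dest.addr, Function.update_apply, h14, h10] at this ⊢
    exact ⟨this, fun j h1 h2 h3 => by simp [h1, h2, h3]⟩
  rintro τ ⟨h17, h18, hτ⟩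
  rw [blk_singleton]
  refine (Tri.loop hB rfl (fun i τ => (∀ j, j ∉ [17, 18, 24] → τ j = σ j) ∧ τ 18 = 2 ^ i / 2 ∧
    ∃ e, e + i = w ∧ τ 17 = c ^ 2 ^ e % n) ?_ ?_
      ⟨hτ, h18, 0, by omega, by rw [h17]; simp [Nat.mod_eq_of_lt hc]⟩).mono le_rfl ?_
  · rintro τ ⟨-, h, -⟩; exact h
  · rintro i τ ⟨hj, hi, e, he, hτ⟩ -
    rw [two_pow_succ_div_two] at hi
    refine Tri.of_wp hB rfl fun hb => ?_
    have e0 := hj 0 (by simp)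
    have hlt : τ 17 * τ 17 < 2 ^ B := by
      have : τ 17 < n := hτ ▸ Nat.mod_lt _ (by omega)
      exact lt_of_le_of_lt (Nat.mul_le_mul this.le this.le) hn
    simp [blk_cons, blk_singleton, wp, val, Dest.addr, Function.update_apply, e0, h0, hi,
      sub_div_mul]
    refine ⟨hlt, div_mul_lt hlt, fun j h1 h2 h3 => ?_, e + 1, by omega, ?_⟩
    · simp [h1, h2, h3, hj j (by simp [h1, h2, h3])]
    · rw [hτ, ← Nat.mul_mod, ← pow_two, ← pow_mul, pow_succ]
  · rintro τ - ⟨⟨i, hj, hi, e, he, hτ⟩, h0⟩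
    obtain rfl : i = 0 := eq_zero_of_two_pow_div_two (hi.symm.trans h0)
    obtain rfl : e = w := he
    exact ⟨hτ, hj⟩

/-- Comparison of `r₁₇` with the residues of the registers from `64` to `63 + r₁₅`: register `19`
is cleared if one of them equals it, and register `16` is multiplied by all nonzero differences. -/
def scanP : Prog := blk [
  blk [addP 19 (lit 1) (lit 0), addP 20 (reg 15) (lit 0)],
  .loop (reg 20) (blk [addP 21 (reg 20) (lit 63), divP 24 (ind 21) (reg 0),
    mulP 24 (reg 24) (reg 0), subP 24 (ind 21) (reg 24), subP 23 (reg 17) (reg 24),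
    subP 24 (reg 24) (reg 17), addP 23 (reg 23) (reg 24),
    .ite (reg 23) (blk [mulP 16 (reg 16) (reg 23), divP 24 (reg 16) (reg 0),
      mulP 24 (reg 24) (reg 0), subP 16 (reg 16) (reg 24)]) (addP 19 (lit 0) (lit 0)),
    subP 20 (reg 20) (lit 1)])]

/-- One of the two truncated differences is zero, so their sum is the distance of `x` and `y` and
agrees with `x - y` up to sign. -/
theorem isUnit_sub_of_coprime {n x y q : ℕ} (h1 : (q * ((x - y) + (y - x))).Coprime n) :
    q.Coprime n ∧ IsUnit ((x : ZMod n) - y) := by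
  refine ⟨h1.coprime_mul_right, ?_⟩
  have h2 := (ZMod.isUnit_iff_coprime _ _).2 h1.coprime_mul_left
  rcases le_total x y with hxy | hxy
  · rw [Nat.sub_eq_zero_of_le hxy, zero_add, Nat.cast_sub hxy] at h2
    rw [← neg_sub]
    exact h2.neg
  · rwa [Nat.sub_eq_zero_of_le hxy, add_zero, Nat.cast_sub hxy] at h2

/-- A nonzero distance below a prime is coprime to it, so accumulating differences never makes a
prime fail the later gcd test. -/
theorem coprime_mul_sub {n x y q : ℕ} (hn : n.Prime) (hx : x < n) (hy : y < n)
    (hxy : (x - y) + (y - x) ≠ 0) (hq : q.Coprime n) :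
    (q * ((x - y) + (y - x))).Coprime n := by
  refine Nat.Coprime.mul_left hq ?_
  refine Nat.Coprime.symm ((Nat.Prime.coprime_iff_not_dvd hn).2 fun h => ?_)
  have := Nat.le_of_dvd (by omega) h
  omega

/-- Register `16` collects the product of all nonzero differences, so that a single gcd at the end
replaces one for each pair. A zero difference is not multiplied in; it only marks the candidate as
redundant through register `19`. -/
theorem scanP_spec {B n m y : ℕ} {r : ℕ → ℕ} (hB : 8 ≤ B) (hn : 1 < n) (hnB : n * n < 2 ^ B)
    (hm : m + 64 < 2 ^ B) (hy : y < n) {σ : Mem} (h0 : σ 0 = n) (h15 : σ 15 = m)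
    (h16 : σ 16 < n) (h17 : σ 17 = y) (hr : ∀ i < m, σ (64 + i) % n = r i) :
    Tri B (15 * m + 3) scanP σ fun τ => (∀ j, j ∉ [16, 19, 20, 21, 23, 24] → τ j = σ j) ∧
      τ 16 < n ∧ (n.Prime → (σ 16).Coprime n → (τ 16).Coprime n) ∧
      ((τ 16).Coprime n → (σ 16).Coprime n) ∧ (τ 19 = 0 → ∃ i < m, r i = y) ∧
      (τ 19 ≠ 0 → (τ 16).Coprime n → ∀ i < m, IsUnit ((y : ZMod n) - r i)) := by
  refine (Tri.cons (k₁ := 2) (k₂ := m * (14 + 1) + 1) (Q' := fun τ => τ 19 = 1 ∧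
    τ 20 = m ∧ ∀ j, j ∉ [16, 19, 20, 21, 23, 24] ∨ j = 16 → τ j = σ j)
    (Tri.of_wp hB rfl fun hb => ?_) ?_).mono (by omega) fun _ _ => id
  · have := lt_two_pow_of_small hB (show 1 < 256 by norm_num)
    simp [blk_cons, blk_singleton, wp, val, Dest.addr, Function.update_apply, h15] at this ⊢
    refine ⟨by omega, by omega, fun j h1 => ?_⟩
    have : j ≠ 20 ∧ j ≠ 19 := by omega
    simp [this]
  rintro τ ⟨h19, h20, hτ⟩
  rw [blk_singleton]
  refine (Tri.loop hB (k := 14) rfl (fun i τ => i ≤ m ∧ τ 20 = i ∧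
      (∀ j, j ∉ [16, 19, 20, 21, 23, 24] → τ j = σ j) ∧
      τ 16 < n ∧ (n.Prime → (σ 16).Coprime n → (τ 16).Coprime n) ∧
      ((τ 16).Coprime n → (σ 16).Coprime n) ∧ (τ 19 = 0 → ∃ i < m, r i = y) ∧
      (τ 19 ≠ 0 → (τ 16).Coprime n → ∀ j, i ≤ j → j < m → IsUnit ((y : ZMod n) - r j))) ?_ ?_
      ⟨le_rfl, h20, fun j hj => hτ j (Or.inl hj), ?_⟩).mono le_rfl ?_
  · rintro τ ⟨-, h, -⟩; exact h
  · rintro i τ ⟨him, h20, hj, h16, hp, hc, hz, hu⟩ -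
    refine Tri.of_wp hB rfl fun hb => ?_
    have e0 := hj 0 (by simp)
    have e17 := hj 17 (by simp)
    have ea := hj (64 + i) (by simp; omega)
    have hri := hr i (by omega)
    have hrn : r i < n := hri ▸ Nat.mod_lt _ (by omega)
    have hlt := hb (64 + i)
    rw [ea] at hlt
    have had : i + 1 + 63 = 64 + i := by omega
    have n1 : ¬ (64 + i = 21) := by omega
    have n2 : ¬ (64 + i = 24) := by omega
    have hnB' : n < 2 ^ B := lt_of_le_of_lt (Nat.le_mul_self n) hnB
    simp [blk_cons, blk_singleton, wp, val, Dest.addr, Function.update_apply, e0, h0, h20, e17,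
      h17, had, n1, n2, ea, sub_div_mul, hri]
    refine ⟨by omega, div_mul_lt hlt, by omega, fun hne => ?_, fun h1 h2 => ?_⟩
    · have hmul : τ 16 * ((y - r i) + (r i - y)) < 2 ^ B :=
        lt_of_le_of_lt (Nat.mul_le_mul h16.le (by omega)) hnB
      refine ⟨hmul, div_mul_lt hmul, by omega, fun j j1 j2 j3 j4 j5 j6 => ?_,
        Nat.mod_lt _ (by omega), fun hpr hco => ?_, fun hco => ?_, hz, fun h19 hco j hij hjm => ?_⟩
      · simp [j1, j2, j3, j4, j5, j6, hj j (by simp [j1, j2, j3, j4, j5, j6])]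
      · exact coprime_mul_sub hpr hy hrn (by omega) (hp hpr hco)
      · exact hc (isUnit_sub_of_coprime hco).1
      · obtain ⟨c1, c2⟩ := isUnit_sub_of_coprime hco
        rcases hij.eq_or_lt with rfl | hij
        · exact c2
        · exact hu h19 c1 j hij hjm
    · refine ⟨by omega, fun j j1 j2 j3 j4 j5 j6 => ?_, h16, hp, hc, i, by omega,
        by omega⟩
      simp [j1, j2, j3, j4, j5, j6, hj j (by simp [j1, j2, j3, j4, j5, j6])]
  · rw [hτ 16 (Or.inr rfl), h19]
    exact ⟨h16, fun _ => id, id, by omega, fun _ _ j h1 h2 => by omega⟩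
  · rintro τ - ⟨⟨i, him, hi, hj, h16, hp, hc, hz, hu⟩, h0⟩
    obtain rfl : i = 0 := hi.symm.trans h0
    exact ⟨hj, h16, hp, hc, hz, fun h1 h2 j hj => hu h1 h2 j (Nat.zero_le _) hj⟩

/-- The registers from `64` on hold `m` numbers `f 0, …` up to `M`, together with their
`W`-th powers modulo `n`, and register `16` is coprime to `n` only if these powers have
invertible differences. -/
structure Reps (n W M m : ℕ) (f : ℕ → ℕ) (σ : Mem) : Prop where
  card : σ 15 = m
  code : ∀ i < m, σ (64 + i) = f i * n + f i ^ W % n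
  pos : ∀ i < m, 1 ≤ f i
  le : ∀ i < m, f i ≤ M
  unit : (σ 16).Coprime n → ∀ i < m, ∀ j < i, IsUnit ((f i : ZMod n) ^ W - (f j : ZMod n) ^ W)

theorem Reps.congr {n W M m : ℕ} {f : ℕ → ℕ} {σ τ : Mem} (h : Reps n W M m f σ)
    (h15 : τ 15 = σ 15) (h16 : (τ 16).Coprime n → (σ 16).Coprime n)
    (hτ : ∀ i, 64 ≤ i → τ i = σ i) : Reps n W M m f τ where
  card := h15.trans h.card
  code i hi := (hτ _ (by omega)).trans (h.code i hi)
  pos := h.pos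
  le := h.le
  unit h' := h.unit (h16 h')

/-- The body of the search for representatives: the candidate in register `14` is appended to the
list if its power differs from those of the previous ones. -/
def candP : Prog := blk [
  sqrP,
  scanP,
  .ite (reg 19) (blk [mulP 24 (reg 14) (reg 0), addP 24 (reg 24) (reg 17), addP 21 (reg 15) (lit 64),
    .assign (.ind 21) .add (reg 24) (lit 0), addP 15 (reg 15) (lit 1)]) .skip]

theorem candP_spec {B n w M m c : ℕ} {f : ℕ → ℕ} (hB : 8 ≤ B) (hn : 1 < n) (hnB : n * n < 2 ^ B)
    (hm : m + 64 < 2 ^ B) (hc : 0 < c) (hcM : c ≤ M) (hcn : c < n) {σ : Mem} (h0 : σ 0 = n)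
    (h10 : σ 10 = 2 ^ w) (h14 : σ 14 = c) (h16 : σ 16 < n)
    (hr : Reps n (2 ^ w) M m f σ) :
    Tri B (6 * w + 15 * m + 13) candP σ fun τ =>
      (∀ j < 64, j ∉ [15, 16, 17, 18, 19, 20, 21, 23, 24] → τ j = σ j) ∧ τ 16 < n ∧
      (n.Prime → (σ 16).Coprime n → (τ 16).Coprime n) ∧
      ∃ m' f', m ≤ m' ∧ m' ≤ m + 1 ∧ Reps n (2 ^ w) M m' f' τ ∧ (∀ i < m, f' i = f i) ∧
        ∃ i < m', f' i ^ 2 ^ w % n = c ^ 2 ^ w % n := by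
  refine (Tri.cons (sqrP_spec hB hnB hcn h0 h10 h14) (k₂ := 15 * m + 3 + 7) ?_).mono (by omega)
    fun _ _ => id
  rintro τ ⟨h17, hτ⟩
  have hr' : Reps n (2 ^ w) M m f τ := hr.congr (hτ _ (by simp))
    (by rw [hτ _ (by simp)]; exact id) fun i hi => hτ i (by simp; omega)
  have e0 := hτ 0 (by simp)
  have e14 := hτ 14 (by simp)
  have e16 := hτ 16 (by simp)
  refine Tri.cons ((scanP_spec hB hn hnB hm (Nat.mod_lt _ (by omega)) (e0.trans h0) hr'.card
    (by rw [e16]; exact h16) h17 (r := fun i => f i ^ 2 ^ w % n) fun i hi => by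
      rw [hr'.code i hi, Nat.mul_add_mod', Nat.mod_mod]).mono (by omega) fun _ _ => id) ?_
  rintro ρ ⟨hρ, h16, hp, hco, hz, hu⟩
  rw [e16] at hp hco
  have hρσ : ∀ j, j ∉ [15, 16, 17, 18, 19, 20, 21, 23, 24] → ρ j = σ j := fun j hj => by
    simp at hj
    rw [hρ j (by simp; omega), hτ j (by simp; omega)]
  have hr'' : Reps n (2 ^ w) M m f ρ := hr'.congr (hρ _ (by simp))
    (by rw [e16]; exact hco) fun i hi => hρ i (by simp; omega)
  refine Tri.of_wp hB rfl fun hb => ?_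
  have e0' := hρ 0 (by simp)
  have e14' := hρ 14 (by simp)
  have e17' := hρ 17 (by simp)
  have hnn : 0 < n := by omega
  have hmod : c ^ 2 ^ w % n < n := Nat.mod_lt _ hnn
  -- A candidate and its power share one register as quotient and remainder by `n`; as `c < n`, the
  -- code stays below `n * n`.
  have hcode : c * n + c ^ 2 ^ w % n < 2 ^ B := by
    refine lt_of_lt_of_le (?_ : _ < n * n) hnB.le
    obtain ⟨d, rfl⟩ : ∃ d, n = c + 1 + d := ⟨n - (c + 1), by omega⟩
    nlinarith
  simp [blk_cons, blk_singleton, wp, val, Dest.addr, Function.update_apply, e0', e14', e17',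
    e0, e14, h17, h0, h14, hr''.card]
  refine ⟨fun h19 => ⟨by omega, hcode, by omega, hcode, by omega, fun j hj j1 j2 j3 j4 j5 j6 j7 j8
    j9 => ?_, h16, hp, m + 1, by omega, by omega, Function.update f m c, ?_, fun i hi => by
      simp [hi.ne], m, by omega, by simp⟩, fun h19 => ?_⟩
  · have : j ≠ m + 64 := by omega
    simp [j1, j7, j9, this, hρσ j (by simp; tauto)]
  · constructor
    · simp
    · intro i hi
      rcases (show i = m ∨ i < m by omega) with rfl | hi
      · have : ¬ 64 + i = 15 := by omega
        simp [this, add_comm]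
      · have h1 : ¬ 64 + i = 15 := by omega
        have h2 : ¬ 64 + i = m + 64 := by omega
        have h3 : ¬ 64 + i = 21 := by omega
        have h4 : ¬ 64 + i = 24 := by omega
        simp [h1, h2, h3, h4, hi.ne, hr''.code i hi, Function.update_apply]
    · intro i hi
      rcases (show i = m ∨ i < m by omega) with rfl | hi
      · simp only [Function.update_self]; omega
      · simpa [hi.ne] using hr''.pos i hi
    · intro i hi
      rcases (show i = m ∨ i < m by omega) with rfl | hi
      · simpa using hcM
      · simpa [hi.ne] using hr''.le i hi
    · intro h i hi j hj
      have e : ∀ x, Function.update (Function.update (Function.update (Function.update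
        (Function.update ρ 24 (c * n)) 24 (c * n + c ^ 2 ^ w % n)) 21 (m + 64)) (m + 64)
        (c * n + c ^ 2 ^ w % n)) 15 x 16 = ρ 16 := by
        intro x
        have : ¬ 16 = m + 64 := by omega
        simp [Function.update_apply, this]
      simp [Function.update_apply] at h
      rcases (show i = m ∨ i < m by omega) with rfl | hi
      · have := hu h19 h j hj
        simpa [hj.ne] using this
      · have hj' : j < m := by omega
        simpa [hi.ne, hj'.ne] using hr''.unit h i hi j hj
  · refine ⟨fun j hj j1 j2 j3 j4 j5 j6 j7 j8 j9 => hρσ j (by simp; tauto), h16, hp, m, le_rfl,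
      by omega, f, hr'', fun _ _ => rfl, hz h19⟩

/-- The search for representatives. -/
def searchP : Prog := blk [
  blk [addP 15 (lit 0) (lit 0), addP 16 (lit 1) (lit 0), addP 14 (reg 7) (lit 0)],
  .loop (reg 14) (blk [subP 24 (reg 9) (reg 15), .ite (reg 24) candP .skip,
    subP 14 (reg 14) (lit 1)])]

/-- Candidates are skipped only once `C` representatives have been found. Ending with fewer
therefore means that every candidate was compared, so that the list covers all the `W`-th powers. -/
theorem searchP_spec {B n a k v w M C : ℕ} {A : Prop} (hB : 8 ≤ B) (hn : 1 < n)
    (hnB : n * n < 2 ^ B) (hMn : M < n) (hC0 : 0 < C) (hC : C + 64 < 2 ^ B) {σ : Mem}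
    (hσ : Params n a k v σ) (hf : Flag n A σ) (h7 : σ 7 = M) (h9 : σ 9 = C)
    (h10 : σ 10 = 2 ^ w) :
    Tri B (M * (6 * w + 15 * C + 17) + 4) searchP σ fun τ => Params n a k v τ ∧ Flag n A τ ∧
      τ 16 < n ∧ (n.Prime → (τ 16).Coprime n) ∧ ∃ m f, m ≤ C ∧ Reps n (2 ^ w) M m f τ ∧
        (m < C → ∀ c, 0 < c → c ≤ M → ∃ i < m, f i ^ 2 ^ w % n = c ^ 2 ^ w % n) := by
  refine (Tri.cons (k₁ := 3) (k₂ := M * ((6 * w + 15 * C + 16) + 1) + 1) (Q' := fun τ =>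
    Params n a k v τ ∧ Flag n A τ ∧ τ 15 = 0 ∧ τ 16 = 1 ∧ τ 14 = M)
    (Tri.of_wp hB rfl fun hb => ?_) ?_).mono (le_of_eq (by ring)) fun _ _ => id
  · have := hb 7
    have := lt_two_pow_of_small hB (show 1 < 256 by norm_num)
    simp [blk_cons, blk_singleton, wp, val, Dest.addr, Function.update_apply, h7]
    exact ⟨by omega, by omega, hσ.congr (by simp [Function.update_apply]), hf.congr rfl id⟩
  rintro τ ⟨hP, hF, h15, h16, h14⟩
  rw [blk_singleton]
  have e7 : ∀ {ρ}, Params n a k v ρ → ρ 7 = M := fun h => h.eq_M.trans (hσ.eq_M.symm.trans h7)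
  have e9 : ∀ {ρ}, Params n a k v ρ → ρ 9 = C := fun h => h.eq_C.trans (hσ.eq_C.symm.trans h9)
  have e10 : ∀ {ρ}, Params n a k v ρ → ρ 10 = 2 ^ w := fun h =>
    h.eq_W.trans (hσ.eq_W.symm.trans h10)
  refine (Tri.loop hB rfl (fun i τ => τ 14 = i ∧ i ≤ M ∧ Params n a k v τ ∧ Flag n A τ ∧
      τ 16 < n ∧ (n.Prime → (τ 16).Coprime n) ∧ ∃ m f, m ≤ C ∧ Reps n (2 ^ w) M m f τ ∧
        (m < C → ∀ c, i < c → c ≤ M → ∃ i < m, f i ^ 2 ^ w % n = c ^ 2 ^ w % n)) ?_ ?_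
      ⟨h14, le_rfl, hP, hF, by omega, fun _ => by rw [h16]; simp, 0, id, by omega,
        ⟨h15, by omega, by omega, by omega, by omega⟩, by omega⟩).mono le_rfl ?_
  · rintro τ ⟨h, -⟩; exact h
  · rintro i τ ⟨hi, hiM, hP, hF, h16, hp, m, f, hmC, hR, hcov⟩ -
    refine (Tri.cons (k₁ := 1) (k₂ := (6 * w + 15 * m + 13 + 1) + 1) (Q' := fun ρ =>
      ρ 24 = C - m ∧ ∀ j, j ≠ 24 → ρ j = τ j) (Tri.of_wp hB rfl fun hb => ?_) ?_).mono
        (by omega) fun _ _ => id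
    · simp [blk_cons, blk_singleton, wp, val, Dest.addr, Function.update_apply, e9 hP, hR.card]
      exact fun j hj => by simp [hj]
    rintro ρ ⟨h24, hρ⟩
    replace hP : Params n a k v ρ := hP.congr (by simp [hρ])
    replace hF := hF.congr (hρ 11 (by simp)) id
    replace hR : Reps n (2 ^ w) M m f ρ := hR.congr (hρ _ (by simp))
      (by rw [hρ 16 (by simp)]; exact id) (fun i hi => hρ i (by omega))
    rw [← hρ _ (by simp)] at hi h16 hp
    clear hρ
    refine Tri.cons (Q' := fun τ => τ 14 = i + 1 ∧ Params n a k v τ ∧ Flag n A τ ∧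
      τ 16 < n ∧ (n.Prime → (τ 16).Coprime n) ∧ ∃ m f, m ≤ C ∧ Reps n (2 ^ w) M m f τ ∧
        (m < C → ∀ c, i < c → c ≤ M → ∃ i < m, f i ^ 2 ^ w % n = c ^ 2 ^ w % n))
      (Tri.ite hB rfl (fun h => ?_) fun h => ?_) ?_
    · refine (candP_spec hB hn hnB (by omega) (Nat.succ_pos i) hiM (by omega) hP.eq_n (e10 hP) hi
        h16 hR).mono le_rfl ?_
      rintro μ - ⟨hμ, h16', hp', m', f', hm1, hm2, hR', hff, l, hl, hl'⟩
      simp only [val] at h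
      refine ⟨(hμ 14 (by norm_num) (by simp)).trans hi,
        hP.congr fun j hj => hμ j (by simp at hj; omega) (by simp at hj ⊢; omega),
        hF.congr (hμ 11 (by norm_num) (by simp)) id, h16', fun h => hp' h (hp h), m', f', by omega,
        hR', fun hlt c hc1 hc2 => ?_⟩
      rcases (show c = i + 1 ∨ i + 1 < c by omega) with rfl | hc
      · exact ⟨l, hl, hl'⟩
      · obtain ⟨s, hs, hs'⟩ := hcov (by omega) c hc hc2
        exact ⟨s, by omega, by rw [hff s hs, hs']⟩
    · refine (Tri.of_wp (P := .skip) (Q := fun τ => τ = ρ) hB rfl fun hb => rfl).mono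
        (by simp only [Prog.size]; omega) ?_
      rintro μ - rfl
      simp only [val] at h
      exact ⟨hi, hP, hF, h16, hp, m, f, hmC, hR, by omega⟩
    · rintro μ ⟨hi, hP, hF, h16, hp, m, f, hmC, hR, hcov⟩
      refine Tri.of_wp hB rfl fun hb => ?_
      simp [blk_cons, blk_singleton, wp, val, Dest.addr, Function.update_apply, hi]
      refine ⟨by omega, hP.congr (by simp [Function.update_apply]), hF.congr rfl id, h16, hp, m,
        hmC, f, hR.congr rfl id fun j hj => ?_, hcov⟩
      have : j ≠ 14 := by omega
      simp [this]
  · rintro ρ - ⟨⟨i, hi, -, hP, hF, h16, hp, m, f, hmC, hR, hcov⟩, h0⟩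
    obtain rfl : i = 0 := hi.symm.trans h0
    exact ⟨hP, hF, h16, hp, m, f, hmC, hR, hcov⟩

/-! ### Coprimality of the product of differences -/

/-- Euclid's algorithm for `n` and `r₁₆`, with failure of the test if they are not coprime. -/
def gcdP : Prog := blk [
  blk [addP 17 (reg 0) (lit 0), addP 18 (reg 16) (lit 0)],
  .loop (reg 18) (blk [divP 24 (reg 17) (reg 18), mulP 24 (reg 24) (reg 18),
    subP 24 (reg 17) (reg 24), addP 17 (reg 18) (lit 0), addP 18 (reg 24) (lit 0)]),
  blk [subP 24 (reg 17) (lit 1), .ite (reg 24) (addP 11 (lit 0) (lit 0)) .skip]]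

/-- Since `x % y ≤ x / 2` for `0 < y ≤ x`, the product of the two current numbers at least halves in
every round. It starts below `2 ^ (2 * n.size)`, which bounds the number of rounds. -/
theorem gcdP_spec {B n x : ℕ} {A : Prop} (hB : 8 ≤ B) (hn : 1 < n) {σ : Mem} (h0 : σ 0 = n)
    (hf : Flag n A σ) (h16 : σ 16 = x) (hx : x < n) (hp : n.Prime → x.Coprime n) :
    Tri B (12 * n.size + 7) gcdP σ fun τ => (∀ j, j ∉ [11, 17, 18, 24] → τ j = σ j) ∧
      Flag n (A ∧ x.Coprime n) τ := by
  refine (Tri.cons (k₁ := 2) (k₂ := ((2 * n.size) * (5 + 1) + 1) + 4) (Q' := fun τ =>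
    τ 17 = n ∧ τ 18 = x ∧ ∀ j, j ∉ [17, 18, 24] → τ j = σ j)
    (Tri.of_wp hB rfl fun hb => ?_) ?_).mono (by omega) fun _ _ => id
  · have h1 := hb 0
    have h2 := hb 16
    simp [blk_cons, blk_singleton, wp, val, Dest.addr, Function.update_apply, h0, h16] at h1 h2 ⊢
    exact ⟨h1, h2, fun j j1 j2 j3 => by simp [j1, j2]⟩
  rintro τ ⟨h17, h18, hτ⟩
  refine Tri.cons (Q' := fun τ => τ 17 = x.gcd n ∧ ∀ j, j ∉ [17, 18, 24] → τ j = σ j)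
    ((Tri.loop hB (k := 5) rfl (fun i τ => (∀ j, j ∉ [17, 18, 24] → τ j = σ j) ∧
      τ 18 < τ 17 ∧ (τ 18).gcd (τ 17) = x.gcd n ∧ τ 17 * τ 18 < 2 ^ i) (m := 2 * n.size) ?_ ?_
        ⟨hτ, by omega, by rw [h17, h18], ?_⟩).mono le_rfl ?_) ?_
  · rintro τ ⟨-, h, -, h'⟩
    simp only [val]
    by_contra h18
    have : 0 < τ 17 * τ 18 := Nat.mul_pos (by omega) (by omega)
    omega
  · rintro i τ ⟨hj, hlt, hg, hi⟩ h18
    refine Tri.of_wp hB rfl fun hb => ?_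
    have h1 := hb 17
    have h2 := hb 18
    simp only [val] at h18
    have h3 : τ 17 % τ 18 < τ 18 := Nat.mod_lt _ (by omega)
    simp [blk_cons, blk_singleton, wp, val, Dest.addr, Function.update_apply, sub_div_mul]
    refine ⟨div_mul_lt h1, h2, by omega, fun j j1 j2 j3 => ?_, h3, ?_, ?_⟩
    · simp [j1, j2, j3, hj j (by simp [j1, j2, j3])]
    · rw [← hg, Nat.gcd_rec (τ 18) (τ 17)]
    · have h4 := Nat.div_add_mod' (τ 17) (τ 18)
      have h5 : 1 * τ 18 ≤ τ 17 / τ 18 * τ 18 :=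
        Nat.mul_le_mul_right _ (Nat.div_pos hlt.le (by omega))
      have h6 : 2 * (τ 17 % τ 18) ≤ τ 17 := by omega
      have h7 := Nat.mul_le_mul_left (τ 18) h6
      rw [pow_succ] at hi
      nlinarith
  · rw [h17, h18, two_mul, pow_add]
    have := Nat.lt_size_self n
    exact Nat.mul_lt_mul'' this (hx.trans this)
  · rintro τ - ⟨⟨i, hj, -, hg, -⟩, h⟩
    simp only [val] at h
    rw [h, Nat.gcd_zero_left] at hg
    exact ⟨hg, hj⟩
  · rintro τ ⟨h17, hτ⟩
    refine Tri.of_wp hB rfl fun hb => ?_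
    have hg : 0 < x.gcd n := Nat.gcd_pos_of_pos_right _ (by omega)
    simp [blk_cons, blk_singleton, wp, val, Dest.addr, Function.update_apply, h17]
    refine ⟨fun h => ⟨fun j j1 j2 j3 j4 => ?_, Flag.zero rfl fun h' => ?_⟩, fun h =>
      ⟨fun j j1 j2 j3 j4 => ?_, hf.congr (hτ 11 (by simp)) fun h' => ⟨h', ?_⟩⟩⟩
    · simp [j1, j4, hτ j (by simp; omega)]
    · have := hp h'
      rw [Nat.coprime_iff_gcd_eq_one] at this
      omega
    · simp [j4, hτ j (by simp; omega)]
    · rw [Nat.coprime_iff_gcd_eq_one]; omega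

end RAM

/-! ### Kronecker substitution and simultaneous division of digits -/

namespace Kronecker

open Polynomial Finset

/-- The number with the digits `c 0, …, c (N - 1)` in base `b`. -/
def pk (b N : ℕ) (c : ℕ → ℕ) : ℕ := ∑ i ∈ range N, c i * b ^ i

theorem pk_succ' (b N : ℕ) (c : ℕ → ℕ) :
    pk b (N + 1) c = c 0 + b * pk b N fun i => c (i + 1) := by
  rw [pk, sum_range_succ', pk, mul_sum, pow_zero, mul_one, add_comm]
  congr 1
  exact sum_congr rfl fun i _ => by ring

theorem pk_congr {b N : ℕ} {c d : ℕ → ℕ} (h : ∀ i < N, c i = d i) : pk b N c = pk b N d :=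
  sum_congr rfl fun i hi => by rw [h i (mem_range.1 hi)]

theorem pk_add (b N : ℕ) (c d : ℕ → ℕ) :
    pk b N (fun i => c i + d i) = pk b N c + pk b N d := by
  simp only [pk, add_mul, sum_add_distrib]

theorem pk_mul (b N m : ℕ) (c : ℕ → ℕ) : pk b N (fun i => c i * m) = pk b N c * m := by
  simp only [pk, sum_mul]
  exact sum_congr rfl fun i _ => by ring

theorem pk_append (b N N' : ℕ) (c : ℕ → ℕ) :
    pk b (N + N') c = pk b N c + b ^ N * pk b N' fun i => c (N + i) := by
  rw [pk, sum_range_add, pk, pk, mul_sum]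
  congr 1
  exact sum_congr rfl fun i _ => by ring

theorem pk_lt {b N : ℕ} {c : ℕ → ℕ} (h : ∀ i < N, c i < b) : pk b N c < b ^ N := by
  induction N generalizing c with
  | zero => simp [pk]
  | succ N ih =>
    rw [pk_succ', pow_succ']
    have h1 := ih (c := fun i => c (i + 1)) fun i hi => h _ (by omega)
    have h2 := h 0 (by omega)
    have h3 : b * (pk b N (fun i => c (i + 1)) + 1) ≤ b * b ^ N := Nat.mul_le_mul_left _ h1
    rw [mul_add] at h3
    omega

theorem pk_land {w N : ℕ} {c d : ℕ → ℕ} (hc : ∀ i < N, c i < 2 ^ w) (hd : ∀ i < N, d i < 2 ^ w) :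
    pk (2 ^ w) N c &&& pk (2 ^ w) N d = pk (2 ^ w) N fun i => c i &&& d i := by
  induction N generalizing c d with
  | zero => simp [pk]
  | succ N ih =>
    rw [pk_succ', pk_succ', pk_succ', RAM.land_add_mul (hc 0 (by omega)) (hd 0 (by omega)),
      ih (fun i hi => hc _ (by omega)) (fun i hi => hd _ (by omega))]

/-- The geometric series, by which a repeated digit is produced with one division. -/
theorem pk_one {b : ℕ} (hb : 2 ≤ b) (N : ℕ) : (b ^ N - 1) / (b - 1) = pk b N fun _ => 1 := by
  rw [← Nat.geomSum_eq hb, pk]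
  simp

/-- Each digit in base `D * D` has an upper half `h i` and a lower half `l i`. Division by `D`
shifts by half a digit: upper halves move down, and each lower half becomes the upper half of the
preceding digit, except the very lowest, which is dropped. -/
theorem pk_div {D N : ℕ} (hD : 0 < D) (h l : ℕ → ℕ) (hl : ∀ i < N, l i < D) :
    pk (D * D) N (fun i => D * h i + l i) / D =
      pk (D * D) N fun i => h i + D * (if i + 1 < N then l (i + 1) else 0) := by
  cases N with
  | zero => simp [pk]
  | succ N =>
    have e1 : pk (D * D) (N + 1) (fun i => D * h i + l i)
        = l 0 + D * (pk (D * D) (N + 1) h + D * pk (D * D) N fun i => l (i + 1)) := by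
      rw [pk_add, pk_succ' _ _ l, ← funext fun i => mul_comm (h i) D, pk_mul]
      ring
    have e2 : pk (D * D) (N + 1) (fun i => D * (if i + 1 < N + 1 then l (i + 1) else 0))
        = D * pk (D * D) N fun i => l (i + 1) := by
      rw [← funext fun i => mul_comm (if i + 1 < N + 1 then l (i + 1) else 0) D, pk_mul, mul_comm]
      congr 1
      rw [pk, sum_range_succ, if_neg (by omega), zero_mul, add_zero]
      exact sum_congr rfl fun i hi => by
        rw [mem_range] at hi
        rw [if_pos (by omega)]
    rw [e1, Nat.add_mul_div_left _ _ hD, Nat.div_eq_of_lt (hl 0 (by omega)), zero_add, pk_add, e2]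

/-- Division by a constant through multiplication with an approximate inverse. -/
theorem mul_div_eq_div {n D e : ℕ} (hn : 0 < n) (he : e * n < D) :
    e * (D / n + 1) / D = e / n := by
  have hD : 0 < D := by omega
  have h1 := Nat.div_add_mod D n
  have h2 := Nat.mod_lt D hn
  have h3 := Nat.div_add_mod e n
  have h4 := Nat.mod_lt e hn
  set q := D / n
  set x := e / n
  -- The error `e * (n - D % n)` is at most `e * n < D`, too small to carry the quotient to the next
  -- integer.
  have e1 : e * (q + 1) * n = e * D + e * (n - D % n) := by
    have : (q + 1) * n = D + (n - D % n) := by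
      rw [add_mul, mul_comm q n]; omega
    rw [mul_assoc, this, mul_add]
  have e2 : e * (n - D % n) ≤ e * n := Nat.mul_le_mul_left _ (by omega)
  rw [Nat.div_eq_iff hD]
  constructor
  · refine le_of_mul_le_mul_right (?_ : x * D * n ≤ e * (q + 1) * n) hn
    rw [e1]
    have : n * x * D ≤ e * D := Nat.mul_le_mul_right _ (by omega)
    nlinarith
  · have h5 : e * (q + 1) * n < (x * D + D) * n := by
      rw [e1]
      have h6 : (e + 1) * D ≤ (n * x + n) * D := Nat.mul_le_mul_right _ (by omega)
      nlinarith
    have := Nat.lt_of_mul_lt_mul_right h5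
    omega

/-- Simultaneous division of all digits by `n`. -/
theorem pk_barrett {n r N : ℕ} {e : ℕ → ℕ} (hn : 0 < n) (he : ∀ i < N, e i * n < 2 ^ r)
    (he' : ∀ i < N, e i * (2 ^ r / n + 1) < 2 ^ r * 2 ^ r) :
    (pk (2 ^ r * 2 ^ r) N e * (2 ^ r / n + 1) / 2 ^ r) &&&
      ((2 ^ r - 1) * pk (2 ^ r * 2 ^ r) N fun _ => 1) =
        pk (2 ^ r * 2 ^ r) N fun i => e i / n := by
  have hD : 0 < 2 ^ r := by positivity
  have hdiv : ∀ i < N, e i * (2 ^ r / n + 1) / 2 ^ r < 2 ^ r := fun i hi =>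
    Nat.div_lt_of_lt_mul (he' i hi)
  rw [← pk_mul, mul_comm (2 ^ r - 1), ← pk_mul]
  have e1 : (fun i => e i * (2 ^ r / n + 1)) = fun i => 2 ^ r * (e i * (2 ^ r / n + 1) / 2 ^ r) +
      e i * (2 ^ r / n + 1) % 2 ^ r := funext fun i => (Nat.div_add_mod _ _).symm
  have hl : ∀ i : ℕ, (if i + 1 < N then e (i + 1) * (2 ^ r / n + 1) % 2 ^ r else 0) < 2 ^ r := by
    intro i
    split_ifs
    · exact Nat.mod_lt _ hD
    · exact hD
  rw [e1, pk_div hD _ _ fun i _ => Nat.mod_lt _ hD]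
  have hw : 2 ^ r * 2 ^ r = 2 ^ (r + r) := (pow_add _ _ _).symm
  rw [hw, pk_land]
  · refine pk_congr fun i hi => ?_
    -- The mask keeps the lower half of every digit and so removes the remainder which the shift
    -- brought in from the next digit.
    have := RAM.land_add_mul (w := r) (x := e i * (2 ^ r / n + 1) / 2 ^ r) (y := 2 ^ r - 1)
      (x' := if i + 1 < N then e (i + 1) * (2 ^ r / n + 1) % 2 ^ r else 0) (y' := 0) (hdiv i hi)
      (by omega)
    rw [mul_zero, add_zero, Nat.and_zero, mul_zero, add_zero] at this
    rw [one_mul, this, Nat.and_two_pow_sub_one_eq_mod, Nat.mod_eq_of_lt (hdiv i hi),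
      mul_div_eq_div hn (he i hi)]
  · intro i hi
    have h1 := hdiv i hi
    have h2 := Nat.mul_le_mul_left (2 ^ r) (Nat.succ_le_of_lt (hl i))
    rw [Nat.succ_eq_add_one, mul_add] at h2
    rw [← hw]
    omega
  · intro i _
    rw [← hw, one_mul]
    have := Nat.le_mul_self (2 ^ r)
    omega

/-- The polynomial with the coefficients `c 0, …, c (N - 1)`. -/
noncomputable def poly (N : ℕ) (c : ℕ → ℕ) : ℕ[X] := ∑ i ∈ range N, monomial i (c i)

theorem coeff_poly (N : ℕ) (c : ℕ → ℕ) (i : ℕ) :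
    (poly N c).coeff i = if i < N then c i else 0 := by
  simp [poly, coeff_monomial]

theorem eval_poly (b N : ℕ) (c : ℕ → ℕ) : (poly N c).eval b = pk b N c := by
  simp [poly, pk, eval_finsetSum]

/-- The number `x` is the value at `b` of the polynomial `f` of degree less than `N` and with
coefficients less than `n`. -/
structure Packs (n N b : ℕ) (f : ℕ[X]) (x : ℕ) : Prop where
  eval : x = f.eval b
  coeff : ∀ i, f.coeff i < n
  degree : ∀ i, N ≤ i → f.coeff i = 0

theorem eval_eq_pk {b N : ℕ} {f : ℕ[X]} (hf : ∀ i, N ≤ i → f.coeff i = 0) :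
    f.eval b = pk b N f.coeff := by
  rw [← eval_poly]
  congr 1
  ext i
  rw [coeff_poly]
  split_ifs with h
  · rfl
  · exact hf i (by omega)

/-- The ring homomorphism from `ℕ[X]` to `(ℤ/n)[X]/(X ^ N - a)`. -/
noncomputable def toRing (n N a : ℕ) : ℕ[X] →+* AdjoinRoot (X ^ N - C (a : ZMod n)) :=
  (AdjoinRoot.mk _).comp (mapRingHom (Nat.castRingHom (ZMod n)))

theorem toRing_congr {n N a : ℕ} {f g : ℕ[X]} (h : ∀ i, f.coeff i % n = g.coeff i % n) :
    toRing n N a f = toRing n N a g := by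
  simp only [toRing, RingHom.comp_apply]
  congr 1
  ext i
  simp only [coe_mapRingHom, coeff_map, eq_natCast]
  exact (ZMod.natCast_eq_natCast_iff' _ _ _).2 (h i)

theorem toRing_X_pow (n N a : ℕ) : toRing n N a (X ^ N) = toRing n N a (C a) := by
  simp only [toRing, RingHom.comp_apply]
  rw [← sub_eq_zero, ← map_sub, AdjoinRoot.mk_eq_zero]
  simp

/-- The coefficient of `X ^ i` in the reduction modulo `X ^ N - a`. -/
def fold (N a : ℕ) (f : ℕ[X]) (i : ℕ) : ℕ := f.coeff i + f.coeff (N + i) * a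

/-- As `X ^ N = a`, the coefficients from degree `N` on are multiplied by `a` and added to the lower
ones. One pass suffices because the degree is below `2 * N`. -/
theorem toRing_fold {n N a : ℕ} {f : ℕ[X]} (hf : ∀ i, 2 * N ≤ i → f.coeff i = 0) :
    toRing n N a (poly N fun i => fold N a f i % n) = toRing n N a f := by
  have e : f = poly N f.coeff + X ^ N * poly N fun i => f.coeff (N + i) := by
    ext i
    rw [coeff_add, coeff_X_pow_mul', coeff_poly, coeff_poly]
    rcases lt_or_ge i N with h | h
    · simp [h, Nat.not_le.2 h]
    · rw [if_neg (by omega), if_pos h, zero_add]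
      split_ifs with h'
      · rw [Nat.add_sub_cancel' h]
      · exact hf i (by omega)
  conv_rhs => rw [e, map_add, map_mul, toRing_X_pow, ← map_mul, ← map_add]
  refine toRing_congr fun i => ?_
  rw [coeff_add, coeff_C_mul, coeff_poly, coeff_poly, coeff_poly]
  split_ifs
  · rw [Nat.mod_mod, fold, mul_comm a]
  · simp

/-- The monic polynomial `X ^ N - a` divides no nonzero polynomial of smaller degree, so reduced
representatives are unique and equality in the ring can be read off from the packed numbers. -/
theorem toRing_injOn {n N a b x y : ℕ} {f g : ℕ[X]} (hn : 1 < n) (hN : 0 < N)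
    (hf : Packs n N b f x) (hg : Packs n N b g y) (h : toRing n N a f = toRing n N a g) :
    x = y := by
  have : Nontrivial (ZMod n) := ZMod.nontrivial_iff.2 (by omega)
  suffices f = g by rw [hf.eval, hg.eval, this]
  simp only [toRing, RingHom.comp_apply] at h
  rw [AdjoinRoot.mk_eq_mk] at h
  by_contra hfg
  refine (monic_X_pow_sub_C (a : ZMod n) hN.ne').not_dvd_of_degree_lt ?_ ?_ h
  · intro h0
    refine hfg (Polynomial.ext fun i => ?_)
    have h1 := congr_arg (fun p => p.coeff i) h0
    simp only [coe_mapRingHom, coeff_sub, coeff_map, eq_natCast, coeff_zero] at h1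
    rw [sub_eq_zero, ZMod.natCast_eq_natCast_iff', Nat.mod_eq_of_lt (hf.coeff i),
      Nat.mod_eq_of_lt (hg.coeff i)] at h1
    exact h1
  · rw [degree_X_pow_sub_C hN, degree_lt_iff_coeff_zero]
    intro i hi
    simp only [coe_mapRingHom, coeff_sub, coeff_map, eq_natCast]
    rw [hf.degree i (by exact_mod_cast hi), hg.degree i (by exact_mod_cast hi), sub_self]

theorem coeff_mul_lt {n N b x y i : ℕ} {f g : ℕ[X]} (hn : 0 < n) (hN : 0 < N)
    (hf : Packs n N b f x) (hg : Packs n N b g y) : (f * g).coeff i < 2 * N * (n * n) := by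
  rcases lt_or_ge i (2 * N) with hi | hi
  · rw [coeff_mul, Nat.sum_antidiagonal_eq_sum_range_succ_mk]
    refine lt_of_lt_of_le (sum_lt_sum_of_nonempty (g := fun _ => n * n) ⟨0, by simp⟩
      fun j _ => Nat.mul_lt_mul'' (hf.coeff _) (hg.coeff _)) ?_
    rw [sum_const, card_range, smul_eq_mul]
    exact Nat.mul_le_mul_right _ (by omega)
  · rw [coeff_mul, sum_eq_zero]
    · positivity
    · intro p hp
      rw [HasAntidiagonal.mem_antidiagonal] at hp
      rcases le_or_gt N p.1 with h | h
      · rw [hf.degree _ h, zero_mul]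
      · rw [hg.degree p.2 (by omega), mul_zero]

theorem coeff_mul_eq_zero {n N b x y i : ℕ} {f g : ℕ[X]}
    (hf : Packs n N b f x) (hg : Packs n N b g y) (hi : 2 * N ≤ i) : (f * g).coeff i = 0 := by
  rw [coeff_mul, sum_eq_zero]
  intro p hp
  rw [HasAntidiagonal.mem_antidiagonal] at hp
  rcases le_or_gt N p.1 with h | h
  · rw [hf.degree _ h, zero_mul]
  · rw [hg.degree p.2 (by omega), mul_zero]

/-- Reduction modulo `n` and `X ^ N - a` on packed polynomials. -/
theorem packs_reduce {n N a r x : ℕ} {f : ℕ[X]} (hn : 0 < n) (ha : a < n)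
    (hr : 2 * N * (n * n) * (n + 1) * n ≤ 2 ^ r)
    (hf : ∀ i, f.coeff i < 2 * N * (n * n)) (hf' : ∀ i, 2 * N ≤ i → f.coeff i = 0)
    (hx : x = f.eval (2 ^ r * 2 ^ r)) {Z y q : ℕ} (hZ : Z = (2 ^ r * 2 ^ r) ^ N)
    (hy : y = x % Z + x / Z * a)
    (hq : q = (y * (2 ^ r / n + 1) / 2 ^ r) &&&
      ((2 ^ r - 1) * pk (2 ^ r * 2 ^ r) N fun _ => 1)) :
    x < Z * Z ∧ y < Z ∧ y * (2 ^ r / n + 1) < Z ∧ q * n ≤ y ∧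
      Packs n N (2 ^ r * 2 ^ r) (poly N fun i => fold N a f i % n) (y - q * n) := by
  set b := 2 ^ r * 2 ^ r with hb
  -- Coefficients of products are below `E`, after folding below `E * (n + 1)`; the further factor
  -- `n` in `hr` is the margin for approximate division. Coefficients thus fit into `r` bits, and
  -- digits of `2 * r` bits leave room for multiplying by the approximate inverse.
  set E := 2 * N * (n * n) with hE
  have hD : 0 < 2 ^ r := by positivity
  have hfold : ∀ i, fold N a f i < E * (n + 1) := by
    intro i
    have h1 := hf i
    have h2 := Nat.mul_le_mul (hf (N + i)).le ha.le
    rw [mul_add, mul_one, fold]; omega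
  have hfn : ∀ i, fold N a f i * n < 2 ^ r := fun i =>
    lt_of_lt_of_le (Nat.mul_lt_mul_of_pos_right (hfold i) hn) hr
  have hfD : ∀ i, fold N a f i < 2 ^ r := fun i =>
    lt_of_le_of_lt (Nat.le_mul_of_pos_right _ hn) (hfn i)
  have hmu : 2 ^ r / n + 1 ≤ 2 ^ r + 1 := by
    have := Nat.div_le_self (2 ^ r) n; omega
  have hfm : ∀ i, fold N a f i * (2 ^ r / n + 1) < b := by
    intro i
    have h1 : fold N a f i * (2 ^ r / n + 1) * n ≤ fold N a f i * (2 ^ r + n) := by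
      rw [mul_assoc, add_mul, one_mul]
      exact Nat.mul_le_mul_left _ (by have := Nat.div_mul_le_self (2 ^ r) n; omega)
    rcases Nat.eq_zero_or_pos (fold N a f i) with h0 | h0
    · rw [h0, zero_mul]; positivity
    · have hn' : n < 2 ^ r := lt_of_le_of_lt (Nat.le_mul_of_pos_left _ h0) (hfn i)
      -- For `n = 1` the factor is `2 ^ r + 1` instead of at most `2 ^ r`, so the digit bound needs
      -- slack in the coefficient itself.
      rcases Nat.lt_or_ge 1 n with h1n | h1n
      · have h2 : 2 ^ r / n + 1 ≤ 2 ^ r := by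
          have := Nat.div_lt_self hD h1n; omega
        calc _ ≤ fold N a f i * 2 ^ r := Nat.mul_le_mul_left _ h2
          _ < b := Nat.mul_lt_mul_of_pos_right (hfD i) hD
      · have e1 : n = 1 := by omega
        have h3 := hfold i
        have h4 : fold N a f i + 1 < 2 ^ r := by
          have ha0 : a = 0 := by omega
          have := hf i
          rw [e1] at hr
          simp only [fold, ha0, mul_zero, add_zero] at h0 ⊢
          omega
        calc _ ≤ fold N a f i * (2 ^ r + 1) := Nat.mul_le_mul_left _ hmu
          _ < b := by rw [hb]; nlinarith
  have hxp : x = pk b (N + N) f.coeff := by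
    rw [hx, eval_eq_pk fun i hi => hf' i hi, two_mul]
  have hfb : ∀ i, f.coeff i < b := fun i =>
    lt_of_le_of_lt (Nat.le_add_right _ _) (lt_of_le_of_lt (Nat.le_mul_of_pos_right _
      (Nat.succ_pos _)) (hfm i))
  have hlo : pk b N f.coeff < Z := hZ ▸ pk_lt fun i _ => hfb i
  have hZ0 : 0 < Z := by omega
  have hhi := pk_append b N N f.coeff
  rw [← hxp, ← hZ] at hhi
  have hyp : y = pk b N (fold N a f) := by
    rw [hy, hhi, Nat.add_mul_mod_self_left, Nat.mod_eq_of_lt hlo, Nat.add_mul_div_left _ _ hZ0,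
      Nat.div_eq_of_lt hlo, zero_add, ← pk_mul, ← pk_add]
    rfl
  have hqp : q = pk b N fun i => fold N a f i / n := by
    rw [hq, hyp, hb]
    exact pk_barrett hn (fun i _ => hfn i) fun i _ => hfm i
  have hyq : y = q * n + pk b N fun i => fold N a f i % n := by
    rw [hyp, hqp, ← pk_mul, ← pk_add]
    exact pk_congr fun i _ => (Nat.div_add_mod' _ _).symm
  refine ⟨?_, ?_, ?_, by omega, ?_, ?_, ?_⟩
  · rw [hxp, hZ, ← pow_add]
    exact pk_lt fun i _ => hfb i
  · rw [hyp, hZ]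
    exact pk_lt fun i _ => lt_of_le_of_lt (Nat.le_mul_of_pos_right _ (Nat.succ_pos _)) (hfm i)
  · rw [hyp, hZ, ← pk_mul]
    exact pk_lt fun i _ => hfm i
  · rw [eval_poly]; omega
  · intro i
    rw [coeff_poly]
    split_ifs
    · exact Nat.mod_lt _ hn
    · exact hn
  · intro i hi
    rw [coeff_poly, if_neg (by omega)]

end Kronecker

/-! ### Arithmetic in `(ℤ/n)[X]/(X ^ N - a)` on the machine -/

namespace RAM

open Operand Polynomial Kronecker

set_option linter.unusedSimpArgs false

theorem _root_.Kronecker.pk_inj {b N : ℕ} {c d : ℕ → ℕ} (hc : ∀ i < N, c i < b)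
    (hd : ∀ i < N, d i < b) (h : pk b N c = pk b N d) : ∀ i < N, c i = d i := by
  induction N generalizing c d with
  | zero => intro i hi; omega
  | succ N ih =>
    have hc0 := hc 0 (by omega)
    have hd0 := hd 0 (by omega)
    rw [pk_succ', pk_succ'] at h
    have h0 : c 0 = d 0 := by
      have := congr_arg (· % b) h
      simpa [Nat.mod_eq_of_lt hc0, Nat.mod_eq_of_lt hd0] using this
    rw [h0] at h
    have h1 := ih (c := fun i => c (i + 1)) (d := fun i => d (i + 1)) (fun i hi => hc _ (by omega))
      (fun i hi => hd _ (by omega)) (Nat.eq_of_mul_eq_mul_left (by omega) (Nat.add_left_cancel h))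
    intro i hi
    cases i with
    | zero => exact h0
    | succ i => exact h1 i (by omega)

theorem _root_.Kronecker.Packs.inj {n N b x : ℕ} {f g : ℕ[X]} (hb : n ≤ b)
    (hf : Packs n N b f x) (hg : Packs n N b g x) : f = g := by
  have h := hf.eval.symm.trans hg.eval
  rw [eval_eq_pk hf.degree, eval_eq_pk hg.degree] at h
  have h' := pk_inj (fun i _ => (hf.coeff i).trans_le hb) (fun i _ => (hg.coeff i).trans_le hb) h
  ext i
  rcases lt_or_ge i N with hi | hi
  · exact h' i hi
  · rw [hf.degree i hi, hg.degree i hi]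

theorem _root_.Kronecker.Packs.lt {n N b x : ℕ} {f : ℕ[X]} (hb : n ≤ b)
    (hf : Packs n N b f x) : x < b ^ N := by
  rw [hf.eval, eval_eq_pk hf.degree]
  exact pk_lt fun i _ => (hf.coeff i).trans_le hb

/-- The constants for arithmetic in `(ℤ/n)[X]/(X ^ N - a)`. -/
structure Consts (n a N r : ℕ) (σ : Mem) : Prop where
  eq_n : σ 0 = n
  eq_a : σ 1 = a
  eq_D : σ 25 = 2 ^ r
  eq_b : σ 26 = 2 ^ r * 2 ^ r
  eq_mu : σ 27 = 2 ^ r / n + 1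
  eq_Z : σ 28 = (2 ^ r * 2 ^ r) ^ N
  eq_mask : σ 29 = (2 ^ r - 1) * pk (2 ^ r * 2 ^ r) N fun _ => 1

theorem Consts.congr {n a N r : ℕ} {σ τ : Mem} (h : Consts n a N r σ)
    (hτ : ∀ j ∈ [0, 1, 25, 26, 27, 28, 29], τ j = σ j) : Consts n a N r τ where
  eq_n := (hτ 0 (by simp)).trans h.eq_n
  eq_a := (hτ 1 (by simp)).trans h.eq_a
  eq_D := (hτ 25 (by simp)).trans h.eq_D
  eq_b := (hτ 26 (by simp)).trans h.eq_b
  eq_mu := (hτ 27 (by simp)).trans h.eq_mu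
  eq_Z := (hτ 28 (by simp)).trans h.eq_Z
  eq_mask := (hτ 29 (by simp)).trans h.eq_mask

/-- The conditions on the sizes of the parameters. -/
structure Sizes (n a N r B : ℕ) : Prop where
  eight_le : 8 ≤ B
  one_lt : 1 < n
  lt : a < n
  two_le : 2 ≤ N
  le : 2 * N * (n * n) * (n + 1) * n ≤ 2 ^ r
  bits : (2 ^ r * 2 ^ r) ^ N * (2 ^ r * 2 ^ r) ^ N ≤ 2 ^ B

theorem Sizes.le_base {n a N r B : ℕ} (h : Sizes n a N r B) : n ≤ 2 ^ r * 2 ^ r := by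
  have h1 : 1 ≤ 2 * N * (n * n) * (n + 1) := by
    have := h.two_le
    have := h.one_lt
    have : 0 < 2 * N * (n * n) * (n + 1) := by positivity
    exact this
  have h2 := Nat.mul_le_mul_right n h1
  have h3 := h.le
  have h4 := Nat.le_mul_self (2 ^ r)
  omega

/-- Reduction modulo `n` and `X ^ N - a` of register `30`. -/
def reduceP : Prog := blk [divP 34 (reg 30) (reg 28), mulP 35 (reg 34) (reg 28),
  subP 35 (reg 30) (reg 35), mulP 34 (reg 34) (reg 1), addP 30 (reg 35) (reg 34),
  mulP 34 (reg 30) (reg 27), divP 34 (reg 34) (reg 25), andP 34 (reg 34) (reg 29),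
  mulP 34 (reg 34) (reg 0), subP 30 (reg 30) (reg 34)]

theorem reduceP_spec {n a N r B : ℕ} (hs : Sizes n a N r B) {σ : Mem} (hσ : Consts n a N r σ)
    {f : ℕ[X]} (hf : ∀ i, f.coeff i < 2 * N * (n * n)) (hf' : ∀ i, 2 * N ≤ i → f.coeff i = 0)
    (h30 : σ 30 = f.eval (2 ^ r * 2 ^ r)) :
    Tri B 10 reduceP σ fun τ => (∀ j, j ∉ [30, 34, 35] → τ j = σ j) ∧
      ∃ g, Packs n N (2 ^ r * 2 ^ r) g (τ 30) ∧ toRing n N a g = toRing n N a f := by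
  have hn := hs.one_lt
  obtain ⟨h1, h2, h3, h4, h5⟩ := packs_reduce (x := σ 30) (by omega) hs.lt hs.le hf hf' h30 rfl
    rfl rfl
  have hZ : (2 ^ r * 2 ^ r) ^ N ≤ 2 ^ B := le_trans (Nat.le_mul_self _) hs.bits
  refine Tri.of_wp hs.eight_le rfl fun hb => ?_
  have h30' := hb 30
  simp [reduceP, blk_cons, blk_singleton, wp, val, Dest.addr, Function.update_apply, hσ.eq_n, hσ.eq_a,
    hσ.eq_D, hσ.eq_b, hσ.eq_mu, hσ.eq_Z, hσ.eq_mask, sub_div_mul]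
  refine ⟨div_mul_lt h30', lt_of_le_of_lt (Nat.le_add_left _ _) (h2.trans_le hZ), by omega, by omega, by omega, fun j j1 j2 j3 => ?_, _, h5,
    toRing_fold hf'⟩
  simp [j1, j2, j3]

/-- `d := s * t` in `(ℤ/n)[X]/(X ^ N - a)`. -/
def mulRingP (s t d : ℕ) : Prog :=
  blk [mulP 30 (reg s) (reg t), reduceP, addP d (reg 30) (lit 0)]

theorem mulRingP_spec {n a N r B s t d : ℕ} (hs : Sizes n a N r B) {σ : Mem}
    (hσ : Consts n a N r σ) (hs' : s < 256) (ht' : t < 256) (hd : d < 256)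
    {f g : ℕ[X]} (hf : Packs n N (2 ^ r * 2 ^ r) f (σ s)) (hg : Packs n N (2 ^ r * 2 ^ r) g (σ t)) :
    Tri B 12 (mulRingP s t d) σ fun τ =>
      (∀ j, j ∉ [30, 34, 35, d] → τ j = σ j) ∧
      ∃ p, Packs n N (2 ^ r * 2 ^ r) p (τ d) ∧
        toRing n N a p = toRing n N a f * toRing n N a g := by
  have hn := hs.one_lt
  have hN := hs.two_le
  refine (Tri.cons (k₁ := 1) (k₂ := 10 + 1) (Q' := fun τ => τ 30 = σ s * σ t ∧
    ∀ j, j ≠ 30 → τ j = σ j) (Tri.of_wp hs.eight_le (by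
      simp [Prog.straight, Dest.small, small, hs', ht']) fun hb => ?_) ?_).mono le_rfl fun _ _ => id
  · simp [blk_cons, blk_singleton, wp, val, Dest.addr, Function.update_apply]
    refine ⟨lt_of_lt_of_le (Nat.mul_lt_mul'' (hf.lt hs.le_base) (hg.lt hs.le_base)) hs.bits,
      fun j j1 => by simp [j1]⟩
  rintro τ ⟨h30, hτ⟩
  have hmulc : ∀ i, (f * g).coeff i < 2 * N * (n * n) := fun i =>
    coeff_mul_lt (by omega) (by omega) hf hg
  have hτc : Consts n a N r τ := hσ.congr (by simp [hτ])
  refine Tri.cons (reduceP_spec hs hτc hmulc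
    (fun i hi => coeff_mul_eq_zero hf hg hi) (by rw [h30, eval_mul, ← hf.eval, ← hg.eval])) ?_
  rintro ρ ⟨hρ, p, hp, hp'⟩
  refine Tri.of_wp hs.eight_le (by simp [blk, Prog.straight, Dest.small, small, hd]) fun hb => ?_
  have h30 := hb 30
  simp [blk_cons, blk_singleton, wp, val, Dest.addr, Function.update_apply]
  refine ⟨h30, fun j j1 j2 j3 j4 => ?_, p, hp, by rw [hp', map_mul]⟩
  simp [j1, j2, j3, j4, hρ j (by simp [j1, j2, j3]), hτ j j1]

/-- `r₃₁ := r₃₂ ^ n` in `(ℤ/n)[X]/(X ^ N - a)`. -/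
def powRingP : Prog := blk [
  blk [addP 31 (lit 1) (lit 0), addP 33 (reg 0) (lit 0)],
  .loop (reg 33) (blk [
    andP 24 (reg 33) (lit 1),
    .ite (reg 24) (mulRingP 31 32 31) .skip,
    mulRingP 32 32 32,
    divP 33 (reg 33) (lit 2)])]

theorem packs_one {n N b : ℕ} (hn : 1 < n) (hN : 0 < N) : Packs n N b 1 1 where
  eval := by simp
  coeff i := by rw [coeff_one]; split_ifs <;> omega
  degree i hi := by rw [coeff_one, if_neg (by omega)]

theorem powRingP_spec {n a N r B : ℕ} (hs : Sizes n a N r B) {σ : Mem} (hσ : Consts n a N r σ)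
    {f : ℕ[X]} (hf : Packs n N (2 ^ r * 2 ^ r) f (σ 32)) :
    Tri B (28 * n.size + 3) powRingP σ fun τ =>
      (∀ j, j ∉ [24, 30, 31, 32, 33, 34, 35] → τ j = σ j) ∧
      ∃ g, Packs n N (2 ^ r * 2 ^ r) g (τ 31) ∧ toRing n N a g = toRing n N a f ^ n := by
  have hn := hs.one_lt
  have hN := hs.two_le
  refine (Tri.cons (k₁ := 2) (k₂ := n.size * (27 + 1) + 1) (Q' := fun τ => τ 31 = 1 ∧ τ 33 = n ∧
    ∀ j, j ∉ [31, 33] → τ j = σ j) (Tri.of_wp hs.eight_le rfl fun hb => ?_) ?_).mono (by omega)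
      fun _ _ => id
  · have h0 := hb 0
    have := lt_two_pow_of_small hs.eight_le (show 1 < 256 by norm_num)
    simp [blk_cons, blk_singleton, wp, val, Dest.addr, Function.update_apply, hσ.eq_n] at h0 ⊢
    have := hs.eight_le
    exact ⟨by omega, h0, fun j j1 j2 => by simp [j1, j2]⟩
  rintro τ ⟨h31, h33, hτ⟩
  rw [blk_singleton]
  -- Binary powering from the lowest bit: accumulator times base to the remaining exponent is
  -- constant, and the length of that exponent counts the rounds.
  refine (Tri.loop hs.eight_le rfl (fun i τ => (τ 33).size = i ∧
    (∀ j, j ∉ [24, 30, 31, 32, 33, 34, 35] → τ j = σ j) ∧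
    ∃ g h, Packs n N (2 ^ r * 2 ^ r) g (τ 31) ∧ Packs n N (2 ^ r * 2 ^ r) h (τ 32) ∧
      toRing n N a g * toRing n N a h ^ τ 33 = toRing n N a f ^ n) ?_ ?_ ⟨by rw [h33],
        fun j hj => hτ j (by simp at hj ⊢; omega), 1, f, by rw [h31]; exact packs_one hn (by omega),
        by rwa [hτ 32 (by simp)], by rw [h33, map_one, one_mul]⟩).mono le_rfl ?_
  · rintro τ ⟨h, -⟩
    exact Nat.size_eq_zero.1 h
  · rintro i τ ⟨hi, hj, g, h, hg, hh, hgh⟩ h0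
    simp only [val] at h0
    rw [size_div_two h0] at hi
    refine Tri.cons (k₁ := 1) (k₂ := (12 + 1) + (12 + 1)) (Q' := fun ρ => ρ 24 = τ 33 % 2 ∧
      ∀ j, j ≠ 24 → ρ j = τ j) (Tri.of_wp hs.eight_le rfl fun hb => ?_) ?_
    · simp [wp, val, Dest.addr, Function.update_apply]
      exact fun j j1 => by simp [j1]
    rintro ρ ⟨h24, hρ⟩
    replace hj : ∀ j, j ∉ [24, 30, 31, 32, 33, 34, 35] → ρ j = σ j := fun j h => by
      rw [hρ j (by simp at h; omega), hj j h]
    rw [← hρ 31 (by simp)] at hg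
    rw [← hρ 32 (by simp)] at hh
    rw [← hρ 33 (by simp)] at hi h24 hgh
    clear hρ
    have hc : Consts n a N r ρ := hσ.congr fun j h => hj j (by simp at h ⊢; omega)
    refine Tri.cons (Q' := fun μ => (∀ j, j ∉ [24, 30, 31, 32, 33, 34, 35] → μ j = σ j) ∧
      μ 33 = ρ 33 ∧ ∃ g' h, Packs n N (2 ^ r * 2 ^ r) g' (μ 31) ∧
      Packs n N (2 ^ r * 2 ^ r) h (μ 32) ∧ toRing n N a g' * (toRing n N a h * toRing n N a h) ^
        (ρ 33 / 2) = toRing n N a f ^ n)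
      (Tri.ite hs.eight_le rfl (fun h0 => ?_) fun h0 => ?_) ?_
    · refine (mulRingP_spec hs hc (by norm_num) (by norm_num) (by norm_num) hg hh).mono le_rfl ?_
      rintro μ - ⟨hμ, p, hp, hp'⟩
      refine ⟨fun j h => by rw [hμ j (by simp at h ⊢; omega), hj j h], hμ _ (by simp), p, h, hp,
        by rwa [hμ 32 (by simp)], ?_⟩
      simp only [val] at h0
      rw [hp', ← hgh, ← pow_two, ← pow_mul, mul_assoc, ← pow_succ']
      congr 2
      omega
    · refine (Tri.of_wp (P := .skip) (Q := fun τ => τ = ρ) hs.eight_le rfl fun hb => rfl).mono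
        (by simp only [Prog.size]; omega) ?_
      rintro μ - rfl
      simp only [val] at h0
      refine ⟨hj, rfl, g, h, hg, hh, ?_⟩
      rw [← hgh, ← pow_two, ← pow_mul]
      congr 2
      omega
    rintro μ ⟨hj, h33, g', h', hg', hh', he⟩
    have hc : Consts n a N r μ := hσ.congr fun j h => hj j (by simp at h ⊢; omega)
    refine Tri.cons (mulRingP_spec hs hc (by norm_num) (by norm_num) (by norm_num) hh' hh') ?_
    rintro ν ⟨hν, p, hp, hp'⟩
    refine Tri.of_wp hs.eight_le rfl fun hb => ?_
    simp [blk_cons, blk_singleton, wp, val, Dest.addr, Function.update_apply]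
    rw [hν 33 (by simp), h33]
    refine ⟨by omega, fun j j1 j2 j3 j4 j5 j6 j7 => ?_, g', by rwa [hν 31 (by simp)], p, hp,
      by rw [hp', he]⟩
    simp [j5, hν j (by simp; omega), hj j (by simp; omega)]
  · rintro τ - ⟨⟨i, hi, hj, g, h, hg, hh, hgh⟩, h0⟩
    simp only [val] at h0
    rw [h0, pow_zero, mul_one] at hgh
    exact ⟨hj, g, hg, hgh⟩

/-! ### The polynomial congruences -/

/-- The congruence `(1 + c X) ^ n = 1 + c X ^ n` modulo `n` and `X ^ N - a`. -/
def PolyTest (n N a c : ℕ) : Prop :=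
  toRing n N a (C c * X + 1) ^ n = toRing n N a (C c * X ^ n + 1)

/-- For prime `n` the Frobenius map is additive and fixes the residue of `c`. -/
theorem PolyTest.of_prime {n : ℕ} (hn : n.Prime) (N a c : ℕ) : PolyTest n N a c := by
  have : Fact n.Prime := ⟨hn⟩
  unfold PolyTest
  rw [← map_pow]
  simp only [toRing, RingHom.comp_apply]
  congr 1
  simp [add_pow_char, mul_pow]
  rw [← Polynomial.C_eq_natCast, ← C_pow, ZMod.pow_card]

/-- Computation of the constants for arithmetic in `(ℤ/n)[X]/(X ^ N - a)`. -/
def constsP : Prog := blk [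
  blk [mulP 24 (reg 13) (reg 13), mulP 24 (reg 24) (reg 24), mulP 24 (reg 24) (reg 8),
    mulP 25 (reg 24) (lit 2), mulP 26 (reg 25) (reg 25), divP 27 (reg 25) (reg 0),
    addP 27 (reg 27) (lit 1), addP 28 (reg 26) (lit 0), divP 24 (reg 8) (lit 2)],
  .loop (reg 24) (blk [mulP 28 (reg 28) (reg 28), divP 24 (reg 24) (lit 2)]),
  blk [subP 24 (reg 28) (lit 1), subP 34 (reg 26) (lit 1), divP 24 (reg 24) (reg 34),
    subP 34 (reg 25) (lit 1), mulP 29 (reg 34) (reg 24)]]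

theorem constsP_spec {n a k v s r B : ℕ} (hs : Sizes n a (2 ^ s) r B) (hss : s = 2 * hh n + 2 * v)
    (hr : r = 4 * n.size + s + 1) {σ : Mem} (hσ : Params n a k v σ) :
    Tri B (3 * s + 15) constsP σ fun τ => Consts n a (2 ^ s) r τ ∧
      ∀ j, j ∉ [24, 25, 26, 27, 28, 29, 34] → τ j = σ j := by
  have hn := hs.one_lt
  have hB := hs.eight_le
  obtain ⟨b, hb⟩ : ∃ b, b = 2 ^ r * 2 ^ r := ⟨_, rfl⟩
  have hr2 : 2 ≤ 2 ^ r := Nat.le_self_pow (by omega) 2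
  have hrb : 2 * 2 ^ r ≤ b := hb ▸ Nat.mul_le_mul_right _ hr2
  have hbZ : b ≤ b ^ 2 ^ s := Nat.le_self_pow (by positivity) _
  have hZ : 2 * b ^ 2 ^ s ≤ 2 ^ B := by
    refine le_trans (Nat.mul_le_mul_right _ (by omega : 2 ≤ b ^ 2 ^ s)) ?_
    rw [hb]; exact hs.bits
  have hp : ∀ {p}, p ≤ r → 2 ^ p < 2 ^ B := fun h => by
    have := Nat.pow_le_pow_right (show 0 < 2 by norm_num) h
    omega
  have e8 : σ 8 = 2 ^ s := hσ.eq_N.trans (by rw [hss])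
  refine (Tri.cons (k₁ := 9) (k₂ := (s * (2 + 1) + 1) + 5) (Q' := fun τ => τ 25 = 2 ^ r ∧
    τ 26 = b ∧ τ 27 = 2 ^ r / n + 1 ∧ τ 28 = b ∧ τ 24 = 2 ^ s / 2 ∧
    ∀ j, j ∉ [24, 25, 26, 27, 28, 29, 34] → τ j = σ j)
    (Tri.of_wp hB rfl fun hb' => ?_) ?_).mono (by omega) fun _ _ => id
  · have e1 : 2 ^ n.size * 2 ^ n.size = 2 ^ (2 * n.size) := by rw [← pow_add]; congr 1; ring
    have e2 : 2 ^ (2 * n.size) * 2 ^ (2 * n.size) = 2 ^ (4 * n.size) := by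
      rw [← pow_add]; congr 1; ring
    have e3 : 2 ^ (4 * n.size) * 2 ^ s * 2 = 2 ^ r := by rw [← pow_add, ← pow_succ, hr]
    have h27 : 2 ^ r / n < 2 ^ r := Nat.div_lt_self (by positivity) hn
    simp [blk_cons, blk_singleton, wp, val, Dest.addr, Function.update_apply, hσ.eq_P, e8, e1, e2,
      e3, ← hb, hσ.eq_n]
    refine ⟨hp (by omega), hp (by omega), by rw [← pow_add]; exact hp (by omega), hp le_rfl,
      by omega, by omega, by omega, fun j j1 j2 j3 j4 j5 j6 j7 => by simp [j1, j2, j3, j4, j5]⟩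
  rintro τ ⟨h25, h26, h27, h28, h24, hτ⟩
  refine Tri.cons ((Tri.loop hB rfl (fun i τ => τ 24 = 2 ^ i / 2 ∧ τ 25 = 2 ^ r ∧
    τ 26 = b ∧ τ 27 = 2 ^ r / n + 1 ∧ (∃ e, e + i = s ∧ τ 28 = b ^ 2 ^ e) ∧
    ∀ j, j ∉ [24, 25, 26, 27, 28, 29, 34] → τ j = σ j) ?_ ?_
      ⟨h24, h25, h26, h27, ⟨0, by omega, by rw [h28]; simp⟩, hτ⟩).mono le_rfl fun _ _ => id) ?_
  · rintro τ ⟨h, -⟩; exact h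
  · rintro i τ ⟨h24, h25, h26, h27, ⟨e, he, h28⟩, hτ⟩ -
    refine Tri.of_wp hB rfl fun hb' => ?_
    rw [two_pow_succ_div_two] at h24
    have e1 : b ^ 2 ^ e * b ^ 2 ^ e = b ^ 2 ^ (e + 1) := by
      rw [← pow_add, ← two_mul, ← pow_succ']
    have e2 : b ^ 2 ^ (e + 1) ≤ b ^ 2 ^ s :=
      Nat.pow_le_pow_right (by omega) (Nat.pow_le_pow_right (by norm_num) (by omega))
    simp [blk_cons, blk_singleton, wp, val, Dest.addr, Function.update_apply, h24, h25, h26, h27,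
      h28, e1]
    exact ⟨by omega, ⟨e + 1, by omega, rfl⟩, fun j j1 j2 j3 j4 j5 j6 j7 => by
      simp [j1, j5, hτ j (by simp; omega)]⟩
  rintro τ ⟨⟨i, h24, h25, h26, h27, ⟨e, he, h28⟩, hτ⟩, h0⟩
  obtain rfl : i = 0 := eq_zero_of_two_pow_div_two (h24.symm.trans h0)
  obtain rfl : e = s := he
  rw [blk_singleton]
  refine Tri.of_wp hB rfl fun hb' => ?_
  have e1 := pk_one (b := b) (by omega) (2 ^ e)
  have h29 : (2 ^ r - 1) * pk b (2 ^ e) (fun _ => 1) < b ^ 2 ^ e := by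
    rw [mul_comm, ← pk_mul]
    exact pk_lt fun i _ => by omega
  simp [blk_cons, blk_singleton, wp, val, Dest.addr, Function.update_apply, h25, h26, h28, e1]
  refine ⟨by omega, ?_, fun j j1 j2 j3 j4 j5 j6 j7 => by simp [j1, j6, j7, hτ j (by simp; omega)]⟩
  constructor <;> simp [h25, h26, h27, h28, hb, hτ, hσ.eq_n, hσ.eq_a]

/-- One polynomial congruence, for the representative stored in register `63 + r₂₀`. -/
def testP : Prog := blk [
  blk [addP 21 (reg 20) (lit 63), divP 37 (ind 21) (reg 0), addP 32 (reg 26) (lit 0)],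
  powRingP,
  blk [mulP 30 (reg 31) (reg 37), addP 30 (reg 30) (lit 1)],
  reduceP,
  blk [addP 36 (reg 30) (lit 0), mulP 32 (reg 37) (reg 26), addP 32 (reg 32) (lit 1)],
  powRingP,
  blk [subP 24 (reg 36) (reg 31), subP 34 (reg 31) (reg 36), addP 24 (reg 24) (reg 34),
    .ite (reg 24) (addP 11 (lit 0) (lit 0)) .skip, subP 20 (reg 20) (lit 1)]]

theorem coeff_C_mul_add_one (c : ℕ) (g : ℕ[X]) (i : ℕ) :
    (C c * g + 1).coeff i = c * g.coeff i + if i = 0 then 1 else 0 := by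
  rw [coeff_add, coeff_C_mul, coeff_one]

theorem testP_spec {n a N r B c i : ℕ} {A : Prop} (hs : Sizes n a N r B) (hc : c < n)
    {σ : Mem} (hσ : Consts n a N r σ) (hi : σ 20 = i + 1) (hci : σ (64 + i) / n = c)
    (hiB : i + 64 < 2 ^ B) (hf : Flag n A σ) :
    Tri B (56 * n.size + 35) testP σ fun τ => Consts n a N r τ ∧ τ 20 = i ∧ τ 15 = σ 15 ∧
      (∀ j, 64 ≤ j → τ j = σ j) ∧ Flag n (A ∧ PolyTest n N a c) τ := by
  have hn := hs.one_lt
  have hN := hs.two_le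
  have hB := hs.eight_le
  have hbn := hs.le_base
  obtain ⟨b, hb⟩ : ∃ b, b = 2 ^ r * 2 ^ r := ⟨_, rfl⟩
  rw [← hb] at hbn
  have hbits := hs.bits
  rw [← hb] at hbits
  have hcN : ∀ x < n, c * x + 1 < 2 * N * (n * n) := fun x hx => by
    have h1 : c * x < n * n := Nat.mul_lt_mul'' hc hx
    have h2 : 2 * 2 * (n * n) ≤ 2 * N * (n * n) := Nat.mul_le_mul_right _ (by omega)
    omega
  have hX : Packs n N b X b := by
    refine ⟨by simp, fun i => ?_, fun i hi => ?_⟩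
    · rw [coeff_X]; split_ifs <;> omega
    · rw [coeff_X, if_neg (by omega)]
  have hcX : Packs n N b (C c * X + 1) (c * b + 1) := by
    refine ⟨by simp, fun i => ?_, fun i hi => ?_⟩
    · rw [coeff_C_mul_add_one, coeff_X]
      by_cases h1 : 1 = i
      · subst h1; simpa using hc
      · rw [if_neg h1]; split_ifs <;> omega
    · rw [coeff_C_mul_add_one, coeff_X, if_neg (by omega), if_neg (by omega), mul_zero]
  have hcXlt := hcX.lt hbn
  have hZB : b ^ N ≤ 2 ^ B := le_trans (Nat.le_mul_self _) hbits
  refine (Tri.cons (k₁ := 3) (k₂ := (28 * n.size + 3) + (2 + (10 + (3 + ((28 * n.size + 3) + 7)))))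
    (Q' := fun τ => τ 37 = c ∧ τ 32 = b ∧ ∀ j, j ∉ [21, 37, 32] → τ j = σ j)
    (Tri.of_wp hB rfl fun hb' => ?_) ?_).mono (by omega) fun _ _ => id
  · have e : i + 1 + 63 = 64 + i := by omega
    have h26 := hb' 26
    rw [hσ.eq_b, ← hb] at h26
    have e1 : ¬ 64 + i = 21 := by omega
    simp [blk_cons, blk_singleton, wp, val, Dest.addr, Function.update_apply, hi, e, hσ.eq_n,
      hσ.eq_b, hci, ← hb, e1]
    exact ⟨by omega, h26, fun j j1 j2 j3 => by simp [j1, j2, j3]⟩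
  rintro τ ⟨h37, h32, hτ⟩
  have hτc : Consts n a N r τ := hσ.congr (by simp [hτ])
  -- The right-hand side also needs a power in the ring, because `X ^ n` has to be reduced.
  -- Recomputing it for every representative only doubles the number of multiplications.
  refine Tri.cons (powRingP_spec hs hτc (f := X) (by rw [h32, ← hb]; exact hX)) ?_
  rintro ρ ⟨hρ, g, hg, hg'⟩
  replace h37 : ρ 37 = c := by rw [hρ 37 (by simp), h37]
  replace hτ : ∀ j, j ∉ [21, 24, 30, 31, 32, 33, 34, 35, 36, 37] → ρ j = σ j := fun j hj => by
    simp at hj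
    rw [hρ j (by simp; omega), hτ j (by simp; omega)]
  clear hρ hτc h32
  rw [← hb] at hg
  have hC1 : (C c * g + 1).eval b = ρ 31 * c + 1 := by
    rw [hg.eval]; simp [mul_comm]
  refine Tri.cons (Q' := fun μ => μ 30 = (C c * g + 1).eval b ∧ μ 37 = c ∧
    ∀ j, j ∉ [21, 24, 30, 31, 32, 33, 34, 35, 36, 37] → μ j = σ j)
    (Tri.of_wp hB rfl fun hb' => ?_) ?_
  · have h1 : ρ 31 * c + 1 < 2 ^ B := by
      refine lt_of_lt_of_le ?_ hbits
      have h2 := hg.lt hbn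
      have h3 : c * b + 1 < b ^ N := hcXlt
      have h4 : c + 1 ≤ b ^ N := by nlinarith
      have h5 : ρ 31 * c ≤ ρ 31 * b ^ N := Nat.mul_le_mul_left _ (by omega)
      have h6 : (ρ 31 + 1) * b ^ N ≤ b ^ N * b ^ N := Nat.mul_le_mul_right _ h2
      rcases Nat.eq_zero_or_pos (ρ 31) with h0 | h0
      · rw [h0, zero_mul]; nlinarith
      · rw [add_mul] at h6; omega
    simp only [hC1]
    simp [blk_cons, blk_singleton, wp, val, Dest.addr, Function.update_apply, h37]
    exact ⟨by omega, h1, fun j j1 j2 j3 j4 j5 j6 j7 j8 j9 j10 => by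
      simp [j3, hτ j (by simp; omega)]⟩
  clear hτ h37
  rintro ρ' ⟨h30, h37, hτ⟩
  have hc' : Consts n a N r ρ' := hσ.congr (by simp [hτ])
  refine Tri.cons (reduceP_spec hs hc' (f := C c * g + 1) (fun i => ?_) (fun i hi => ?_)
    (by rw [h30, hb])) ?_
  · have h1 := hcN _ (hg.coeff i)
    rw [coeff_C_mul_add_one]
    split_ifs <;> omega
  · rw [coeff_C_mul_add_one, hg.degree i (by omega), if_neg (by omega), mul_zero]
  rintro μ ⟨hμ, p, hp, hp'⟩
  replace h37 : μ 37 = c := by rw [hμ 37 (by simp), h37]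
  replace hτ : ∀ j, j ∉ [21, 24, 30, 31, 32, 33, 34, 35, 36, 37] → μ j = σ j := fun j hj => by
    simp at hj
    rw [hμ j (by simp; omega), hτ j (by simp; omega)]
  clear hμ h30 hc'
  rw [← hb] at hp
  refine Tri.cons (Q' := fun ν => ν 36 = μ 30 ∧ ν 32 = c * b + 1 ∧
    ∀ j, j ∉ [21, 24, 30, 31, 32, 33, 34, 35, 36, 37] → ν j = σ j)
    (Tri.of_wp hB rfl fun hb' => ?_) ?_
  · have h30 := hb' 30
    have h26 := hτ 26 (by simp)
    rw [hσ.eq_b, ← hb] at h26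
    simp [blk_cons, blk_singleton, wp, val, Dest.addr, Function.update_apply, h37, h26]
    exact ⟨h30, by omega, by omega, fun j j1 j2 j3 j4 j5 j6 j7 j8 j9 j10 => by
      simp [j5, j9, hτ j (by simp; omega)]⟩
  rintro ν ⟨h36, h32, hν⟩
  have hc' : Consts n a N r ν := hσ.congr (by simp [hν])
  refine Tri.cons (powRingP_spec hs hc' (f := C c * X + 1) (by rw [h32, ← hb]; exact hcX)) ?_
  rintro κ ⟨hκ, q, hq, hq'⟩
  rw [← hb] at hq
  rw [← hκ 36 (by simp)] at h36
  replace hν : ∀ j, j ∉ [21, 24, 30, 31, 32, 33, 34, 35, 36, 37] → κ j = σ j := fun j hj => by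
    simp at hj
    rw [hκ j (by simp; omega), hν j (by simp; omega)]
  clear hκ hc'
  have hpt : toRing n N a p = toRing n N a (C c * X ^ n + 1) := by
    rw [hp', map_add, map_mul, hg', map_add, map_mul, map_pow]
  rw [← h36] at hp
  rw [blk_singleton]
  refine Tri.of_wp hB rfl fun hb' => ?_
  have k36 := hp.lt hbn
  have k31 := hq.lt hbn
  have h20 := hν 20 (by simp)
  have h11 := hν 11 (by simp)
  have hκc : Consts n a N r κ := hσ.congr (by simp [hν])
  simp [blk_cons, blk_singleton, wp, val, Dest.addr, Function.update_apply, h20, hi]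
  refine ⟨by omega, fun h => ⟨hκc.congr (by simp [Function.update_apply]), hν 15 (by simp),
    fun j hj => ?_, Flag.zero rfl fun hpr => ?_⟩,
    fun h h' => ⟨hκc.congr (by simp [Function.update_apply]), hν 15 (by simp),
      fun j hj => ?_, hf.congr h11 fun hA => ⟨hA, ?_⟩⟩⟩
  · have : j ≠ 20 ∧ j ≠ 11 ∧ j ≠ 24 ∧ j ≠ 34 := by omega
    simp [this, hν j (by simp; omega)]
  · have : κ 36 = κ 31 := toRing_injOn hn (by omega) hp hq
      (by rw [hpt, hq', PolyTest.of_prime hpr])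
    omega
  · have : j ≠ 20 ∧ j ≠ 24 ∧ j ≠ 34 := by omega
    simp [this, hν j (by simp; omega)]
  · have e : κ 36 = κ 31 := by omega
    rw [e] at hp
    rw [PolyTest, ← hq', ← hpt, hp.inj hbn hq]

/-- The polynomial congruences for all representatives. -/
def polyP : Prog := blk [
  constsP,
  addP 20 (reg 15) (lit 0),
  .loop (reg 20) testP]

theorem polyP_spec {n a k v s r W M m B : ℕ} {f : ℕ → ℕ} {A : Prop}
    (hs : Sizes n a (2 ^ s) r B) (hss : s = 2 * hh n + 2 * v) (hr : r = 4 * n.size + s + 1)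
    (hMn : M < n) (hm : m + 64 < 2 ^ B) {σ : Mem} (hσ : Params n a k v σ)
    (hR : Reps n W M m f σ) (hf : Flag n A σ) :
    Tri B (3 * s + 17 + m * (56 * n.size + 36)) polyP σ fun τ =>
      Flag n (A ∧ ∀ i < m, PolyTest n (2 ^ s) a (f i)) τ := by
  have hB := hs.eight_le
  have hn := hs.one_lt
  have hdiv : ∀ i < m, σ (64 + i) / n = f i := fun i hi => by
    rw [hR.code i hi, mul_comm, Nat.mul_add_div (by omega), Nat.div_eq_of_lt (Nat.mod_lt _
      (by omega)), add_zero]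
  refine (Tri.cons (constsP_spec hs hss hr hσ) (k₂ := 1 + (m * ((56 * n.size + 35) + 1) + 1))
    ?_).mono (le_of_eq (by ring)) fun _ _ => id
  rintro τ ⟨hc, hτ⟩
  refine Tri.cons (Q' := fun ρ => Consts n a (2 ^ s) r ρ ∧ ρ 20 = m ∧ ρ 11 = σ 11 ∧
    ∀ j, 64 ≤ j → ρ j = σ j) (Tri.of_wp hB rfl fun hb => ?_) ?_
  · simp [wp, val, Dest.addr, Function.update_apply, hτ 15 (by simp), hR.card]
    refine ⟨by omega, hc.congr (by simp [Function.update_apply]), hτ 11 (by simp), fun j hj => ?_⟩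
    have : j ≠ 20 := by omega
    simp [this, hτ j (by simp; omega)]
  rintro ρ ⟨hc, h20, h11, hρ⟩
  rw [blk_singleton]
  refine (Tri.loop hB rfl (fun i τ => τ 20 = i ∧ i ≤ m ∧ Consts n a (2 ^ s) r τ ∧
    (∀ j, 64 ≤ j → τ j = σ j) ∧ Flag n (A ∧ ∀ j, i ≤ j → j < m → PolyTest n (2 ^ s) a (f j)) τ)
    ?_ ?_ ⟨h20, le_rfl, hc, hρ, hf.congr h11 fun h => ⟨h, by omega⟩⟩).mono le_rfl ?_
  · rintro τ ⟨h, -⟩; exact h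
  · rintro i τ ⟨hi, him, hc, hj, hF⟩ -
    refine (testP_spec hs (lt_of_le_of_lt (hR.le i him) hMn) hc hi
      (by rw [hj _ (by omega), hdiv i him]) (by omega) hF).mono le_rfl ?_
    rintro μ - ⟨hc, hi, -, hμ, hF⟩
    refine ⟨hi, by omega, hc, fun j h => by rw [hμ j h, hj j h], hF.congr rfl fun h => ⟨h.1.1,
      fun j h1 h2 => ?_⟩⟩
    rcases h1.eq_or_lt with rfl | h1
    · exact h.2
    · exact h.1.2 j h1 h2
  · rintro τ - ⟨⟨i, hi, -, -, -, hF⟩, h0⟩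
    obtain rfl : i = 0 := hi.symm.trans h0
    exact hF.congr rfl fun h => ⟨h.1, fun j hj => h.2 j (Nat.zero_le _) hj⟩

end RAM

/-! ### Correctness: the counting argument -/

namespace KummerTest

open Polynomial Finset

/-- Distinct proper subsets of `S` give distinct products of the linear polynomials `1 + b X`. -/
theorem prod_linear_injective {K : Type*} [Field K] {S T T' : Finset K} (hS : ∀ b ∈ S, b ≠ 0)
    (hT : T ⊆ S) (hT' : T' ⊆ S)
    (h : ∏ b ∈ T, (1 + C b * X) = ∏ b ∈ T', (1 + C b * X : K[X])) : T = T' := by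
  have key : ∀ {T T' : Finset K}, T ⊆ S → T' ⊆ S →
      ∏ b ∈ T, (1 + C b * X) = ∏ b ∈ T', (1 + C b * X : K[X]) → T ⊆ T' := by
    intro T T' hT hT' h b hb
    have hb0 := hS b (hT hb)
    -- The root `-b⁻¹` belongs to the factor `1 + b X` and to no other.
    have h1 := congr_arg (eval (-b⁻¹)) h
    rw [eval_prod, eval_prod, prod_eq_zero hb (by simp [hb0]), eq_comm, prod_eq_zero_iff] at h1
    obtain ⟨c, hc, hc'⟩ := h1
    simp only [eval_add, eval_one, eval_mul, eval_C, eval_X] at hc'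
    have : c = b := by field_simp at hc'; linear_combination -hc'
    rwa [← this]
  exact (key hT hT' h).antisymm (key hT' hT h.symm)

theorem natDegree_prod_linear_le {K : Type*} [Field K] (T : Finset K) :
    (∏ b ∈ T, (1 + C b * X : K[X])).natDegree ≤ T.card := by
  refine (natDegree_prod_le _ _).trans ?_
  refine (sum_le_card_nsmul T _ 1 fun b _ => ?_).trans (by simp)
  compute_degree

/-- The counting argument: if the linear polynomials `1 + b X` with `b ∈ S` are mapped by the
exponents `n` and `p` as by substitutions and `2 ^ |S|` is large, then `n` and `p` are
multiplicatively dependent. -/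
theorem exists_pow_mul_pow_eq {K : Type*} [Field K] {n p N R : ℕ} {a θ : K}
    (hN : 0 < N) (hθ : θ ^ N = a) {S : Finset K} (hS : ∀ b ∈ S, b ≠ 0) (han : a ^ n = a)
    (hap : a ^ p = a) (hSn : ∀ b ∈ S, ∀ x, x ^ N = a → (1 + b * x) ^ n = 1 + b * x ^ n)
    (hSp : ∀ b ∈ S, ∀ x, x ^ N = a → (1 + b * x) ^ p = 1 + b * x ^ p)
    (hinj : ∀ i j, i < j → j < S.card → θ ^ n ^ i ≠ θ ^ n ^ j) (hR : N < (R + 1) * (R + 1))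
    (hpn : p ≤ n) (hn : 0 < n) (hbig : n ^ (2 * R) < 2 ^ S.card - 1) :
    ∃ i l i' l', (i, l) ≠ (i', l') ∧ n ^ i * p ^ l = n ^ i' * p ^ l' := by
  classical
  -- Exponents which preserve the `N`-th roots of `a` and act on every `1 + b x` by substitution are
  -- closed under multiplication. All roots `x` have to be treated together, because the first of
  -- two exponents moves the root to which the second is applied.
  have hE : ∀ i l, (∀ x, x ^ N = a → (x ^ (n ^ i * p ^ l)) ^ N = a) ∧
      ∀ b ∈ S, ∀ x, x ^ N = a → (1 + b * x) ^ (n ^ i * p ^ l) = 1 + b * x ^ (n ^ i * p ^ l) := by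
    have hmul : ∀ {m m' : ℕ}, ((∀ x, x ^ N = a → (x ^ m) ^ N = a) ∧
        ∀ b ∈ S, ∀ x, x ^ N = a → (1 + b * x) ^ m = 1 + b * x ^ m) →
        ((∀ x, x ^ N = a → (x ^ m') ^ N = a) ∧
        ∀ b ∈ S, ∀ x, x ^ N = a → (1 + b * x) ^ m' = 1 + b * x ^ m') →
        ((∀ x, x ^ N = a → (x ^ (m * m')) ^ N = a) ∧
        ∀ b ∈ S, ∀ x, x ^ N = a → (1 + b * x) ^ (m * m') = 1 + b * x ^ (m * m')) := by
      rintro m m' ⟨h1, h2⟩ ⟨h1', h2'⟩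
      refine ⟨fun x hx => by rw [pow_mul]; exact h1' _ (h1 x hx), fun b hb x hx => ?_⟩
      rw [pow_mul, h2 b hb x hx, h2' b hb _ (h1 x hx), ← pow_mul]
    have hone : ((∀ x, x ^ N = a → (x ^ 1) ^ N = a) ∧
        ∀ b ∈ S, ∀ x, x ^ N = a → (1 + b * x) ^ 1 = 1 + b * x ^ 1) := by simp
    have hpow : ∀ {m : ℕ}, ((∀ x, x ^ N = a → (x ^ m) ^ N = a) ∧
        ∀ b ∈ S, ∀ x, x ^ N = a → (1 + b * x) ^ m = 1 + b * x ^ m) → ∀ i : ℕ,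
        ((∀ x, x ^ N = a → (x ^ (m ^ i)) ^ N = a) ∧
        ∀ b ∈ S, ∀ x, x ^ N = a → (1 + b * x) ^ (m ^ i) = 1 + b * x ^ (m ^ i)) := by
      intro m hm i
      induction i with
      | zero => exact hone
      | succ i ih => rw [pow_succ]; exact hmul ih hm
    intro i l
    exact hmul (hpow ⟨fun x hx => by rw [← pow_mul, mul_comm, pow_mul, hx, han], hSn⟩ i)
      (hpow ⟨fun x hx => by rw [← pow_mul, mul_comm, pow_mul, hx, hap], hSp⟩ l)
  have hprod : ∀ T ⊆ S, ∀ i l, (∏ b ∈ T, (1 + b * θ)) ^ (n ^ i * p ^ l) =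
      ∏ b ∈ T, (1 + b * θ ^ (n ^ i * p ^ l)) := fun T hT i l => by
    rw [← prod_pow]
    exact prod_congr rfl fun b hb => (hE i l).2 b (hT hb) θ hθ
  have heval : ∀ (T : Finset K) x, (∏ b ∈ T, (1 + C b * X : K[X])).eval x = ∏ b ∈ T, (1 + b * x) :=
    fun T x => by rw [eval_prod]; simp
  -- If two products agree at `θ`, raising to the powers `n ^ i` shows that the polynomials agree at
  -- the `|S|` distinct points `θ ^ n ^ i`. Their degrees are below `|S|` since the subsets are
  -- proper, so they are equal.
  have hV : (S.ssubsets.image fun T => ∏ b ∈ T, (1 + b * θ)).card = 2 ^ S.card - 1 := by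
    rw [card_image_of_injOn, ssubsets, card_erase_of_mem (mem_powerset_self S), card_powerset]
    intro T hT T' hT' hTT
    replace hT := mem_ssubsets.1 (mem_coe.1 hT)
    replace hT' := mem_ssubsets.1 (mem_coe.1 hT')
    refine prod_linear_injective hS hT.1 hT'.1 ?_
    refine eq_of_degree_sub_lt_of_eval_finset_eq ((range S.card).image fun i => θ ^ n ^ i) ?_ ?_
    · rw [card_image_of_injOn, card_range]
      · refine (degree_sub_le _ _).trans_lt (max_lt ?_ ?_)
        · exact (degree_le_of_natDegree_le (natDegree_prod_linear_le T)).trans_lt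
            (by exact_mod_cast card_lt_card hT)
        · exact (degree_le_of_natDegree_le (natDegree_prod_linear_le T')).trans_lt
            (by exact_mod_cast card_lt_card hT')
      · intro i hi j hj hij
        simp only [coe_range, Set.mem_Iio] at hi hj
        rcases lt_trichotomy i j with h | h | h
        · exact absurd hij (hinj i j h hj)
        · exact h
        · exact absurd hij.symm (hinj j i h hi)
    · intro x hx
      obtain ⟨i, -, rfl⟩ := mem_image.1 hx
      have h1 := hprod T hT.1 i 0
      have h2 := hprod T' hT'.1 i 0
      rw [pow_zero, mul_one] at h1 h2
      rw [heval, heval, ← h1, ← h2]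
      exact congr_arg (· ^ n ^ i) hTT
  -- Pigeonhole: `(R + 1) ^ 2 > N` pairs of exponents, but at most `N` roots of `X ^ N - a`.
  obtain ⟨⟨i, l⟩, hil, ⟨i', l'⟩, hil', hne, heq⟩ := exists_ne_map_eq_of_card_lt_of_maps_to
    (s := range (R + 1) ×ˢ range (R + 1)) (t := (nthRoots N a).toFinset)
    (f := fun z => θ ^ (n ^ z.1 * p ^ z.2)) (by
      rw [card_product, card_range]
      exact (Multiset.toFinset_card_le _).trans_lt ((card_nthRoots N a).trans_lt hR))
    (fun z _ => by
      simp only [Multiset.mem_toFinset, mem_coe]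
      rw [mem_nthRoots hN]
      exact (hE z.1 z.2).1 θ hθ)
  refine ⟨i, l, i', l', hne, ?_⟩
  simp only [mem_product, mem_range] at hil hil'
  have hle : ∀ {i l}, i < R + 1 → l < R + 1 → n ^ i * p ^ l ≤ n ^ (2 * R) := by
    intro i l hi hl
    calc n ^ i * p ^ l ≤ n ^ i * n ^ l := Nat.mul_le_mul_left _ (Nat.pow_le_pow_left hpn l)
      _ = n ^ (i + l) := (pow_add _ _ _).symm
      _ ≤ n ^ (2 * R) := Nat.pow_le_pow_right hn (by omega)
  by_contra hmm
  set m := n ^ i * p ^ l with hm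
  set m' := n ^ i' * p ^ l' with hm'
  have hne0 : (X ^ m - X ^ m' : K[X]) ≠ 0 := fun h => by
    have h1 := congr_arg natDegree (sub_eq_zero.1 h)
    rw [natDegree_X_pow, natDegree_X_pow] at h1
    exact hmm h1
  have hdeg : (X ^ m - X ^ m' : K[X]).natDegree ≤ n ^ (2 * R) := by
    refine (natDegree_sub_le _ _).trans ?_
    rw [natDegree_X_pow, natDegree_X_pow]
    exact max_le (hle hil.1 hil.2) (hle hil'.1 hil'.2)
  have hcard := card_le_degree_of_subset_roots (p := (X ^ m - X ^ m' : K[X]))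
    (Z := S.ssubsets.image fun T => ∏ b ∈ T, (1 + b * θ)) (fun z hz => by
      obtain ⟨T, hT, rfl⟩ := mem_image.1 hz
      rw [mem_roots hne0, IsRoot.def, eval_sub, eval_pow, eval_pow, eval_X,
        hprod T (mem_ssubsets.1 hT).1, hprod T (mem_ssubsets.1 hT).1, sub_eq_zero]
      rw [heq])
  omega

/-- If `i = i'`, cancelling forces `l = l'`. Otherwise cancelling the smaller power of `n` shows
that `n` divides a power of `p`. -/
theorem eq_prime_pow_of_pow_mul_pow_eq {n p i l i' l' : ℕ} (hp : p.Prime) (hn : 0 < n)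
    (hne : (i, l) ≠ (i', l')) (h : n ^ i * p ^ l = n ^ i' * p ^ l') : ∃ b, n = p ^ b := by
  wlog hi : i ≤ i' generalizing i l i' l'
  · exact this hne.symm h.symm (by omega)
  rcases hi.eq_or_lt with rfl | hi
  · have h1 := Nat.eq_of_mul_eq_mul_left (by positivity) h
    exact absurd (by rw [Nat.pow_right_injective hp.two_le h1]) hne
  · have h1 : n ∣ p ^ l := by
      refine (dvd_pow_self n (by omega : i' - i ≠ 0)).trans ?_
      refine Nat.dvd_of_mul_dvd_mul_left (by positivity : 0 < n ^ i) ?_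
      rw [← pow_add, Nat.add_sub_cancel' hi.le, h]
      exact dvd_mul_right _ _
    obtain ⟨b, -, hb⟩ := (Nat.dvd_prime_pow hp).1 h1
    exact ⟨b, hb⟩

/-- The order of `n` modulo `2 ^ (k + e)` where `2 ^ k` is the exact power of two in `n - 1`. -/
theorem two_pow_dvd_of_dvd_pow_sub_one {n k q d e : ℕ} (hn : n % 4 = 1) (hn1 : 1 < n)
    (hk : n - 1 = 2 ^ k * (2 * q + 1)) (h : 2 ^ (k + e) ∣ n ^ d - 1) : 2 ^ e ∣ d := by
  -- Lifting the exponent at `2`: as `n ≡ 1` modulo `4`, the valuation of `n ^ d - 1` is that of `n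
  -- - 1` plus that of `d`, without parity condition on `d`.
  have h1 := Int.two_pow_sub_pow' (x := n) (y := 1) d (by omega) (by omega)
  have e1 : ((n : ℤ) ^ d - 1 ^ d) = ((n ^ d - 1 : ℕ) : ℤ) := by
    rw [Nat.cast_sub (Nat.one_le_pow _ _ (by omega))]; push_cast; simp
  have e2 : ((n : ℤ) - 1) = ((n - 1 : ℕ) : ℤ) := by
    rw [Nat.cast_sub (by omega)]; simp
  rw [e1, e2] at h1
  have h2 : ((2 : ℕ) : ℤ) = 2 := rfl
  rw [← h2, Int.natCast_emultiplicity, Int.natCast_emultiplicity, Int.natCast_emultiplicity] at h1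
  have h3 : emultiplicity 2 (n - 1) = k := by
    rw [emultiplicity_eq_coe, hk]
    refine ⟨dvd_mul_right _ _, fun h => ?_⟩
    rw [pow_succ] at h
    have := Nat.dvd_of_mul_dvd_mul_left (by positivity) h
    omega
  have h4 := le_emultiplicity_of_pow_dvd h
  rw [h1, h3] at h4
  apply pow_dvd_of_le_emultiplicity
  push_cast at h4
  exact (ENat.add_le_add_iff_left (ENat.natCast_ne_top k)).1 h4

theorem orderOf_eq_two_pow {K : Type*} [Field K] (h2 : (-1 : K) ≠ 1) {x : K} {e : ℕ}
    (hx : x ^ 2 ^ e = -1) : orderOf x = 2 ^ (e + 1) := by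
  refine orderOf_eq_prime_pow (by rw [hx]; exact h2) ?_
  rw [pow_succ, pow_mul, hx]
  norm_num

open Kronecker RAM in
/-- The polynomial congruence in every field to which `ℤ/n` maps. -/
theorem _root_.RAM.PolyTest.eq_of_pow_eq {n N a c : ℕ} (h : PolyTest n N a c) {K : Type*} [Field K]
    (ψ : ZMod n →+* K) {x : K} (hx : x ^ N = ψ a) : (1 + c * x) ^ n = 1 + c * x ^ n := by
  have h1 := congr_arg (AdjoinRoot.lift ψ x (by simp [hx])) h
  rw [map_pow] at h1
  simp only [toRing, RingHom.comp_apply, AdjoinRoot.lift_mk] at h1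
  simpa [add_comm] using h1

open Kronecker RAM in
/-- The correctness of the primality test. -/
theorem prime_of_tests {n a k q v h : ℕ} (hn : n % 4 = 1) (hn1 : 1 < n)
    (hk : n - 1 = 2 ^ k * (2 * q + 1)) (hv : v < k)
    (ha : (a : ZMod n) ^ (2 ^ (k - v - 1) * (2 * q + 1)) = -1) (hh : n ^ 4 < 2 ^ 2 ^ h)
    (hpow : ∀ b y, 2 ≤ b → y ^ b ≠ n) {f : ℕ → ℕ}
    (hf : ∀ i < 2 ^ (2 * h + 2 * v - min k (2 * h + 2 * v)), (f i).Coprime n)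
    (hunit : ∀ i < 2 ^ (2 * h + 2 * v - min k (2 * h + 2 * v)), ∀ j < i,
      IsUnit ((f i : ZMod n) ^ 2 ^ (min k (2 * h + 2 * v) - v) -
        (f j : ZMod n) ^ 2 ^ (min k (2 * h + 2 * v) - v)))
    (htest : ∀ i < 2 ^ (2 * h + 2 * v - min k (2 * h + 2 * v)),
      PolyTest n (2 ^ (2 * h + 2 * v)) a (f i)) : n.Prime := by
  classical
  set p := n.minFac with hpdef
  have hp : p.Prime := Nat.minFac_prime (by omega)
  have hpn : p ∣ n := Nat.minFac_dvd n
  have : Fact p.Prime := ⟨hp⟩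
  let K := AlgebraicClosure (ZMod p)
  let ψ : ZMod n →+* K := (algebraMap (ZMod p) K).comp (ZMod.castHom hpn (ZMod p))
  have hψ : ∀ z, ψ z ^ p = ψ z := fun z => by
    simp only [ψ, RingHom.comp_apply]
    rw [← map_pow, ZMod.pow_card]
  have : CharP K p := charP_of_injective_algebraMap (algebraMap (ZMod p) K).injective p
  have hp2 : p ≠ 2 := fun h2 => by
    rw [h2] at hpn; omega
  have h2 : (-1 : K) ≠ 1 := fun h => by
    have h3 : ((2 : ℕ) : K) = 0 := by push_cast; linear_combination -h
    rw [CharP.cast_eq_zero_iff K p] at h3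
    exact hp2 ((Nat.prime_dvd_prime_iff_eq hp Nat.prime_two).1 h3)
  obtain ⟨A, hA⟩ : ∃ A, A = ψ a := ⟨_, rfl⟩
  have hA1 : A ^ (2 ^ (k - v - 1) * (2 * q + 1)) = -1 := by rw [hA, ← map_pow, ha]; simp
  obtain ⟨s, hs⟩ : ∃ s, s = 2 * h + 2 * v := ⟨_, rfl⟩
  obtain ⟨r, hr⟩ : ∃ r, r = min k s := ⟨_, rfl⟩
  rw [← hs, ← hr] at hf hunit htest
  have hh0 : 0 < h := by
    rcases Nat.eq_zero_or_pos h with h0 | h0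
    · rw [h0] at hh
      have := Nat.le_self_pow (show 4 ≠ 0 by norm_num) n
      omega
    · exact h0
  have hrk : r ≤ k := hr ▸ min_le_left _ _
  have hrs : r ≤ s := hr ▸ min_le_right _ _
  have hvr : v < r := hr ▸ lt_min hv (by omega)
  have hAn : A ^ n = A := by
    have h1 : A ^ (n - 1) = 1 := by
      have e : 2 ^ k * (2 * q + 1) = 2 ^ (k - v - 1) * (2 * q + 1) * 2 ^ (v + 1) := by
        rw [mul_right_comm, ← pow_add]
        congr 2
        omega
      rw [hk, e, pow_mul, hA1]
      exact Even.neg_one_pow ((even_two).pow_of_ne_zero (by omega))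
    rw [← Nat.sub_add_cancel hn1.le, pow_succ, h1, one_mul]
  set N := 2 ^ s with hN
  have hN0 : 0 < N := by positivity
  obtain ⟨θ, hθ⟩ := IsAlgClosed.exists_pow_nat_eq A hN0
  -- This order exceeds `2 ^ k` by the factor `2 ^ (s - v)`, which is the number of distinct points
  -- `θ ^ n ^ i` needed below.
  have hθord : orderOf (θ ^ (2 * q + 1)) = 2 ^ (k + (s - v)) := by
    rw [show k + (s - v) = s + (k - v - 1) + 1 by omega]
    refine orderOf_eq_two_pow h2 ?_
    rw [← pow_mul, pow_add, mul_left_comm, pow_mul, hθ, mul_comm, hA1]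
  -- A power of `A` lies in the prime field, so the exponent `p` fixes `ζ`. The order `2 ^ (r - v)`
  -- divides both `n - 1` and `N` because `r ≤ k` and `r ≤ s`, so the exponent `n` fixes `ζ` too,
  -- and multiplication by `ζ` permutes the `N`-th roots of `A`.
  obtain ⟨ζ, hζ⟩ : ∃ ζ : K, ζ = A ^ (2 ^ (k - r) * (2 * q + 1)) := ⟨_, rfl⟩
  have hζord : orderOf ζ = 2 ^ (r - v) := by
    rw [show r - v = (r - v - 1) + 1 by omega]
    refine orderOf_eq_two_pow h2 ?_
    rw [hζ, ← pow_mul, mul_right_comm, ← pow_add, show k - r + (r - v - 1) = k - v - 1 by omega,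
      hA1]
  have hζpow : ∀ {e}, 2 ^ (r - v) ∣ e → ζ ^ e = 1 := fun h => orderOf_dvd_iff_pow_eq_one.1
    (hζord ▸ h)
  have hζN : ζ ^ N = 1 := hζpow (pow_dvd_pow 2 (by omega))
  have hζn : ζ ^ n = ζ := by
    have : ζ ^ (n - 1) = 1 := hζpow (hk ▸ (pow_dvd_pow 2 (by omega)).mul_right _)
    rw [← Nat.sub_add_cancel hn1.le, pow_succ, this, one_mul]
  have hζp : ζ ^ p = ζ := by rw [hζ, ← pow_mul, mul_comm, pow_mul, hA, hψ]
  have hcast : ∀ x : ℕ, ψ x = x := fun x => map_natCast ψ x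
  have hf0 : ∀ i < 2 ^ (s - r), (f i : K) ≠ 0 := fun i hi => by
    have h1 := ((ZMod.isUnit_iff_coprime _ _).2 (hf i hi)).map ψ
    rw [hcast] at h1
    exact h1.ne_zero
  have hfne : ∀ i < 2 ^ (s - r), ∀ j < i, (f i : K) ^ 2 ^ (r - v) ≠ (f j : K) ^ 2 ^ (r - v) := by
    intro i hi j hj h
    have h1 := ((hunit i hi j hj).map ψ).ne_zero
    rw [map_sub, map_pow, map_pow, hcast, hcast, h, sub_self] at h1
    exact h1 rfl
  let S : Finset K := (range (2 ^ (s - r)) ×ˢ range (2 ^ (r - v))).image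
    fun z => (f z.1 : K) * ζ ^ z.2
  -- Raising to the power `2 ^ (r - v)` removes `ζ`, so that `hfne` recovers the index `i`; the
  -- order of `ζ` then recovers `t`.
  have hScard : S.card = 2 ^ (s - v) := by
    rw [card_image_of_injOn, card_product, card_range, card_range, ← pow_add]
    · congr 1; omega
    · rintro ⟨i, t⟩ hi ⟨j, t'⟩ hj hij
      simp only [coe_product, coe_range, Set.mem_prod, Set.mem_Iio] at hi hj hij
      have h1 := congr_arg (· ^ 2 ^ (r - v)) hij
      simp only [mul_pow, ← pow_mul] at h1
      rw [hζpow (dvd_mul_left _ _), hζpow (dvd_mul_left _ _), mul_one, mul_one] at h1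
      have hij' : i = j := by
        rcases lt_trichotomy i j with h | h | h
        · exact absurd h1.symm (hfne j hj.1 i h)
        · exact h
        · exact absurd h1 (hfne i hi.1 j h)
      subst hij'
      have h3 := mul_left_cancel₀ (hf0 i hi.1) hij
      rw [pow_injOn_Iio_orderOf (hζord ▸ hi.2 : t < orderOf ζ) (hζord ▸ hj.2 : t' < orderOf ζ) h3]
  have hSmem : ∀ {b}, b ∈ S → ∃ i < 2 ^ (s - r), ∃ t, b = f i * ζ ^ t := fun hb => by
    obtain ⟨⟨i, t⟩, hz, rfl⟩ := mem_image.1 hb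
    simp only [mem_product, mem_range] at hz
    exact ⟨i, hz.1, t, rfl⟩
  have hζ0 : ζ ≠ 0 := fun h => by
    rw [h, zero_pow hN0.ne'] at hζN
    exact zero_ne_one hζN
  -- With `R = 2 ^ (h + v)` one has `R ^ 2 = N`. The number `n ^ (2 * R)` is the square root of `(n
  -- ^ 4) ^ R`, which is less than `2 ^ (2 ^ h * R) = 2 ^ |S|`.
  obtain ⟨i, l, i', l', hne, heq⟩ := exists_pow_mul_pow_eq (n := n) (p := p) (R := 2 ^ (h + v))
    hN0 hθ (S := S) (fun b hb => by
      obtain ⟨i, hi, t, rfl⟩ := hSmem hb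
      exact mul_ne_zero (hf0 i hi) (pow_ne_zero _ hζ0)) hAn (by rw [hA, hψ])
    (fun b hb x hx => by
      obtain ⟨i, hi, t, rfl⟩ := hSmem hb
      -- The test for `c` at the root `ζ ^ t * x` is the test for `c * ζ ^ t` at the root `x`.
      have h1 := (htest i hi).eq_of_pow_eq ψ (x := ζ ^ t * x)
        (by rw [mul_pow, ← pow_mul, mul_comm t, pow_mul, hζN, one_pow, one_mul, hx, hA])
      rw [mul_pow, ← pow_mul ζ, mul_comm t n, pow_mul, hζn] at h1
      rw [mul_assoc, h1, mul_assoc])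
    (fun b hb x hx => by
      obtain ⟨i, hi, t, rfl⟩ := hSmem hb
      rw [add_pow_char, one_pow, mul_pow, mul_pow, ← pow_mul, mul_comm t, pow_mul, hζp, ← hcast,
        hψ])
    (fun i j hij hj h => by
      rw [hScard] at hj
      -- A coincidence would make the order of `θ ^ (2 * q + 1)` divide `n ^ i * (n ^ (j - i) - 1)`.
      -- As `n` is odd, `2 ^ (s - v)` would divide `j - i`, which is positive and smaller.
      have h1 : (θ ^ (2 * q + 1)) ^ n ^ i = (θ ^ (2 * q + 1)) ^ n ^ j := by
        rw [← pow_mul, ← pow_mul, mul_comm, pow_mul, h, ← pow_mul, mul_comm]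
      rw [(orderOf_pos_iff.1 (hθord ▸ by positivity)).pow_eq_pow_iff_modEq, hθord] at h1
      have h3 := (Nat.modEq_iff_dvd' (Nat.pow_le_pow_right (by omega) hij.le)).1 h1
      have e1 : n ^ j - n ^ i = n ^ i * (n ^ (j - i) - 1) := by
        rw [Nat.mul_sub, mul_one, ← pow_add, Nat.add_sub_cancel' hij.le]
      rw [e1] at h3
      have hodd : Nat.Coprime (2 ^ (k + (s - v))) (n ^ i) :=
        Nat.Coprime.pow _ _ ((Nat.Prime.coprime_iff_not_dvd Nat.prime_two).2 (by omega))
      have h4 := two_pow_dvd_of_dvd_pow_sub_one hn hn1 hk (hodd.dvd_of_dvd_mul_left h3)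
      have := Nat.le_of_dvd (by omega) h4
      omega)
    (by
      rw [hN, hs, show 2 * h + 2 * v = (h + v) + (h + v) by ring, pow_add]
      nlinarith [Nat.zero_le (2 ^ (h + v))])
    (Nat.le_of_dvd (by omega) hpn) (by omega) (by
      rw [hScard]
      have e1 : n ^ (2 * 2 ^ (h + v)) * n ^ (2 * 2 ^ (h + v)) = (n ^ 4) ^ 2 ^ (h + v) := by
        rw [← pow_add, ← pow_mul]; congr 1; ring
      have e2 : (n ^ 4) ^ 2 ^ (h + v) < (2 ^ 2 ^ h) ^ 2 ^ (h + v) :=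
        Nat.pow_lt_pow_left hh (by positivity)
      have e3 : (2 ^ 2 ^ h) ^ 2 ^ (h + v) = 2 ^ 2 ^ (s - v) := by
        rw [← pow_mul, ← pow_add]; congr 2; omega
      have e4 : 2 ≤ n ^ (2 * 2 ^ (h + v)) := le_trans hn1 (Nat.le_self_pow (by positivity) n)
      rw [← e1, e3] at e2
      have e5 := Nat.mul_le_mul_right (n ^ (2 * 2 ^ (h + v))) e4
      omega)
  obtain ⟨b, hb⟩ := eq_prime_pow_of_pow_mul_pow_eq hp (by omega) hne heq
  rcases (show b = 0 ∨ b = 1 ∨ 2 ≤ b by omega) with rfl | rfl | hb2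
  · rw [pow_zero] at hb; omega
  · rw [pow_one] at hb; rw [hb]; exact hp
  · exact absurd hb.symm (hpow b p hb2)

end KummerTest

open Finset in
/-- The number of residues `c ^ W` with `c ≤ M` is at least `M / W`. -/
theorem KummerTest.le_mul_of_forall_exists {p M W m : ℕ} [Fact p.Prime] (hM : M < p) (hW : 0 < W)
    {f : ℕ → ℕ} (h : ∀ c, 0 < c → c ≤ M → ∃ i < m, (f i : ZMod p) ^ W = (c : ZMod p) ^ W) :
    M ≤ W * m := by
  classical
  have h1 := card_le_mul_card_image_of_maps_to (s := (Icc 1 M : Finset ℕ))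
    (t := (range m).image fun i => (f i : ZMod p) ^ W) (f := fun c : ℕ => (c : ZMod p) ^ W)
    (fun c hc => by
      rw [mem_Icc] at hc
      obtain ⟨i, hi, hi'⟩ := h c hc.1 hc.2
      exact mem_image.2 ⟨i, mem_range.2 hi, hi'⟩) W (fun b _ => by
      -- Each fibre consists of roots of `X ^ W - b`; distinct `c ≤ M < p` remain distinct modulo
      -- `p`.
      refine le_trans ?_ ((Multiset.toFinset_card_le _).trans (Polynomial.card_nthRoots W b))
      refine card_le_card_of_injOn (fun c : ℕ => (c : ZMod p)) (fun c hc => ?_) ?_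
      · simp only [coe_filter, Set.mem_ofPred_eq] at hc
        simpa [Polynomial.mem_nthRoots hW] using hc.2
      · intro c hc d hd hcd
        simp only [coe_filter, mem_Icc, Set.mem_ofPred_eq] at hc hd
        have h2 := (ZMod.natCast_eq_natCast_iff' _ _ _).1 hcd
        rwa [Nat.mod_eq_of_lt (by omega), Nat.mod_eq_of_lt (by omega)] at h2)
  rw [Nat.card_Icc, Nat.add_sub_cancel] at h1
  refine h1.trans (Nat.mul_le_mul_left _ (card_image_le.trans (card_range m).le))

/-! ### The complete test and its running time -/

namespace RAM

open Operand

set_option linter.unusedSimpArgs false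

/-- The factor `4` in the definition of `hh` serves this bound: `n ^ 4 < 2 ^ (4 * n.size)` and `4 *
n.size < 2 ^ hh n`. -/
theorem pow_four_lt (n : ℕ) : n ^ 4 < 2 ^ 2 ^ hh n := by
  have h1 : n ^ 4 < (2 ^ n.size) ^ 4 := Nat.pow_lt_pow_left (Nat.lt_size_self n) (by norm_num)
  rw [← pow_mul] at h1
  refine h1.trans (Nat.pow_lt_pow_right (by norm_num) ?_)
  rw [mul_comm]
  exact Nat.lt_size_self _

/-- Correctness of the verdict after all checks. -/
theorem prime_of_checks {n a k q v m : ℕ} {f : ℕ → ℕ} {σ : Mem} (hn : n % 4 = 1) (hn1 : 1 < n)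
    (hk : n - 1 = 2 ^ k * (2 * q + 1)) (hv : v < k)
    (ha : (a : ZMod n) ^ (2 ^ (k - v - 1) * (2 * q + 1)) = -1) (hMn : 2 ^ (2 * hh n + v) < n)
    (hm : m ≤ 2 ^ (2 * hh n + 2 * v - min k (2 * hh n + 2 * v)))
    (hR : Reps n (2 ^ (min k (2 * hh n + 2 * v) - v)) (2 ^ (2 * hh n + v)) m f σ)
    (hcov : m < 2 ^ (2 * hh n + 2 * v - min k (2 * hh n + 2 * v)) → ∀ c, 0 < c →
      c ≤ 2 ^ (2 * hh n + v) → ∃ i < m, f i ^ 2 ^ (min k (2 * hh n + 2 * v) - v) % n =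
        c ^ 2 ^ (min k (2 * hh n + 2 * v) - v) % n)
    (htr : ∀ c, 2 ≤ c → c < n → c ≤ 2 ^ (2 * hh n + v) → ¬ c ∣ n)
    (hpow : ∀ b y, 2 ≤ b → y ^ b ≠ n) (hco : (σ 16).Coprime n)
    (htest : ∀ i < m, PolyTest n (2 ^ (2 * hh n + 2 * v)) a (f i)) : n.Prime := by
  have hp : n.minFac.Prime := Nat.minFac_prime (by omega)
  have : Fact n.minFac.Prime := ⟨hp⟩
  have hpM : ∀ p : ℕ, p.Prime → p ∣ n → 2 ^ (2 * hh n + v) < p := fun p hp hpn => by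
    by_contra hle
    exact htr p hp.two_le (by omega) (by omega) hpn
  -- A shorter list would cover the `W`-th powers of `1, …, M` modulo the least prime factor, and
  -- there are at least `M / W` of these, which is the required number.
  have hmC : m = 2 ^ (2 * hh n + 2 * v - min k (2 * hh n + 2 * v)) := by
    refine hm.antisymm (not_lt.1 fun hlt => ?_)
    have h1 := KummerTest.le_mul_of_forall_exists (hpM _ hp (Nat.minFac_dvd n))
      (W := 2 ^ (min k (2 * hh n + 2 * v) - v)) (by positivity) (f := f) (m := m)
      (fun c hc hcM => by
        obtain ⟨i, hi, h⟩ := hcov hlt c hc hcM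
        refine ⟨i, hi, ?_⟩
        have h2 : f i ^ 2 ^ (min k (2 * hh n + 2 * v) - v) ≡
          c ^ 2 ^ (min k (2 * hh n + 2 * v) - v) [MOD n] := h
        have h3 := (ZMod.natCast_eq_natCast_iff _ _ _).2 (h2.of_dvd (Nat.minFac_dvd n))
        push_cast at h3
        exact h3)
    have h2 := Nat.mul_lt_mul_of_pos_left hlt
      (show 0 < 2 ^ (min k (2 * hh n + 2 * v) - v) by positivity)
    have hvr : v ≤ min k (2 * hh n + 2 * v) := le_min hv.le (by omega)
    have hrs := min_le_right k (2 * hh n + 2 * v)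
    rw [← pow_add, show min k (2 * hh n + 2 * v) - v +
      (2 * hh n + 2 * v - min k (2 * hh n + 2 * v)) = 2 * hh n + v by omega] at h2
    omega
  rw [hmC] at htest
  refine KummerTest.prime_of_tests hn hn1 hk hv ha (pow_four_lt n) hpow (f := f) (fun i hi => ?_)
    (fun i hi j hj => hR.unit hco i (hmC ▸ hi) j hj) htest
  -- The representatives are at most `M`, and every prime factor of `n` is larger.
  refine Nat.coprime_of_dvd fun p hp h1 h2 => ?_
  have h3 := Nat.le_of_dvd (hR.pos i (hmC ▸ hi)) h1
  have h4 := hR.le i (hmC ▸ hi)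
  have h5 := hpM p hp h2
  omega

/-- The primality test. -/
def primeP : Prog :=
  .seq (blk [setupP, trialP, blk [subP 24 (reg 0) (lit 1), subP 24 (reg 24) (reg 7)]])
    (.seq (.ite (reg 24) (.seq (blk [powerP, searchP, gcdP]) polyP) .skip)
      (addP 0 (reg 11) (lit 0)))

theorem Bdd.mono {B B' : ℕ} {σ : Mem} (h : Bdd B σ) (hB : B ≤ B') : Bdd B' σ := fun i =>
  (h i).trans_le (Nat.pow_le_pow_right (by norm_num) hB)

/-- The number of bits needed before the polynomial congruences. -/
def bits₀ (n v : ℕ) : ℕ := 8 + 4 * n.size + 2 * hh n + 2 * v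

/-- The number of bits needed for the polynomial congruences. -/
def bits₁ (n v : ℕ) : ℕ :=
  4 * (4 * n.size + (2 * hh n + 2 * v) + 1) * 2 ^ (2 * hh n + 2 * v)

/-- A bound for the running time. -/
def time (n k v : ℕ) : ℕ :=
  (4 * n.size + 3 * v + 4 * hh n + 24 + (9 * 2 ^ (2 * hh n + v) + 5 + 2)) * (9 * bits₀ n v) +
  ((20 * (n.size + 1) ^ 3 + (2 ^ (2 * hh n + v) * (6 * (min k (2 * hh n + 2 * v) - v) +
    15 * 2 ^ (2 * hh n + 2 * v - min k (2 * hh n + 2 * v)) + 17) + 4 + (12 * n.size + 7))) *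
      (9 * bits₀ n v) +
  (3 * (2 * hh n + 2 * v) + 17 + 2 ^ (2 * hh n + 2 * v - min k (2 * hh n + 2 * v)) *
    (56 * n.size + 36)) * (9 * bits₁ n v) + 18 * bits₁ n v) + 9 * bits₁ n v

theorem bits₀_le_bits₁ (n v : ℕ) (hn : 1 < n) : bits₀ n v ≤ bits₁ n v := by
  have h0 : 0 < n.size := Nat.size_pos.2 (by omega)
  have h1 : 1 ≤ hh n := Nat.size_pos.2 (by omega)
  have h2 : 2 ^ 2 ≤ 2 ^ (2 * hh n + 2 * v) := Nat.pow_le_pow_right (by norm_num) (by omega)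
  have h3 := Nat.mul_le_mul_left (4 * (4 * n.size + (2 * hh n + 2 * v) + 1)) h2
  unfold bits₀ bits₁
  omega

/-- The factors `n`, `n`, `n + 1`, `n` account for `4 * n.size` in the exponent and `2 * N` for the
rest. A product of two packed polynomials has `2 * N` digits of `2 * r` bits, which is `bits₁`. -/
theorem sizes {n a v : ℕ} (hn : 1 < n) (ha : a < n) : Sizes n a (2 ^ (2 * hh n + 2 * v))
    (4 * n.size + (2 * hh n + 2 * v) + 1) (bits₁ n v) where
  eight_le := (by unfold bits₀; omega : 8 ≤ bits₀ n v).trans (bits₀_le_bits₁ n v hn)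
  one_lt := hn
  lt := ha
  two_le := Nat.le_self_pow (by
    have : 0 < hh n := Nat.size_pos.2 (Nat.mul_pos (by norm_num) (Nat.size_pos.2 (by omega)))
    omega) 2
  le := by
    have h1 := Nat.lt_size_self n
    calc 2 * 2 ^ (2 * hh n + 2 * v) * (n * n) * (n + 1) * n
        ≤ 2 * 2 ^ (2 * hh n + 2 * v) * (2 ^ n.size * 2 ^ n.size) * 2 ^ n.size * 2 ^ n.size := by
          gcongr
          exact h1
      _ = 2 ^ (4 * n.size + (2 * hh n + 2 * v) + 1) := by ring
  bits := by
    rw [← pow_add, ← pow_add, ← pow_mul]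
    refine Nat.pow_le_pow_right (by norm_num) (le_of_eq ?_)
    unfold bits₁
    ring

/-- Two register widths are used: the many rounds of trial division and of the search are charged at
the short width `bits₀`. The width `bits₁` is charged for the polynomial congruences and for
boundedly many further instructions. -/
theorem primeP_spec {n a k q v : ℕ} (hn : n % 4 = 1) (hn1 : 1 < n)
    (hk : n - 1 = 2 ^ k * (2 * q + 1)) (hv : v < k) (han : a < n)
    (ha : (a : ZMod n) ^ (2 ^ (k - v - 1) * (2 * q + 1)) = -1) :
    ∃ t τ, primeP.Runs (init n a (v + 1)) t τ ∧ t ≤ time n k v ∧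
      (n.Prime → τ 0 = 1) ∧ (¬ n.Prime → τ 0 = 0) := by
  have hB8 : 8 ≤ bits₀ n v := by unfold bits₀; omega
  have hp0 : ∀ {p}, p < bits₀ n v → 2 ^ p < 2 ^ bits₀ n v := fun h =>
    Nat.pow_lt_pow_right (by norm_num) h
  have hL := Nat.lt_size_self n
  have hnB : n < 2 ^ bits₀ n v := hL.trans (hp0 (by unfold bits₀; omega))
  have hnnB : n * n < 2 ^ bits₀ n v := by
    refine (Nat.mul_lt_mul'' hL hL).trans ?_
    rw [← pow_add]
    exact hp0 (by unfold bits₀; omega)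
  have hinit : Bdd (bits₀ n v) (init n a (v + 1)) := by
    have h1 : v + 1 < 2 ^ bits₀ n v := (by unfold bits₀; omega : v + 1 < bits₀ n v).trans
      Nat.lt_two_pow_self
    intro i
    match i with
    | 0 => exact hnB
    | 1 => exact han.trans hnB
    | 2 => exact h1
    | i + 3 => exact Nat.two_pow_pos _
  have hs := sizes (v := v) hn1 han
  have hb01 := bits₀_le_bits₁ n v hn1
  obtain ⟨M, hM⟩ : ∃ M, M = 2 ^ (2 * hh n + v) := ⟨_, rfl⟩
  obtain ⟨C, hC⟩ : ∃ C, C = 2 ^ (2 * hh n + 2 * v - min k (2 * hh n + 2 * v)) := ⟨_, rfl⟩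
  have hC0 : 0 < C := hC ▸ Nat.two_pow_pos _
  have hC64 : C + 64 < 2 ^ bits₀ n v := by
    have h1 : C ≤ 2 ^ (2 * hh n + 2 * v) := hC ▸ Nat.pow_le_pow_right (by norm_num) (by omega)
    have h2 := Nat.two_pow_pos (2 * hh n + 2 * v)
    have h3 : 2 ^ (2 * hh n + 2 * v + 7) < 2 ^ bits₀ n v := hp0 (by unfold bits₀; omega)
    rw [pow_add] at h3
    omega
  -- setup and trial division
  obtain ⟨t₁, τ₁, hr₁, ht₁, hb₁, ⟨hP, hF⟩, h24⟩ : ∃ t τ, (blk [setupP, trialP,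
      blk [subP 24 (reg 0) (lit 1), subP 24 (reg 24) (reg 7)]]).Runs (init n a (v + 1)) t τ ∧
      t ≤ (4 * n.size + 3 * v + 4 * hh n + 24 + (9 * 2 ^ (2 * hh n + v) + 5 + 2)) *
        (9 * bits₀ n v) ∧ Bdd (bits₀ n v) τ ∧ (Params n a k v τ ∧ Flag n (True ∧
          ∀ c, 2 ≤ c → c < n → c ≤ 2 ^ (2 * hh n + v) → ¬ c ∣ n) τ) ∧ τ 24 = n - 1 - M := by
    refine Tri.cons (setupP_spec le_rfl hk hv) ?_ hinit
    rintro τ ⟨hP, h11⟩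
    refine Tri.cons (trialP_spec hB8 hn1 hP (A := True) ⟨h11.le, fun _ => h11, fun _ => trivial⟩) ?_
    rintro ρ ⟨hP, hF⟩
    rw [blk_singleton]
    refine Tri.of_wp hB8 rfl fun hb => ?_
    simp only [blk_cons, blk_singleton, wp, val, Dest.addr]
    refine ⟨⟨hP.congr (by simp [Function.update_apply]), hF.congr rfl id⟩, ?_⟩
    simp [Function.update_apply, hP.eq_n, hP.eq_M, hM]
  -- the other checks
  obtain ⟨t₂, τ₂, hr₂, ht₂, hb₂, hF₂⟩ : ∃ t τ,
      (Prog.ite (reg 24) (.seq (blk [powerP, searchP, gcdP]) polyP) .skip).Runs τ₁ t τ ∧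
      t ≤ (20 * (n.size + 1) ^ 3 + (2 ^ (2 * hh n + v) * (6 * (min k (2 * hh n + 2 * v) - v) +
        15 * 2 ^ (2 * hh n + 2 * v - min k (2 * hh n + 2 * v)) + 17) + 4 + (12 * n.size + 7))) *
        (9 * bits₀ n v) + (3 * (2 * hh n + 2 * v) + 17 + 2 ^ (2 * hh n + 2 * v -
          min k (2 * hh n + 2 * v)) * (56 * n.size + 36)) * (9 * bits₁ n v) + 18 * bits₁ n v ∧
      Bdd (bits₁ n v) τ ∧ Flag n n.Prime τ := by
    have hcost := Operand.cost_le hB8 hb₁ (x := reg 24) rfl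
    by_cases hz : τ₁ 24 = 0
    -- Here `n - 1 ≤ M`, so trial division has already passed the square root of `n`.
    · refine ⟨_, _, .ite_false hz (.skip _), by omega, hb₁.mono hb01, hF.congr rfl fun h => ?_⟩
      refine Nat.prime_def_le_sqrt.2 ⟨hn1, fun m hm hm' => h.2 m hm ?_ ?_⟩ <;>
      · have := Nat.sqrt_lt_self hn1
        omega
    · have hMn : M < n := by omega
      obtain ⟨t, τ, hr, ht, hb, hP, m, f, hm, hR, hcov, hF⟩ : ∃ t τ,
          (blk [powerP, searchP, gcdP]).Runs τ₁ t τ ∧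
          t ≤ (20 * (n.size + 1) ^ 3 + (2 ^ (2 * hh n + v) * (6 * (min k (2 * hh n + 2 * v) - v) +
            15 * 2 ^ (2 * hh n + 2 * v - min k (2 * hh n + 2 * v)) + 17) + 4 +
              (12 * n.size + 7))) * (9 * bits₀ n v) ∧ Bdd (bits₀ n v) τ ∧ Params n a k v τ ∧
          ∃ m f, m ≤ C ∧ Reps n (2 ^ (min k (2 * hh n + 2 * v) - v)) M m f τ ∧
          (m < C → ∀ c, 0 < c → c ≤ M → ∃ i < m, f i ^ 2 ^ (min k (2 * hh n + 2 * v) - v) % n =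
            c ^ 2 ^ (min k (2 * hh n + 2 * v) - v) % n) ∧
          Flag n (((True ∧ ∀ c, 2 ≤ c → c < n → c ≤ 2 ^ (2 * hh n + v) → ¬ c ∣ n) ∧
            ∀ b y, 2 ≤ b → y ^ b ≠ n) ∧ (τ 16).Coprime n) τ := by
        refine Tri.cons (powerP_spec (by unfold bits₀; omega) hn1 hP hF) ?_ hb₁
        rintro τ ⟨hP, hF⟩
        rw [← hC, ← hM]
        refine Tri.cons (searchP_spec hB8 hn1 hnnB hMn hC0 hC64 hP hF (hM ▸ hP.eq_M)
          (hC ▸ hP.eq_C) hP.eq_W) ?_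
        rintro ρ ⟨hP, hF, h16, hpr, m, f, hm, hR, hcov⟩
        rw [blk_singleton]
        refine (gcdP_spec hB8 hn1 hP.eq_n hF rfl h16 hpr).mono le_rfl ?_
        rintro μ - ⟨hμ, hF⟩
        exact ⟨hP.congr fun j hj => hμ j (by simp at hj ⊢; omega), m, f, hm,
          hR.congr (hμ 15 (by simp)) (by rw [hμ 16 (by simp)]; exact id)
            fun i hi => hμ i (by simp; omega), hcov, hF.congr rfl fun h => by
              simpa only [hμ 16 (by simp), hM] using h⟩
      obtain ⟨t', τ', hr', ht', hb', hF'⟩ := polyP_spec hs rfl rfl hMn (by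
        have := Nat.pow_le_pow_right (n := 2) (by norm_num) hb01
        omega) hP hR hF (hb.mono hb01)
      refine ⟨_, _, .ite_true hz (.seq hr hr'), ?_, hb', hF'.congr rfl fun h => ?_⟩
      · have h1 := Nat.mul_le_mul_right (9 * bits₁ n v)
          (Nat.add_le_add_left (Nat.mul_le_mul_right (56 * n.size + 36) hm)
            (3 * (2 * hh n + 2 * v) + 17))
        rw [hC] at h1
        omega
      · subst hM hC
        exact prime_of_checks hn hn1 hk hv ha hMn hm hR hcov h.1.1.1.2 h.1.1.2 h.1.2 h.2
  have h11 := hb₂ 11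
  obtain ⟨t₃, τ₃, hr₃, ht₃, hb₃, hτ₃⟩ := Tri.of_wp (P := addP 0 (reg 11) (lit 0))
    (Q := fun τ => τ 0 = τ₂ 11) hs.eight_le rfl (fun _ => by
      simp [wp, val, Dest.addr, h11]) hb₂
  refine ⟨_, _, .seq hr₁ (.seq hr₂ hr₃), ?_, fun h => ?_, fun h => ?_⟩
  · simp only [Prog.size, one_mul] at ht₃
    unfold time
    omega
  · rw [hτ₃, hF₂.2.1 h]
  · rw [hτ₃]
    have := hF₂.1
    by_contra h0
    exact h (hF₂.2.2 (by omega))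

theorem two_pow_hh_le {n : ℕ} (hn : 1 < n) : 2 ^ hh n ≤ 8 * n.size := by
  have h0 : 0 < n.size := Nat.size_pos.2 (by omega)
  have h1 : 0 < hh n := Nat.size_pos.2 (by omega)
  have h2 : 2 ^ (hh n - 1) ≤ 4 * n.size := Nat.lt_size.1 (show hh n - 1 < (4 * n.size).size by
    unfold hh at *; omega)
  obtain ⟨h, hh'⟩ : ∃ h, hh n = h + 1 := ⟨hh n - 1, by omega⟩
  rw [hh', Nat.add_sub_cancel] at h2
  rw [hh', pow_succ]
  omega

/-- The dominant term is `C` tests of `O(L)` operations on `O(L ^ 3 * V ^ 2)` bits, where `L =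
n.size` and `V = 2 ^ v`. Every other term is absorbed into `C * V ^ 2 * L ^ 4` because `C`, `V` and
`L` are at least `1`. -/
theorem time_le {n k v : ℕ} (hn : 4 < n) (hk : k ≤ n.size) (hv : v ≤ n.size) :
    time n k v ≤ 10 ^ 7 *
      (2 ^ (2 * hh n + 2 * v - min k (2 * hh n + 2 * v)) * (2 ^ v) ^ 2 * n.size ^ 4) := by
  have hH := two_pow_hh_le (n := n) (by omega)
  have hhH : hh n < 2 ^ hh n := Nat.lt_two_pow_self
  have hL : 3 ≤ n.size := Nat.lt_size.2 (by omega)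
  have hV : 0 < 2 ^ v := Nat.two_pow_pos v
  have hC : 0 < 2 ^ (2 * hh n + 2 * v - min k (2 * hh n + 2 * v)) := Nat.two_pow_pos _
  have hM : 2 ^ (2 * hh n + v) ≤ 64 * n.size ^ 2 * 2 ^ v := by
    calc 2 ^ (2 * hh n + v) = (2 ^ hh n) ^ 2 * 2 ^ v := by ring
      _ ≤ (8 * n.size) ^ 2 * 2 ^ v := by gcongr
      _ = _ := by ring
  have hN : 2 ^ (2 * hh n + 2 * v) ≤ 64 * n.size ^ 2 * (2 ^ v) ^ 2 := by
    calc 2 ^ (2 * hh n + 2 * v) = 2 ^ (2 * hh n + v) * 2 ^ v := by ring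
      _ ≤ 64 * n.size ^ 2 * 2 ^ v * 2 ^ v := by gcongr
      _ = _ := by ring
  have hb₀ : bits₀ n v ≤ 30 * n.size := by unfold bits₀; omega
  have hb₁ : bits₁ n v ≤ 5888 * (n.size ^ 3 * (2 ^ v) ^ 2) := by
    calc bits₁ n v ≤ 4 * (23 * n.size) * (64 * n.size ^ 2 * (2 ^ v) ^ 2) := by
          unfold bits₁
          gcongr
          omega
      _ = _ := by ring
  have hmin : min k (2 * hh n + 2 * v) - v ≤ n.size := by omega
  have h3s : 3 * (2 * hh n + 2 * v) + 17 ≤ 71 * n.size := by omega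
  have hfst : 4 * n.size + 3 * v + 4 * hh n + 24 + (9 * 2 ^ (2 * hh n + v) + 5 + 2) ≤
      9 * 2 ^ (2 * hh n + v) + 70 * n.size := by omega
  unfold time
  generalize 2 ^ (2 * hh n + 2 * v - min k (2 * hh n + 2 * v)) = C at *
  generalize 2 ^ (2 * hh n + v) = M at *
  generalize min k (2 * hh n + 2 * v) - v = w at *
  generalize 2 ^ v = V at *
  generalize n.size = L at *
  have hLVC : ∀ i j l, i ≤ 4 → j ≤ 2 → l ≤ 1 → L ^ i * V ^ j * C ^ l ≤ C * V ^ 2 * L ^ 4 := by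
    intro i j l hi hj hl
    calc L ^ i * V ^ j * C ^ l ≤ L ^ 4 * V ^ 2 * C ^ 1 := by
          gcongr
          all_goals omega
      _ = _ := by ring
  have e1 : (4 * L + 3 * v + 4 * hh n + 24 + (9 * M + 5 + 2)) * (9 * bits₀ n v) ≤
      174420 * (C * V ^ 2 * L ^ 4) := by
    calc _ ≤ (9 * (64 * L ^ 2 * V) + 70 * L) * (9 * (30 * L)) := by
          gcongr ?_ * ?_
          · exact hfst.trans (by gcongr)
          · gcongr
      _ = 155520 * (L ^ 3 * V ^ 1 * C ^ 0) + 18900 * (L ^ 2 * V ^ 0 * C ^ 0) := by ring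
      _ ≤ 155520 * (C * V ^ 2 * L ^ 4) + 18900 * (C * V ^ 2 * L ^ 4) := by
          linarith [hLVC 3 1 0 (by simp) (by simp) (by simp),
            hLVC 2 0 0 (by simp) (by simp) (by simp)]
      _ = _ := by ring
  have e2 : (20 * (L + 1) ^ 3 + (M * (6 * w + 15 * C + 17) + 4 + (12 * L + 7))) *
      (9 * bits₀ n v) ≤ 706050 * (C * V ^ 2 * L ^ 4) := by
    calc _ ≤ (20 * (2 * L) ^ 3 + (64 * L ^ 2 * V * (23 * L + 15 * C) + 23 * L)) *
          (9 * (30 * L)) := by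
          gcongr ?_ * ?_
          · gcongr ?_ + ?_
            · gcongr
              omega
            · have : M * (6 * w + 15 * C + 17) ≤ 64 * L ^ 2 * V * (23 * L + 15 * C) :=
                Nat.mul_le_mul hM (by omega)
              omega
          · gcongr
      _ = 43200 * (L ^ 4 * V ^ 0 * C ^ 0) + 397440 * (L ^ 4 * V ^ 1 * C ^ 0) +
          259200 * (L ^ 3 * V ^ 1 * C ^ 1) + 6210 * (L ^ 2 * V ^ 0 * C ^ 0) := by ring
      _ ≤ 43200 * (C * V ^ 2 * L ^ 4) + 397440 * (C * V ^ 2 * L ^ 4) +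
          259200 * (C * V ^ 2 * L ^ 4) + 6210 * (C * V ^ 2 * L ^ 4) := by
          linarith [hLVC 4 0 0 (by simp) (by simp) (by simp),
            hLVC 4 1 0 (by simp) (by simp) (by simp),
            hLVC 3 1 1 (by simp) (by simp) (by simp),
            hLVC 2 0 0 (by simp) (by simp) (by simp)]
      _ = _ := by ring
  have e3 : (3 * (2 * hh n + 2 * v) + 17 + C * (56 * L + 36)) * (9 * bits₁ n v) ≤
      8637696 * (C * V ^ 2 * L ^ 4) := by
    calc _ ≤ (71 * L + C * (92 * L)) * (9 * (5888 * (L ^ 3 * V ^ 2))) := by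
          gcongr
          omega
      _ = 3762432 * (L ^ 4 * V ^ 2 * C ^ 0) + 4875264 * (L ^ 4 * V ^ 2 * C ^ 1) := by ring
      _ ≤ 3762432 * (C * V ^ 2 * L ^ 4) + 4875264 * (C * V ^ 2 * L ^ 4) := by
          linarith [hLVC 4 2 0 (by simp) (by simp) (by simp),
            hLVC 4 2 1 (by simp) (by simp) (by simp)]
      _ = _ := by ring
  have e4 : L ^ 3 * V ^ 2 ≤ C * V ^ 2 * L ^ 4 := by
    simpa using hLVC 3 2 0 (by norm_num) (by norm_num) (by norm_num)
  omega

theorem size_le_two_mul_logb {n : ℕ} (hn : 1 < n) : (n.size : ℝ) ≤ 2 * Real.logb 2 n := by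
  have h0 : 0 < n.size := Nat.size_pos.2 (by omega)
  have h1 : 2 ^ (n.size - 1) ≤ n := Nat.lt_size.1 (by omega)
  have h2 : ((n.size - 1 : ℕ) : ℝ) ≤ Real.logb 2 n := by
    rw [Real.le_logb_iff_rpow_le (by norm_num) (by positivity), Real.rpow_natCast]
    exact_mod_cast h1
  have h3 : 1 ≤ Real.logb 2 n := by
    rw [Real.le_logb_iff_rpow_le (by norm_num) (by positivity), Real.rpow_one]
    exact_mod_cast hn
  push_cast [Nat.cast_sub h0] at h2
  linarith

/-- From `2 ^ hh n ≤ 8 * n.size ≤ 16 * log n`. Rounding the parameter up in this way enlarges the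
number of tests by at most the factor `2 ^ 8`. -/
theorem two_mul_hh_le {n : ℕ} (hn : 1 < n) :
    (2 * hh n : ℤ) ≤ 8 + ⌈2 * Real.logb 2 (Real.logb 2 (n : ℝ))⌉ := by
  have h1 := size_le_two_mul_logb hn
  have h2 : ((2 ^ hh n : ℕ) : ℝ) ≤ ((8 * n.size : ℕ) : ℝ) := by exact_mod_cast two_pow_hh_le hn
  push_cast at h2
  have h0 : 0 < Real.logb 2 n := Real.logb_pos (by norm_num) (by exact_mod_cast hn)
  have h3 : (hh n : ℝ) ≤ Real.logb 2 (2 ^ 4 * Real.logb 2 n) := by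
    rw [Real.le_logb_iff_rpow_le (by norm_num) (by positivity), Real.rpow_natCast]
    linarith
  rw [Real.logb_mul (by norm_num) h0.ne', Real.logb_pow, Real.logb_self_eq_one (by norm_num)] at h3
  have h4 := Int.le_ceil (2 * Real.logb 2 (Real.logb 2 (n : ℝ)))
  have h5 : ((2 * hh n : ℤ) : ℝ) ≤ ((8 + ⌈2 * Real.logb 2 (Real.logb 2 (n : ℝ))⌉ : ℤ) : ℝ) := by
    push_cast at h3 ⊢
    linarith
  exact_mod_cast h5

end RAM

/-- One fixed program, on input `n`, the residue of `a` modulo `n`, and `u`, halts with `1` in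
register `0` if `n` is prime and with `0` there if not, within the claimed time. -/
theorem corollary5p1 :
    ∃ (P : RAM.Prog) (g : ℕ → ℝ),
      IsSoftO g (fun n => (Real.logb 2 (n : ℝ)) ^ 4) ∧
      ∀ (n k u : ℕ) (s a : ℤ),
        n % 4 = 1 →
        k = padicValNat 2 (n - 1) →
        s = ⌈2 * Real.logb 2 (Real.logb 2 (n : ℝ))⌉ →
        1 ≤ u → u ≤ k →
        a ^ ((n - 1) / 2 ^ u) ≡ -1 [ZMOD (n : ℤ)] →
        ∃ (t : ℕ) (σ : RAM.Mem),
          P.Runs (RAM.init n (a % (n : ℤ)).toNat u) t σ ∧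
          (n.Prime → σ 0 = 1) ∧ (¬ n.Prime → σ 0 = 0) ∧
          (t : ℝ) ≤ (2 : ℝ) ^ (2 * ((u : ℤ) - 1)) *
            (2 : ℝ) ^ (max (s + 2 * ((u : ℤ) - 1) - (k : ℤ)) 0) * g n := by
  -- The constant combines `10 ^ 7` from `RAM.time_le`, `2 ^ 8` from `RAM.two_mul_hh_le` and `2 ^ 4`
  -- from `n.size ≤ 2 * log n`. No factor `log log n` is lost, so the soft-O exponent is `0`.
  refine ⟨RAM.primeP, fun n => 10 ^ 7 * 2 ^ 12 * Real.logb 2 n ^ 4, ⟨0, ?_⟩, ?_⟩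
  · simp only [pow_zero, mul_one]
    exact Asymptotics.isBigO_const_mul_self _ _ _
  rintro n k u s a hn hk hs hu huk ha
  -- For `n = 1` the valuation of `0` is `0` by convention, contradicting `1 ≤ u ≤ k`.
  have hn1 : 1 < n := by
    by_contra h
    have : n = 1 := by omega
    subst this
    simp at hk
    omega
  obtain ⟨v, rfl⟩ : ∃ v, u = v + 1 := ⟨u - 1, by omega⟩
  obtain ⟨q, hq⟩ : ∃ q, n - 1 = 2 ^ k * (2 * q + 1) := by
    obtain ⟨e, m, hm, he⟩ := Nat.exists_eq_two_pow_mul_odd (n := n - 1) (by omega)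
    obtain ⟨q, rfl⟩ := hm
    refine ⟨q, ?_⟩
    rw [hk, he, padicValNat_base_pow_mul (by norm_num) (by omega),
      padicValNat.eq_zero_of_not_dvd (by omega), zero_add]
  have hn0 : (n : ℤ) ≠ 0 := by omega
  have hmod := Int.emod_nonneg a hn0
  have han : (a % (n : ℤ)).toNat < n := by
    have := Int.emod_lt_of_pos a (by omega : (0 : ℤ) < n)
    omega
  have hexp : (n - 1) / 2 ^ (v + 1) = 2 ^ (k - v - 1) * (2 * q + 1) := by
    refine Nat.div_eq_of_eq_mul_right (by positivity) ?_
    rw [hq, ← mul_assoc, ← pow_add]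
    congr 2
    omega
  have hcast : (((a % (n : ℤ)).toNat : ℕ) : ZMod n) = (a : ZMod n) := by
    rw [← Int.cast_natCast, Int.toNat_of_nonneg hmod, ZMod.intCast_mod]
  have haZ : (((a % (n : ℤ)).toNat : ℕ) : ZMod n) ^ (2 ^ (k - v - 1) * (2 * q + 1)) = -1 := by
    rw [hcast, ← hexp]
    have := (ZMod.intCast_eq_intCast_iff _ _ _).2 ha
    push_cast at this
    exact this
  obtain ⟨t, τ, hr, ht, h1, h2⟩ := RAM.primeP_spec hn hn1 hq (by omega) han haZ
  refine ⟨t, τ, hr, h1, h2, ?_⟩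
  have hkn : k ≤ n.size := by
    have h3 : 2 ^ k ≤ n := (Nat.le_mul_of_pos_right _ (by omega)).trans (hq ▸ Nat.sub_le n 1)
    exact (Nat.lt_size.2 h3).le
  have htime := ht.trans (RAM.time_le (by omega) hkn (by omega : v ≤ n.size))
  have hl0 : 0 < Real.logb 2 n := Real.logb_pos (by norm_num) (by exact_mod_cast hn1)
  have hC : (2 : ℝ) ^ (2 * RAM.hh n + 2 * v - min k (2 * RAM.hh n + 2 * v)) ≤
      2 ^ 8 * 2 ^ (max (s + 2 * (v : ℤ) - k) 0) := by
    rw [← zpow_natCast, ← zpow_natCast 2 8, ← zpow_add₀ (by norm_num)]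
    refine zpow_le_zpow_right₀ (by norm_num) ?_
    have := RAM.two_mul_hh_le hn1
    rw [← hs] at this
    push_cast
    omega
  have hv : (2 : ℝ) ^ (2 * (((v + 1 : ℕ) : ℤ) - 1)) = (2 ^ v) ^ 2 := by
    rw [← pow_mul, ← zpow_natCast]
    congr 1
    push_cast
    ring
  have hv' : ((v + 1 : ℕ) : ℤ) - 1 = v := by push_cast; ring
  rw [hv, hv']
  calc (t : ℝ) ≤ 10 ^ 7 * (2 ^ (2 * RAM.hh n + 2 * v - min k (2 * RAM.hh n + 2 * v)) *
        (2 ^ v) ^ 2 * n.size ^ 4) := by exact_mod_cast htime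
    _ ≤ 10 ^ 7 * (2 ^ 8 * 2 ^ (max (s + 2 * (v : ℤ) - k) 0) * (2 ^ v) ^ 2 *
        (2 * Real.logb 2 n) ^ 4) := by
        gcongr
        exact RAM.size_le_two_mul_logb hn1
    _ = _ := by ring
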